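/- Let $(W,S)$ be a Coxeter system with $S$ finite, with length function $|\cdot|$, and write $v\le w$ if $|v^{-1}w|=|w|-|v|$ (the weak right Bruhat order). Let $\mathbb{R}_{>0}^{(W,S)}$ be the set of $q=(q_s)_{s\in S}$ with $q_s>0$ and $q_s=q_t$ whenever $s,t$ are conjugate in $W$. For such $q$ let $T_s^{(q)}$ ($s\in S$) be the bounded operator on $\ell^2(W)$ with $T_s^{(q)}\delta_w=\delta_{sw}$ if $|sw|>|w|$ and $T_s^{(q)}\delta_w=\delta_{sw}+q_s^{-1/2}(q_s-1)\delta_w$ if $|sw|<|w|$. Let $C^*_{r,q}(W)\subseteq\mathcal{B}(\ell^2(W))$ be the C$^*$-algebra generated by $1$ and the $T_s^{(q)}$, $s\in S$, and let $\mathfrak{A}(W)$ be the C$^*$-algebra generated by all $C^*_{r,q}(W)$, $q\in\mathbb{R}_{>0}^{(W,S)}$. It contains the left translations $T_w^{(1)}\colon\delta_v\mapsto\delta_{wv}$ and the orthogonal projections $P_w$ onto $\overline{\mathrm{span}}\{\delta_v: w\le v\}$, $w\in W$. Let $\pi$ be the quotient map of $\mathcal{B}(\ell^2(W))$ by the compact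 operators. A sequence $(x_i)$ in $W$ converges if for every $v\in W$ either $v\le x_i$ for all large $i$ (written $v\le(x_i)$) or $v\not\le x_i$ for all large $i$; two convergent sequences are equivalent if they have the same $v\in W$ below them. The boundary $\partial(W,S)$ is the set of equivalence classes $z$ of convergent sequences with $\sup\{|v| : v\le z\}=\infty$, with the topology generated by the sets $\{z: v\le z\}$ and $\{z: v\not\le z\}$, $v\in W$; it is a compact Hausdorff space on which $W$ acts continuously by extending left multiplication. Let $\lambda_w$ be the canonical unitaries of the reduced crossed product $C(\partial(W,S))\rtimes_r W$, and $\chi_w\in C(\partial(W,S))$ the characteristic function of $\{z: w\le z\}$. For $q\in\mathbb{R}_{>0}^{(W,S)}$ put $q_w=q_{s_1}\cdots q_{s_n}$ for a reduced expression $w=s_1\cdots s_n$, and let $\mathcal{R}'$ be the set of all $(q_s^{\epsilon_s})_{s\in S}$, where $q\in\mathbb{R}_{>0}^{(W,S)}$ with $\sum_{w\in W}q_w<\infty$ and $\epsilon\in\{-1,1\}^S$ with $\epsilon_s=\epsilon_t$ whenever $s,t$ are conjugate in $W$. Then there is a $*$-isomorphism $\kappa\colon\pi(\mathfrak{A}(W))\to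 C(\partial(W,S))\rtimes_r W$ with $\kappa(\pi(P_w))=\chi_w$ and $\kappa(\pi(T_w^{(1)}))=\lambda_w$ for all $w\in W$, and for every $q\in\mathbb{R}_{>0}^{(W,S)}\setminus\mathcal{R}'$ the map $\kappa\circ\pi|_{\mathfrak{A}(W)}$ restricts to an injective $*$-homomorphism $C^*_{r,q}(W)\to C(\partial(W,S))\rtimes_r W$. -/

import Mathlib

open Filter Topology
open scoped ENNReal

namespace HeckeBoundary

section WeakOrder

variable {B W : Type*} [Group W] {M : CoxeterMatrix B} (cs : CoxeterSystem M W)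

/-- The weak right Bruhat order: `w` starts with `v`, i.e. `|v⁻¹w| = |w| - |v|`. -/
def WeakLE (v w : W) : Prop := cs.length v + cs.length (v⁻¹ * w) = cs.length w

lemma end_mul_apply {α : Type*} (f g : Function.End α) (x : α) : (f * g) x = f (g x) := rfl

lemma end_one_apply {α : Type*} (x : α) : (1 : Function.End α) x = x := rfl

/-- The involution of `W × ℤ/2` attached to a simple reflection. -/
def reflFlip [DecidableEq W] (i : B) : Function.End (W × ZMod 2) := fun p =>
  (cs.simple i * p.1 * cs.simple i, p.2 + if p.1 = cs.simple i then 1 else 0)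

lemma reflFlip_mul_pow [DecidableEq W] (i j : B) (n : ℕ) (p : W × ZMod 2) :
    ((reflFlip cs i * reflFlip cs j) ^ n) p =
      ((cs.simple i * cs.simple j) ^ n * p.1 * ((cs.simple i * cs.simple j) ^ n)⁻¹,
        p.2 + ∑ l ∈ Finset.range (2 * n),
          if p.1 = cs.simple j * (cs.simple i * cs.simple j) ^ l then 1 else 0) := by
  have hcomm : ∀ m : ℕ, cs.simple j * (cs.simple i * cs.simple j) ^ m =
      ((cs.simple i * cs.simple j) ^ m)⁻¹ * cs.simple j := by
    intro m
    have : (cs.simple j * (cs.simple i * cs.simple j) * (cs.simple j)⁻¹) ^ m =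
        ((cs.simple i * cs.simple j)⁻¹) ^ m := by
      congr 1; simp [mul_assoc]
    rw [conj_pow, inv_pow] at this
    rw [← this]; group
  induction n with
  | zero => ext <;> simp [end_one_apply]
  | succ n ih =>
    rw [pow_succ', end_mul_apply, ih]
    simp only [end_mul_apply, reflFlip]
    set a := cs.simple i * cs.simple j with ha
    refine Prod.ext ?_ ?_
    · rw [pow_succ' a, mul_inv_rev]
      simp [ha, mul_assoc]
    · have e1 : (a ^ n * p.1 * (a ^ n)⁻¹ = cs.simple j) ↔ p.1 = cs.simple j * a ^ (2 * n) := by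
        rw [two_mul, pow_add, ← mul_assoc, hcomm n, mul_inv_eq_iff_eq_mul, mul_assoc (a ^ n)⁻¹,
          eq_inv_mul_iff_mul_eq]
      have e2 : (cs.simple j * (a ^ n * p.1 * (a ^ n)⁻¹) * cs.simple j = cs.simple i) ↔
          p.1 = cs.simple j * a ^ (2 * n + 1) := by
        have h3 : cs.simple j * a ^ (2 * n + 1) = (a ^ n)⁻¹ * (cs.simple j * a) * a ^ n := by
          rw [show 2 * n + 1 = n + (1 + n) by ring, pow_add, pow_add, ← mul_assoc, hcomm n, pow_one]
          simp only [mul_assoc]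
        rw [h3]
        constructor
        · intro h
          have : a ^ n * p.1 * (a ^ n)⁻¹ = cs.simple j * cs.simple i * cs.simple j := by
            rw [← h]; simp [mul_assoc]
          rw [mul_inv_eq_iff_eq_mul] at this
          rw [mul_assoc, eq_inv_mul_iff_mul_eq, this, ha]; simp only [mul_assoc]
        · intro h
          rw [h]
          simp only [mul_assoc, mul_inv_cancel_left, mul_inv_cancel, mul_one]
          rw [ha]; simp [mul_assoc]
      simp only [e1, e2]
      rw [show 2 * (n + 1) = 2 * n + 1 + 1 by ring, Finset.sum_range_succ, Finset.sum_range_succ]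
      simp only [add_assoc]

lemma reflFlip_liftable [DecidableEq W] : M.IsLiftable (reflFlip cs) := by
  intro i j
  funext p
  rw [reflFlip_mul_pow]
  have hM := cs.simple_mul_simple_pow i j
  refine Prod.ext (by simp [hM, end_one_apply]) ?_
  have : ∀ l, (cs.simple i * cs.simple j) ^ (M i j + l) = (cs.simple i * cs.simple j) ^ l := by
    intro l; rw [pow_add, hM, one_mul]
  simp only [two_mul, Finset.sum_range_add, this, CharTwo.add_self_eq_zero, add_zero]
  rfl

/-- The parity with which a reflection `t` separates `1` from `w`. -/
def sep [DecidableEq W] (w t : W) : ZMod 2 := (cs.lift ⟨reflFlip cs, reflFlip_liftable cs⟩ w⁻¹ (t, 0)).2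

lemma lift_reflFlip [DecidableEq W] (ω : List B) (p : W × ZMod 2) :
    cs.lift ⟨reflFlip cs, reflFlip_liftable cs⟩ (cs.wordProd ω)⁻¹ p =
      ((cs.wordProd ω)⁻¹ * p.1 * cs.wordProd ω, p.2 + (cs.leftInvSeq ω).count p.1) := by
  induction ω generalizing p with
  | nil => ext <;> simp [end_one_apply]
  | cons i ω ih =>
    rw [cs.wordProd_cons, mul_inv_rev, map_mul, end_mul_apply,
      cs.inv_simple, cs.lift_apply_simple, ih]
    refine Prod.ext ?_ ?_
    · simp [reflFlip, mul_assoc]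
    · simp only [reflFlip, CoxeterSystem.leftInvSeq, List.count_cons, Nat.cast_add]
      have h : (List.map (⇑(MulAut.conj (cs.simple i))) (cs.leftInvSeq ω)).count p.1 =
          (cs.leftInvSeq ω).count (cs.simple i * p.1 * cs.simple i) := by
        conv_lhs => rw [show p.1 = MulAut.conj (cs.simple i)
          (cs.simple i * p.1 * cs.simple i) by simp [mul_assoc]]
        exact List.count_map_of_injective _ _ (MulEquiv.injective _) _
      rw [h]
      have : (p.1 = cs.simple i) ↔ (cs.simple i = p.1) := eq_comm
      simp only [beq_iff_eq, this, Nat.cast_ite, Nat.cast_one, Nat.cast_zero]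
      ring

lemma sep_wordProd [DecidableEq W] (ω : List B) (t : W) :
    sep cs (cs.wordProd ω) t = (cs.leftInvSeq ω).count t := by
  simp [sep, lift_reflFlip]

lemma sep_mul [DecidableEq W] (b y t : W) :
    sep cs (b * y) t = sep cs b t + sep cs y (b⁻¹ * t * b) := by
  obtain ⟨ω, rfl⟩ := cs.wordProd_surjective b
  obtain ⟨ω', rfl⟩ := cs.wordProd_surjective y
  simp only [sep, mul_inv_rev, map_mul, end_mul_apply, lift_reflFlip]
  simp

lemma length_lt_of_sep [DecidableEq W] {w t : W} (h : sep cs w t ≠ 0) :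
    cs.length (t * w) < cs.length w := by
  obtain ⟨ω, hω, rfl⟩ := cs.exists_isReduced w
  rw [sep_wordProd] at h
  have : t ∈ cs.leftInvSeq ω := by
    by_contra hc
    exact h (by rw [List.count_eq_zero_of_not_mem hc]; simp)
  exact (cs.isLeftInversion_of_mem_leftInvSeq hω this).2

lemma sep_of_descent [DecidableEq W] {w : W} {i : B}
    (h : cs.length (cs.simple i * w) < cs.length w) : sep cs w (cs.simple i) = 1 := by
  have h0 : sep cs (cs.simple i * w) (cs.simple i) = 0 := by
    by_contra hc
    have := length_lt_of_sep cs hc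
    rw [cs.simple_mul_simple_cancel_left] at this
    omega
  have h1 : sep cs (cs.simple i) (cs.simple i) = 1 := by
    have := sep_wordProd cs [i] (cs.simple i)
    simpa using this
  have := sep_mul cs (cs.simple i) (cs.simple i * w) (cs.simple i)
  rw [cs.simple_mul_simple_cancel_left, h1] at this
  simpa [h0] using this

lemma WeakLE.refl (v : W) : WeakLE cs v v := by simp [WeakLE]

lemma one_weakLE (v : W) : WeakLE cs 1 v := by simp [WeakLE]

variable {cs}

lemma WeakLE.of_le {v w : W} (h : cs.length v + cs.length (v⁻¹ * w) ≤ cs.length w) :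
    WeakLE cs v w := by
  have := cs.length_mul_le v (v⁻¹ * w)
  rw [mul_inv_cancel_left] at this
  exact le_antisymm h this

lemma WeakLE.trans {u v w : W} (h : WeakLE cs u v) (h' : WeakLE cs v w) : WeakLE cs u w := by
  apply WeakLE.of_le
  have := cs.length_mul_le (u⁻¹ * v) (v⁻¹ * w)
  rw [mul_assoc, mul_inv_cancel_left] at this
  unfold WeakLE at h h'
  omega

lemma WeakLE.length_le {u v : W} (h : WeakLE cs u v) : cs.length u ≤ cs.length v := by
  unfold WeakLE at h; omega

lemma simple_weakLE_iff {i : B} {w : W} :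
    WeakLE cs (cs.simple i) w ↔ cs.length (cs.simple i * w) + 1 = cs.length w := by
  unfold WeakLE; rw [cs.length_simple, cs.inv_simple]; omega

lemma simple_not_weakLE_iff {i : B} {w : W} :
    ¬ WeakLE cs (cs.simple i) w ↔ cs.length (cs.simple i * w) = cs.length w + 1 := by
  rw [simple_weakLE_iff]
  have := cs.length_simple_mul w i
  omega

lemma simple_weakLE_mul_iff {i : B} {w : W} :
    WeakLE cs (cs.simple i) (cs.simple i * w) ↔ ¬ WeakLE cs (cs.simple i) w := by
  rw [simple_not_weakLE_iff, simple_weakLE_iff, cs.simple_mul_simple_cancel_left]; omega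

lemma weakLE_simple_mul {i : B} {v w : W}
    (h : WeakLE cs (cs.simple i) v ↔ WeakLE cs (cs.simple i) w) :
    WeakLE cs (cs.simple i * v) (cs.simple i * w) ↔ WeakLE cs v w := by
  have e : (cs.simple i * v)⁻¹ * (cs.simple i * w) = v⁻¹ * w := by group
  unfold WeakLE at h ⊢
  rw [e]
  by_cases hv : WeakLE cs (cs.simple i) v
  · have hw : WeakLE cs (cs.simple i) w := h.1 hv
    rw [simple_weakLE_iff] at hv hw
    omega
  · have hw : ¬ WeakLE cs (cs.simple i) w := fun hc => hv (h.2 hc)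
    rw [simple_not_weakLE_iff] at hv hw
    omega

lemma WeakLE.lifting {i : B} {b y : W} (hy : WeakLE cs (cs.simple i) y) (hb : WeakLE cs b y)
    (hib : ¬ WeakLE cs (cs.simple i) b) : WeakLE cs (cs.simple i * b) y := by
  classical
  have h1 : sep cs y (cs.simple i) = 1 :=
    sep_of_descent cs (by rw [simple_weakLE_iff] at hy; omega)
  have h2 : sep cs b (cs.simple i) = 0 := by
    by_contra hc
    have := length_lt_of_sep cs hc
    rw [simple_not_weakLE_iff] at hib; omega
  have h3 := sep_mul cs b (b⁻¹ * y) (cs.simple i)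
  rw [mul_inv_cancel_left, h1, h2, zero_add] at h3
  have h4 := length_lt_of_sep cs (w := b⁻¹ * y) (t := b⁻¹ * cs.simple i * b)
    (by rw [← h3]; decide)
  apply WeakLE.of_le
  have e : b⁻¹ * cs.simple i * b * (b⁻¹ * y) = (cs.simple i * b)⁻¹ * y := by
    simp [mul_assoc]
  rw [e] at h4
  rw [simple_not_weakLE_iff] at hib
  unfold WeakLE at hb
  omega

/-- `j` is the join of `u` and `v`. -/
def IsJoin (cs : CoxeterSystem M W) (u v j : W) : Prop :=
  WeakLE cs u j ∧ WeakLE cs v j ∧ ∀ y, WeakLE cs u y → WeakLE cs v y → WeakLE cs j y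

lemma exists_join_simple (i j : B) (x : W) (hi : WeakLE cs (cs.simple i) x)
    (hj : WeakLE cs (cs.simple j) x) : ∃ d, IsJoin cs (cs.simple i) (cs.simple j) d := by
  by_contra hcon
  have key : ∀ n : ℕ, ∃ (b : W) (a c : B), (a = i ∧ c = j ∨ a = j ∧ c = i) ∧
      cs.length b = n + 1 ∧ WeakLE cs (cs.simple a) b ∧
      ∀ y, WeakLE cs (cs.simple i) y → WeakLE cs (cs.simple j) y → WeakLE cs b y := by
    intro n
    induction n with
    | zero =>
      exact ⟨cs.simple i, i, j, Or.inl ⟨rfl, rfl⟩, by simp, WeakLE.refl cs _, fun y h _ => h⟩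
    | succ n ih =>
      obtain ⟨b, a, c, hac, hb, hab, huniv⟩ := ih
      have hcb : ¬ WeakLE cs (cs.simple c) b := by
        intro hcb
        apply hcon
        rcases hac with ⟨rfl, rfl⟩ | ⟨rfl, rfl⟩
        · exact ⟨b, hab, hcb, huniv⟩
        · exact ⟨b, hcb, hab, huniv⟩
      refine ⟨cs.simple c * b, c, a, by tauto, ?_, simple_weakLE_mul_iff.2 hcb, ?_⟩
      · rw [simple_not_weakLE_iff] at hcb; omega
      · intro y h1 h2
        refine WeakLE.lifting ?_ (huniv y h1 h2) hcb
        rcases hac with ⟨rfl, rfl⟩ | ⟨rfl, rfl⟩ <;> assumption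
  obtain ⟨b, a, c, _, hb, _, huniv⟩ := key (cs.length x)
  have := (huniv x hi hj).length_le
  omega

/-- Two elements with a common upper bound have a join. -/
lemma exists_join (x u v : W) (hu : WeakLE cs u x) (hv : WeakLE cs v x) :
    ∃ j, IsJoin cs u v j := by
  induction hn : cs.length x using Nat.strong_induction_on generalizing x u v with
  | _ n ih =>
    subst hn
    have H : ∀ (r : B) (a b : W), WeakLE cs (cs.simple r) a → WeakLE cs (cs.simple r) b →
        WeakLE cs a x → WeakLE cs b x → ∃ j, IsJoin cs a b j := by
      intro r a b ha hb hax hbx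
      have hrx := ha.trans hax
      have hrx' : ¬ WeakLE cs (cs.simple r) (cs.simple r * x) := by
        rw [simple_weakLE_mul_iff]; simpa using hrx
      have hax' := (weakLE_simple_mul (iff_of_true ha hrx)).2 hax
      have hbx' := (weakLE_simple_mul (iff_of_true hb hrx)).2 hbx
      obtain ⟨j, h1, h2, h3⟩ := ih (cs.length (cs.simple r * x))
        (by rw [simple_weakLE_iff] at hrx; omega) _ _ _ hax' hbx' rfl
      have hrj : ¬ WeakLE cs (cs.simple r) j := fun hc => hrx' (hc.trans (h3 _ hax' hbx'))
      have hrj' := simple_weakLE_mul_iff.2 hrj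
      refine ⟨cs.simple r * j, ?_, ?_, ?_⟩
      · rw [← weakLE_simple_mul (iff_of_true ha hrj'), cs.simple_mul_simple_cancel_left]; exact h1
      · rw [← weakLE_simple_mul (iff_of_true hb hrj'), cs.simple_mul_simple_cancel_left]; exact h2
      · intro y hay hby
        have hry := ha.trans hay
        rw [← weakLE_simple_mul (iff_of_true hrj' hry), cs.simple_mul_simple_cancel_left]
        exact h3 _ ((weakLE_simple_mul (iff_of_true ha hry)).2 hay)
          ((weakLE_simple_mul (iff_of_true hb hry)).2 hby)
    by_cases hu1 : u = 1
    · subst hu1; exact ⟨v, one_weakLE cs v, WeakLE.refl cs v, fun y _ h => h⟩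
    by_cases hv1 : v = 1
    · subst hv1; exact ⟨u, WeakLE.refl cs u, one_weakLE cs u, fun y h _ => h⟩
    obtain ⟨r, hr⟩ := cs.exists_leftDescent_of_ne_one hu1
    obtain ⟨t, ht⟩ := cs.exists_leftDescent_of_ne_one hv1
    replace hr : WeakLE cs (cs.simple r) u := simple_weakLE_iff.2 (cs.isLeftDescent_iff.1 hr)
    replace ht : WeakLE cs (cs.simple t) v := simple_weakLE_iff.2 (cs.isLeftDescent_iff.1 ht)
    obtain ⟨d, hd1, hd2, hd3⟩ := exists_join_simple r t x (hr.trans hu) (ht.trans hv)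
    have hdx := hd3 x (hr.trans hu) (ht.trans hv)
    obtain ⟨j1, a1, a2, a3⟩ := H r u d hr hd1 hu hdx
    obtain ⟨j2, b1, b2, b3⟩ := H t v d ht hd2 hv hdx
    obtain ⟨j, c1, c2, c3⟩ := H r j1 j2 (hr.trans a1) (hd1.trans b2)
      (a3 x hu hdx) (b3 x hv hdx)
    refine ⟨j, a1.trans c1, b1.trans c2, fun y hy hy' => ?_⟩
    have hdy := hd3 y (hr.trans hy) (ht.trans hy')
    exact c3 y (a3 y hy hdy) (b3 y hy' hdy)

end WeakOrder
section RootedGraph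

variable {V : Type*} (G : SimpleGraph V) (o : V)

/-- The graph order of a rooted graph: `x ≤ y` iff some geodesic path from the root `o` to `y`
passes through `x`. -/
def GraphLE (x y : V) : Prop := ∃ p : G.Walk o y, p.length = G.dist o y ∧ x ∈ p.support

/-- A sequence of vertices `o`-converges if for every vertex `v` one either has `v ≤ x i` for all
large `i`, or `¬ v ≤ x i` for all large `i`. -/
def OConverges (x : ℕ → V) : Prop :=
  ∀ v, (∀ᶠ i in atTop, GraphLE G o v (x i)) ∨ ∀ᶠ i in atTop, ¬ GraphLE G o v (x i)

/-- Two `o`-convergent sequences are equivalent if they eventually dominate the same vertices. -/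
def oSetoid : Setoid {x : ℕ → V // OConverges G o x} where
  r x y := ∀ v, (∀ᶠ i in atTop, GraphLE G o v (x.1 i)) ↔ ∀ᶠ i in atTop, GraphLE G o v (y.1 i)
  iseqv := ⟨fun _ _ => Iff.rfl, fun h v => (h v).symm, fun h h' v => (h v).trans (h' v)⟩

/-- The bordification (compactification) of a rooted graph: equivalence classes of `o`-convergent
sequences of vertices. -/
def Bordification : Type _ := Quotient (oSetoid G o)

variable {G o}

/-- The class of an `o`-convergent sequence. -/
def Bordification.mk (x : ℕ → V) (hx : OConverges G o x) : Bordification G o :=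
  Quotient.mk (oSetoid G o) ⟨x, hx⟩

/-- The relation `v ≤ z` between a vertex `v` and a point `z` of the bordification. -/
def Bordification.Above (v : V) (z : Bordification G o) : Prop :=
  Quotient.lift (s := oSetoid G o)
    (fun x : {x : ℕ → V // OConverges G o x} => ∀ᶠ i in atTop, GraphLE G o v (x.1 i))
    (fun _ _ h => propext (h v)) z

lemma Bordification.above_mk {x : ℕ → V} (hx : OConverges G o x) (v : V) :
    (Bordification.mk x hx).Above v ↔ ∀ᶠ i in atTop, GraphLE G o v (x i) := Iff.rfl

lemma Bordification.exists_rep (z : Bordification G o) :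
    ∃ (x : ℕ → V) (hx : OConverges G o x), Bordification.mk x hx = z := by
  obtain ⟨⟨x, hx⟩, h⟩ := Quotient.exists_rep z
  exact ⟨x, hx, h⟩

lemma Bordification.ext_above {z z' : Bordification G o}
    (h : ∀ v, z.Above v ↔ z'.Above v) : z = z' := by
  obtain ⟨x, hx, rfl⟩ := z.exists_rep
  obtain ⟨y, hy, rfl⟩ := z'.exists_rep
  exact Quotient.sound (s := oSetoid G o) h

/-- The topology generated by the sets `{z | v ≤ z}` and `{z | ¬ v ≤ z}`. -/
instance : TopologicalSpace (Bordification G o) :=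
  TopologicalSpace.generateFrom
    {U | ∃ v, U = {z : Bordification G o | z.Above v} ∨ U = {z | ¬ z.Above v}}

lemma Bordification.isClopen_above (v : V) : IsClopen {z : Bordification G o | z.Above v} :=
  ⟨⟨TopologicalSpace.isOpen_generateFrom_of_mem ⟨v, Or.inr rfl⟩⟩,
    TopologicalSpace.isOpen_generateFrom_of_mem ⟨v, Or.inl rfl⟩⟩

variable (G o)

/-- The boundary of a rooted graph: the classes of sequences which `o`-converge to infinity, i.e.
which dominate vertices at arbitrarily large distance from the root. -/
def graphBoundary : Set (Bordification G o) := {z | ∀ n : ℕ, ∃ v, z.Above v ∧ n ≤ G.dist o v}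

variable {G o}

lemma graphLE_iff (hG : G.Connected) {x y : V} :
    GraphLE G o x y ↔ G.dist o x + G.dist x y = G.dist o y := by
  constructor
  · rintro ⟨p, hp, hx⟩
    classical
    have h1 := SimpleGraph.dist_le (p.takeUntil x hx)
    have h2 := SimpleGraph.dist_le (p.dropUntil x hx)
    have h3 : (p.takeUntil x hx).length + (p.dropUntil x hx).length = p.length := by
      rw [← SimpleGraph.Walk.length_append, SimpleGraph.Walk.take_spec]
    have h4 := hG.dist_triangle (u := o) (v := x) (w := y)
    omega
  · intro h
    obtain ⟨p, hp⟩ := hG.exists_walk_length_eq_dist o x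
    obtain ⟨p', hp'⟩ := hG.exists_walk_length_eq_dist x y
    exact ⟨p.append p', by simp [hp, hp', h], by simp⟩

/-- An `o`-convergent sequence has eventually decided order relations. -/
lemma OConverges.eventually_iff {x : ℕ → V} (hx : OConverges G o x) (v : V) :
    ∀ᶠ i in atTop, (GraphLE G o v (x i) ↔ (Bordification.mk x hx).Above v) := by
  rw [Bordification.above_mk]
  rcases hx v with h | h
  · filter_upwards [h] with i hi using iff_of_true hi h
  · filter_upwards [h] with i hi
    refine iff_of_false hi fun h' => ?_
    obtain ⟨n, h1, h2⟩ := (h.and h').exists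
    exact h1 h2

/-- The bordification of a countable graph is compact. -/
instance [Countable V] : CompactSpace (Bordification G o) := by
  refine ⟨isCompact_iff_ultrafilter_le_nhds.2 fun F _ => ?_⟩
  have : Nonempty V := ⟨o⟩
  obtain ⟨e, he⟩ := exists_surjective_nat V
  obtain ⟨A, hA⟩ : ∃ A : V → Prop, ∀ v, A v ↔
      ∀ᶠ y : Bordification G o in (F : Filter (Bordification G o)), y.Above v :=
    ⟨_, fun _ => Iff.rfl⟩
  have hdec : ∀ v, ∀ᶠ z : Bordification G o in (F : Filter (Bordification G o)),
      (z.Above v ↔ A v) := by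
    intro v
    by_cases h : A v
    · filter_upwards [(hA v).1 h] with z hz using iff_of_true hz h
    · filter_upwards [Ultrafilter.eventually_not.2 (mt (hA v).2 h)] with z hz using iff_of_false hz h
  have hseq : ∀ n : ℕ, ∃ x : V, ∀ k ≤ n, GraphLE G o (e k) x ↔ A (e k) := by
    intro n
    obtain ⟨z, hz⟩ := ((Set.finite_Iic n).eventually_all.2 fun k _ => hdec (e k)).exists
    obtain ⟨x, hx, rfl⟩ := z.exists_rep
    obtain ⟨i, hi⟩ := ((Set.finite_Iic n).eventually_all.2
      fun k _ => hx.eventually_iff (e k)).exists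
    exact ⟨x i, fun k hk => (hi k hk).trans (hz k hk)⟩
  choose x hx using hseq
  have hxe : ∀ v, ∀ᶠ i in atTop, (GraphLE G o v (x i) ↔ A v) := by
    intro v
    obtain ⟨k, rfl⟩ := he v
    filter_upwards [eventually_ge_atTop k] with i hi using hx i k hi
  have hconv : OConverges G o x := by
    intro v
    by_cases h : A v
    · exact Or.inl ((hxe v).mono fun i hi => hi.2 h)
    · exact Or.inr ((hxe v).mono fun i hi h' => h (hi.1 h'))
  have habove : ∀ v, (Bordification.mk x hconv).Above v ↔ A v := by
    intro v
    obtain ⟨i, h1, h2⟩ := ((hxe v).and (hconv.eventually_iff v)).exists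
    exact h2.symm.trans h1
  refine ⟨Bordification.mk x hconv, Set.mem_univ _, ?_⟩
  rw [TopologicalSpace.nhds_generateFrom]
  refine le_iInf₂ fun U hU => ?_
  obtain ⟨hzU, v, rfl | rfl⟩ := hU
  · exact le_principal_iff.2 ((hA v).1 ((habove v).1 hzU))
  · exact le_principal_iff.2 (Ultrafilter.eventually_not.2 fun h => hzU ((habove v).2 ((hA v).2 h)))

end RootedGraph

section CoxeterBoundary

variable {B W : Type*} [Group W] {M : CoxeterMatrix B} (cs : CoxeterSystem M W)

/-- The Cayley graph of a Coxeter system. -/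
abbrev cayley : SimpleGraph W := SimpleGraph.mulCayley (Set.range cs.simple)

variable {cs}

lemma cayley_adj {u v : W} : (cayley cs).Adj u v ↔ ∃ i, v = u * cs.simple i := by
  rw [SimpleGraph.mulCayley_adj]
  constructor
  · rintro ⟨-, ⟨i, hi⟩ | ⟨i, hi⟩⟩
    · exact ⟨i, by rw [hi]; group⟩
    · exact ⟨i, by rw [← cs.inv_simple, hi]; group⟩
  · rintro ⟨i, rfl⟩
    refine ⟨fun h => ?_, Or.inl ⟨i, by group⟩⟩
    exact cs.length_mul_simple_ne u i (by rw [← h])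

lemma exists_walk (u : W) (ω : List B) :
    ∃ p : (cayley cs).Walk u (u * cs.wordProd ω), p.length = ω.length := by
  induction ω generalizing u with
  | nil => exact ⟨SimpleGraph.Walk.nil.copy rfl (by simp), by simp⟩
  | cons i ω ih =>
    obtain ⟨p, hp⟩ := ih (u * cs.simple i)
    refine ⟨(SimpleGraph.Walk.cons (cayley_adj.2 ⟨i, rfl⟩) p).copy rfl
      (by rw [cs.wordProd_cons, mul_assoc]), by simp [hp]⟩

lemma length_le_walk {u v : W} (p : (cayley cs).Walk u v) : cs.length (u⁻¹ * v) ≤ p.length := by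
  induction p with
  | nil => simp
  | @cons a b c h p ih =>
    obtain ⟨i, rfl⟩ := cayley_adj.1 h
    have := cs.length_mul_le (cs.simple i) ((a * cs.simple i)⁻¹ * c)
    have e : cs.simple i * ((a * cs.simple i)⁻¹ * c) = a⁻¹ * c := by simp [mul_assoc]
    rw [e, cs.length_simple] at this
    simp only [SimpleGraph.Walk.length_cons]
    omega

lemma exists_geodesic (u v : W) : ∃ p : (cayley cs).Walk u v, p.length = cs.length (u⁻¹ * v) := by
  obtain ⟨ω, hω, h⟩ := cs.exists_isReduced (u⁻¹ * v)
  obtain ⟨p, hp⟩ := exists_walk (cs := cs) u ω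
  refine ⟨p.copy rfl (by rw [← h]; group), ?_⟩
  rw [SimpleGraph.Walk.length_copy, hp, h, hω.eq]

lemma cayley_connected : (cayley cs).Connected :=
  { preconnected := fun u v => ⟨(exists_geodesic u v).choose⟩, nonempty := ⟨1⟩ }

lemma cayley_dist (u v : W) : (cayley cs).dist u v = cs.length (u⁻¹ * v) := by
  obtain ⟨p, hp⟩ := exists_geodesic (cs := cs) u v
  obtain ⟨p', hp'⟩ := cayley_connected (cs := cs).exists_walk_length_eq_dist u v
  exact le_antisymm (hp ▸ SimpleGraph.dist_le p) (hp' ▸ length_le_walk p')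

/-- The graph order of the rooted Cayley graph is the weak right Bruhat order. -/
lemma graphLE_cayley {v w : W} : GraphLE (cayley cs) 1 v w ↔ WeakLE cs v w := by
  rw [graphLE_iff cayley_connected, cayley_dist, cayley_dist, cayley_dist, WeakLE]
  simp

variable (cs)

/-- The compactification of a Coxeter system. -/
abbrev Compactification : Type _ := Bordification (cayley cs) 1

/-- The boundary of a Coxeter system. -/
abbrev Boundary : Type _ := graphBoundary (cayley cs) 1

/-- Boolean combinations of the predicates `v ≤ ·`. -/
inductive Tame : (W → Prop) → Prop
  | le (v : W) : Tame (WeakLE cs v)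
  | not {p : W → Prop} : Tame p → Tame fun x => ¬ p x
  | and {p q : W → Prop} : Tame p → Tame q → Tame fun x => p x ∧ q x

variable {cs}

lemma Tame.or {p q : W → Prop} (hp : Tame cs p) (hq : Tame cs q) :
    Tame cs fun x => p x ∨ q x := by
  have := (hp.not.and hq.not).not
  simpa only [not_and_or, not_not] using this

lemma Tame.le_simple_mul (i : B) (v : W) : Tame cs fun x => WeakLE cs v (cs.simple i * x) := by
  have hx : ∀ x, WeakLE cs (cs.simple i) (cs.simple i * x) ↔ ¬ WeakLE cs (cs.simple i) x :=
    fun x => simple_weakLE_mul_iff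
  -- translate `v ≤ s x` when `v` and `s x` lie on the same side of the wall of `s`
  have key : ∀ u x, (WeakLE cs (cs.simple i) u ↔ ¬ WeakLE cs (cs.simple i) x) →
      (WeakLE cs u (cs.simple i * x) ↔ WeakLE cs (cs.simple i * u) x) := by
    intro u x h
    rw [← hx] at h
    rw [← weakLE_simple_mul h, cs.simple_mul_simple_cancel_left]
  by_cases hv : WeakLE cs (cs.simple i) v
  · convert (Tame.le (cs := cs) (cs.simple i)).not.and (Tame.le (cs.simple i * v)) using 2 with x
    constructor
    · intro h
      have h1 := (hx x).1 (hv.trans h)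
      exact ⟨h1, (key v x (iff_of_true hv h1)).1 h⟩
    · rintro ⟨h1, h2⟩
      exact (key v x (iff_of_true hv h1)).2 h2
  · by_cases hj : ∃ y, WeakLE cs (cs.simple i) y ∧ WeakLE cs v y
    · obtain ⟨y, hy1, hy2⟩ := hj
      obtain ⟨j, j1, j2, j3⟩ := exists_join y _ _ hy1 hy2
      convert ((Tame.le (cs := cs) (cs.simple i)).and (Tame.le (cs.simple i * v))).or
        ((Tame.le (cs.simple i)).not.and (Tame.le (cs.simple i * j))) using 2 with x
      by_cases hsx : WeakLE cs (cs.simple i) x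
      · simp only [hsx, true_and, not_true, false_and, or_false]
        exact key v x (by simp [hv, hsx])
      · simp only [hsx, false_and, not_false_iff, true_and, false_or]
        rw [← key j x (by simp [j1, hsx])]
        exact ⟨fun h => j3 _ ((hx x).2 hsx) h, fun h => j2.trans h⟩
    · convert (Tame.le (cs := cs) (cs.simple i)).and (Tame.le (cs.simple i * v)) using 2 with x
      by_cases hsx : WeakLE cs (cs.simple i) x
      · simp only [hsx, true_and]
        exact key v x (by simp [hv, hsx])
      · simp only [hsx, false_and, iff_false]
        exact fun h => hj ⟨_, (hx x).2 hsx, h⟩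

lemma Tame.simple_mul {p : W → Prop} (hp : Tame cs p) (i : B) :
    Tame cs fun x => p (cs.simple i * x) := by
  induction hp with
  | le v => exact Tame.le_simple_mul i v
  | not _ ih => exact ih.not
  | and _ _ ih ih' => exact ih.and ih'

lemma Tame.mul {p : W → Prop} (hp : Tame cs p) (w : W) : Tame cs fun x => p (w * x) := by
  obtain ⟨ω, rfl⟩ := cs.wordProd_surjective w
  induction ω generalizing p with
  | nil => simpa using hp
  | cons i ω ih =>
    have := ih (hp.simple_mul i)
    simpa only [cs.wordProd_cons, mul_assoc] using this

lemma Tame.eventually {p : W → Prop} (hp : Tame cs p) {x : ℕ → W}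
    (hx : OConverges (cayley cs) 1 x) :
    (∀ᶠ n in atTop, p (x n)) ∨ ∀ᶠ n in atTop, ¬ p (x n) := by
  induction hp with
  | le v => simpa only [graphLE_cayley] using hx v
  | not _ ih => simpa only [not_not] using ih.symm
  | and _ _ ih ih' =>
    rcases ih with h | h
    · rcases ih' with h' | h'
      · exact Or.inl (h.and h')
      · exact Or.inr (h'.mono fun _ a b => a b.2)
    · exact Or.inr (h.mono fun _ a b => a b.1)

lemma Tame.not_eventually {p : W → Prop} (hp : Tame cs p) {x : ℕ → W}
    (hx : OConverges (cayley cs) 1 x) :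
    (¬ ∀ᶠ n in atTop, p (x n)) ↔ ∀ᶠ n in atTop, ¬ p (x n) := by
  constructor
  · exact fun h => (hp.eventually hx).resolve_left h
  · intro h h'
    obtain ⟨n, h1, h2⟩ := (h.and h').exists
    exact h1 h2

/-- The limit of a tame predicate along a sequence is a clopen condition on its class. -/
lemma Tame.exists_clopen {p : W → Prop} (hp : Tame cs p) :
    ∃ U : Set (Compactification cs), IsClopen U ∧ ∀ (x : ℕ → W) (hx : OConverges (cayley cs) 1 x),
      Bordification.mk x hx ∈ U ↔ ∀ᶠ n in atTop, p (x n) := by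
  induction hp with
  | le v =>
    refine ⟨_, Bordification.isClopen_above v, fun x hx => ?_⟩
    refine (Bordification.above_mk hx v).trans ?_
    simp only [graphLE_cayley]
  | not hp ih =>
    obtain ⟨U, hU, h⟩ := ih
    refine ⟨Uᶜ, hU.compl, fun x hx => ?_⟩
    rw [Set.mem_compl_iff, h x hx, hp.not_eventually hx]
  | and _ _ ih ih' =>
    obtain ⟨U, hU, h⟩ := ih
    obtain ⟨U', hU', h'⟩ := ih'
    refine ⟨U ∩ U', hU.inter hU', fun x hx => ?_⟩
    rw [Set.mem_inter_iff, h x hx, h' x hx, eventually_and]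

lemma OConverges.mul_left {x : ℕ → W} (hx : OConverges (cayley cs) 1 x) (w : W) :
    OConverges (cayley cs) 1 fun n => w * x n := by
  intro v
  simp only [graphLE_cayley]
  exact ((Tame.le (cs := cs) v).mul w).eventually hx

/-- The action of `W` on its compactification which extends left multiplication. -/
instance : MulAction W (Compactification cs) where
  smul w := Quotient.map' (s₁ := oSetoid _ _) (s₂ := oSetoid _ _)
    (fun x => ⟨fun n => w * x.1 n, x.2.mul_left w⟩) (by
      intro x y hxy v
      obtain ⟨U, -, hU⟩ := ((Tame.le (cs := cs) v).mul w).exists_clopen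
      simp only [graphLE_cayley]
      rw [← hU _ x.2, ← hU _ y.2, show Bordification.mk x.1 x.2 = Bordification.mk y.1 y.2 from
        Quotient.sound (s := oSetoid _ _) hxy])
  one_smul z := by
    obtain ⟨x, hx, rfl⟩ := z.exists_rep
    refine Quotient.sound (s := oSetoid _ _) fun v => ?_
    simp
  mul_smul w w' z := by
    obtain ⟨x, hx, rfl⟩ := z.exists_rep
    refine Quotient.sound (s := oSetoid _ _) fun v => ?_
    simp [mul_assoc]

lemma smul_mk (w : W) (x : ℕ → W) (hx : OConverges (cayley cs) 1 x) :
    w • (Bordification.mk x hx : Compactification cs) =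
      Bordification.mk (fun n => w * x n) (hx.mul_left w) := rfl

instance : ContinuousConstSMul W (Compactification cs) where
  continuous_const_smul w := by
    refine continuous_generateFrom_iff.2 ?_
    rintro _ ⟨v, hv⟩
    obtain ⟨U, hU, h⟩ := ((Tame.le (cs := cs) v).mul w).exists_clopen
    have e : (fun z : Compactification cs => w • z) ⁻¹' {z | z.Above v} = U := by
      ext z
      obtain ⟨x, hx, rfl⟩ := z.exists_rep
      rw [h x hx, Set.mem_preimage, smul_mk, Set.mem_ofPred_eq, Bordification.above_mk]
      simp only [graphLE_cayley]
    rcases hv with rfl | rfl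
    · rw [e]; exact hU.isOpen
    · rw [← Set.compl_ofPred, Set.preimage_compl, e]; exact hU.compl.isOpen

lemma simple_smul_mem_boundary (i : B) {z : Compactification cs}
    (hz : z ∈ graphBoundary (cayley cs) 1) : cs.simple i • z ∈ graphBoundary (cayley cs) 1 := by
  obtain ⟨x, hx, rfl⟩ := z.exists_rep
  intro n
  obtain ⟨v, hv, hn⟩ := hz (n + 1)
  rw [Bordification.above_mk] at hv
  rw [cayley_dist] at hn
  simp only [graphLE_cayley, inv_one, one_mul] at hv hn
  simp only [smul_mk, Bordification.above_mk, graphLE_cayley, cayley_dist, inv_one, one_mul]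
  rcases (Tame.le (cs := cs) (cs.simple i)).eventually hx with hs | hs
  · obtain ⟨m, hm1, hm2⟩ := (hs.and hv).exists
    obtain ⟨j, j1, j2, j3⟩ := exists_join _ _ _ hm1 hm2
    refine ⟨cs.simple i * j, ?_, ?_⟩
    · filter_upwards [hs, hv] with k h1 h2
      exact (weakLE_simple_mul (iff_of_true j1 h1)).2 (j3 _ h1 h2)
    · have := j2.length_le
      rw [simple_weakLE_iff] at j1
      omega
  · obtain ⟨m, hm1, hm2⟩ := (hs.and hv).exists
    have hsv : ¬ WeakLE cs (cs.simple i) v := fun h => hm1 (h.trans hm2)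
    refine ⟨cs.simple i * v, ?_, ?_⟩
    · filter_upwards [hs, hv] with k h1 h2
      exact (weakLE_simple_mul (iff_of_false hsv h1)).2 h2
    · rw [simple_not_weakLE_iff] at hsv
      omega

lemma smul_mem_boundary (w : W) {z : Compactification cs}
    (hz : z ∈ graphBoundary (cayley cs) 1) : w • z ∈ graphBoundary (cayley cs) 1 := by
  induction w using cs.simple_induction_left with
  | one => simpa using hz
  | mul_simple_left w i h => rw [mul_smul]; exact simple_smul_mem_boundary i h

/-- The action of `W` on its boundary. -/
instance : MulAction W (Boundary cs) where
  smul w z := ⟨w • z.1, smul_mem_boundary w z.2⟩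
  one_smul z := Subtype.ext (one_smul W z.1)
  mul_smul w w' z := Subtype.ext (mul_smul w w' z.1)

instance : ContinuousConstSMul W (Boundary cs) where
  continuous_const_smul w :=
    Continuous.subtype_mk ((continuous_const_smul w).comp continuous_subtype_val) _

lemma exists_weakLE_length_eq {v : W} {n : ℕ} (h : n ≤ cs.length v) :
    ∃ u, WeakLE cs u v ∧ cs.length u = n := by
  obtain ⟨ω, hω, rfl⟩ := cs.exists_isReduced v
  rw [hω.eq] at h
  have e : cs.wordProd ω = cs.wordProd (ω.take n) * cs.wordProd (ω.drop n) := by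
    rw [← cs.wordProd_append, List.take_append_drop]
  have h1 := (hω.take n).eq
  have h2 := (hω.drop n).eq
  refine ⟨cs.wordProd (ω.take n), ?_, by rw [h1, List.length_take]; omega⟩
  unfold WeakLE
  rw [hω.eq, e, inv_mul_cancel_left, h1, h2, List.length_take, List.length_drop]
  omega

lemma finite_sphere [Finite B] (n : ℕ) : {v : W | cs.length v = n}.Finite := by
  refine ((List.finite_length_eq B n).image cs.wordProd).subset ?_
  intro v hv
  obtain ⟨ω, hω, rfl⟩ := cs.exists_isReduced v
  exact ⟨ω, hω.symm.trans hv, rfl⟩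

/-- The boundary is closed in the compactification. -/
lemma isClosed_boundary [Finite B] : IsClosed (graphBoundary (cayley cs) 1) := by
  have e : graphBoundary (cayley cs) 1 = ⋂ n : ℕ, ⋃ v ∈ {v : W | cs.length v = n},
      {z : Compactification cs | z.Above v} := by
    ext z
    simp only [graphBoundary, cayley_dist, inv_one, one_mul, Set.mem_iInter, Set.mem_iUnion,
      Set.mem_ofPred_eq, exists_prop]
    refine forall_congr' fun n => ?_
    constructor
    · rintro ⟨v, hv, hn⟩
      obtain ⟨u, hu, hun⟩ := exists_weakLE_length_eq hn
      refine ⟨u, hun, ?_⟩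
      obtain ⟨x, hx, rfl⟩ := z.exists_rep
      rw [Bordification.above_mk] at hv ⊢
      simp only [graphLE_cayley] at hv ⊢
      exact hv.mono fun i hi => hu.trans hi
    · rintro ⟨v, hv, hz⟩
      exact ⟨v, hz, hv.ge⟩
  rw [e]
  exact isClosed_iInter fun n => (finite_sphere n).isClosed_biUnion fun v _ =>
    (Bordification.isClopen_above v).isClosed

lemma countable_of_finite [Finite B] (cs : CoxeterSystem M W) : Countable W :=
  cs.wordProd_surjective.countable

instance [Finite B] : CompactSpace (Compactification cs) :=
  have := countable_of_finite cs
  inferInstance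

instance [Finite B] : CompactSpace (Boundary cs) :=
  isCompact_iff_compactSpace.1 isClosed_boundary.isCompact

end CoxeterBoundary
noncomputable section Operators

section CalkinAlgebra

variable {H : Type*} [NormedAddCommGroup H] [InnerProductSpace ℂ H]

lemma isCompactOperator_star [CompleteSpace H] {T : H →L[ℂ] H} (hT : IsCompactOperator T) :
    IsCompactOperator (star T : H →L[ℂ] H) := by
  have hTS : IsCompactOperator (T ∘L star T) := hT.comp_clm (star T)
  have h1 := (isCompactOperator_iff_isCompact_closure_image_ball
    (T ∘L star T).toLinearMap one_pos).1 hTS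
  refine (isCompactOperator_iff_isCompact_closure_image_ball (star T).toLinearMap one_pos).2 ?_
  have htb : TotallyBounded ((T ∘L star T) '' Metric.ball 0 1) :=
    h1.totallyBounded.subset subset_closure
  refine isCompact_iff_totallyBounded_isComplete.2 ⟨TotallyBounded.closure ?_,
    isClosed_closure.isComplete⟩
  rw [Metric.totallyBounded_iff]
  intro ε hε
  obtain ⟨t, hts, htf, hcov⟩ := Metric.finite_approx_of_totallyBounded htb (ε ^ 2 / 2) (by positivity)
  obtain ⟨u, hu, huf, rfl⟩ := Set.exists_subset_image_finite_and.1 ⟨t, hts, htf, rfl⟩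
  refine ⟨(star T : H →L[ℂ] H) '' u, huf.image _, ?_⟩
  rintro _ ⟨x, hx, rfl⟩
  have hx' := hcov (Set.mem_image_of_mem _ hx)
  simp only [Set.mem_iUnion, Set.mem_image, exists_prop] at hx' ⊢
  obtain ⟨_, ⟨y, hy, rfl⟩, hxy⟩ := hx'
  refine ⟨_, ⟨y, hy, rfl⟩, ?_⟩
  rw [Metric.mem_ball, dist_eq_norm, ← map_sub] at hxy
  have hd : ‖x - y‖ ≤ 2 := by
    have h2 := hu hy
    rw [mem_ball_zero_iff] at hx h2
    linarith [norm_sub_le x y]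
  have hn : ‖star T (x - y)‖ ^ 2 ≤ ‖x - y‖ * ‖(T ∘L star T) (x - y)‖ := by
    have e : inner ℂ (x - y) ((T ∘L star T) (x - y)) =
        inner ℂ (star T (x - y)) (star T (x - y)) := by
      rw [ContinuousLinearMap.comp_apply, ContinuousLinearMap.star_eq_adjoint,
        ContinuousLinearMap.adjoint_inner_left]
    have e2 := norm_inner_le_norm (𝕜 := ℂ) (x - y) ((T ∘L star T) (x - y))
    rw [e, inner_self_eq_norm_sq_to_K] at e2
    simpa using e2
  rw [Metric.mem_ball, dist_eq_norm, ContinuousLinearMap.coe_coe, ← map_sub]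
  refine lt_of_pow_lt_pow_left₀ 2 hε.le ?_
  nlinarith [norm_nonneg (x - y), norm_nonneg ((T ∘L star T) (x - y))]

variable (H)

/-- The ideal of compact operators on a Hilbert space. -/
def compactIdeal : Ideal (H →L[ℂ] H) where
  carrier := {T | IsCompactOperator T}
  add_mem' h h' := h.add h'
  zero_mem' := isCompactOperator_zero
  smul_mem' S _ h := h.clm_comp S

instance : (compactIdeal H).IsTwoSided := ⟨fun S h => IsCompactOperator.comp_clm h S⟩

/-- The quotient of the bounded operators by the compact operators. -/
abbrev Calkin : Type _ := (H →L[ℂ] H) ⧸ compactIdeal H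

variable {H}

lemma calkin_eq {S T : H →L[ℂ] H} : Ideal.Quotient.mk (compactIdeal H) S =
    Ideal.Quotient.mk (compactIdeal H) T ↔ IsCompactOperator (S - T) :=
  Ideal.Quotient.mk_eq_mk_iff_sub_mem S T

instance [CompleteSpace H] : StarRing (Calkin H) where
  star := Quotient.map' (star : (H →L[ℂ] H) → (H →L[ℂ] H)) fun S T h => by
    have h' : IsCompactOperator (S - T) := calkin_eq.1 (Quotient.sound h)
    have h2 := isCompactOperator_star h'
    rw [star_sub] at h2
    exact Quotient.exact (calkin_eq.2 h2)
  star_involutive x := by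
    obtain ⟨S, rfl⟩ := Ideal.Quotient.mk_surjective x
    exact congrArg (Ideal.Quotient.mk (compactIdeal H)) (star_star S)
  star_mul x y := by
    obtain ⟨S, rfl⟩ := Ideal.Quotient.mk_surjective x
    obtain ⟨T, rfl⟩ := Ideal.Quotient.mk_surjective y
    exact congrArg (Ideal.Quotient.mk (compactIdeal H)) (star_mul S T)
  star_add x y := by
    obtain ⟨S, rfl⟩ := Ideal.Quotient.mk_surjective x
    obtain ⟨T, rfl⟩ := Ideal.Quotient.mk_surjective y
    exact congrArg (Ideal.Quotient.mk (compactIdeal H)) (star_add S T)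

instance [CompleteSpace H] : StarModule ℂ (Calkin H) where
  star_smul c x := by
    obtain ⟨S, rfl⟩ := Ideal.Quotient.mk_surjective x
    exact congrArg (Ideal.Quotient.mk (compactIdeal H)) (star_smul c S)

variable (H)

/-- The quotient map `π` onto the Calkin algebra, as a `*`-homomorphism. -/
def calkinMap [CompleteSpace H] : (H →L[ℂ] H) →⋆ₐ[ℂ] Calkin H :=
  { Ideal.Quotient.mkₐ ℂ (compactIdeal H) with map_star' := fun _ => rfl }

variable {H}

lemma calkinMap_eq_zero_iff [CompleteSpace H] (T : H →L[ℂ] H) : calkinMap H T = 0 ↔ IsCompactOperator T :=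
  Ideal.Quotient.eq_zero_iff_mem

end CalkinAlgebra

section L2

variable {ι : Type*}

/-- The Hilbert space `ℓ²(ι)`. -/
abbrev L2 (ι : Type*) : Type _ := lp (fun _ : ι => ℂ) 2

open Classical in
/-- The canonical orthonormal basis of `ℓ²(ι)`. -/
def delta (i : ι) : L2 ι := lp.single 2 i (1 : ℂ)

lemma delta_apply [DecidableEq ι] (i j : ι) : delta i j = if j = i then 1 else 0 := by
  classical
  simp [delta, lp.single_apply, Pi.single_apply]

lemma l2_ext {f g : L2 ι} (h : ∀ i, f i = g i) : f = g := lp.ext (funext h)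

lemma l2_summable (f : L2 ι) : Summable fun i => ‖f i‖ ^ (2 : ℝ) := by
  simpa using (lp.memℓp f).summable (by norm_num)

/-- The unitary of `ℓ²(ι)` that permutes the canonical basis by `e`. -/
def permOp (e : Equiv.Perm ι) : L2 ι →L[ℂ] L2 ι :=
  LinearMap.mkContinuous
    { toFun := fun f => ⟨fun i => f (e.symm i), (memℓp_gen_iff (by norm_num)).2 (by
        simpa [Function.comp_def] using
          (e.symm.summable_iff (f := fun i => ‖f i‖ ^ (2 : ℝ))).2 (l2_summable f))⟩
      map_add' := fun _ _ => rfl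
      map_smul' := fun _ _ => rfl } 1 (by
    intro f
    rw [one_mul]
    refine lp.norm_le_of_tsum_le (by norm_num) (norm_nonneg _) ?_
    rw [lp.norm_rpow_eq_tsum (by norm_num)]
    exact (e.symm.tsum_eq (fun i => ‖f i‖ ^ (2 : ℝ≥0∞).toReal)).le)

lemma permOp_apply (e : Equiv.Perm ι) (f : L2 ι) (i : ι) : permOp e f i = f (e.symm i) := rfl

lemma permOp_delta (e : Equiv.Perm ι) (i : ι) : permOp e (delta i) = delta (e i) := by
  classical
  refine l2_ext fun j => ?_
  simp only [permOp_apply, delta_apply, Equiv.symm_apply_eq]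

/-- The operator of pointwise multiplication with a bounded function `a` on `ℓ²(ι)`. -/
def diagOp (a : ι → ℂ) (C : ℝ) (h : ∀ i, ‖a i‖ ≤ C) : L2 ι →L[ℂ] L2 ι :=
  have key : ∀ (f : L2 ι) i, ‖a i * f i‖ ^ (2 : ℝ) ≤ |C| ^ (2 : ℝ) * ‖f i‖ ^ (2 : ℝ) := by
    intro f i
    rw [← Real.mul_rpow (abs_nonneg _) (norm_nonneg _), norm_mul]
    exact Real.rpow_le_rpow (by positivity)
      (mul_le_mul_of_nonneg_right ((h i).trans (le_abs_self C)) (norm_nonneg _)) (by norm_num)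
  have summ : ∀ f : L2 ι, Summable fun i => ‖a i * f i‖ ^ (2 : ℝ) := fun f =>
    Summable.of_nonneg_of_le (fun i => by positivity) (key f) ((l2_summable f).mul_left _)
  LinearMap.mkContinuous
    { toFun := fun f => ⟨fun i => a i * f i, (memℓp_gen_iff (by norm_num)).2 (by
        simpa using summ f)⟩
      map_add' := fun f g => l2_ext fun i => mul_add _ _ _
      map_smul' := fun c f => l2_ext fun i => by
        simp only [lp.coeFn_smul, Pi.smul_apply, smul_eq_mul, RingHom.id_apply]; ring } |C| (by
    intro f
    refine lp.norm_le_of_tsum_le (by norm_num) (by positivity) ?_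
    rw [Real.mul_rpow (abs_nonneg _) (norm_nonneg _), lp.norm_rpow_eq_tsum (by norm_num),
      ← tsum_mul_left]
    simp only [ENNReal.toReal_ofNat]
    exact (summ f).tsum_le_tsum (key f) ((l2_summable f).mul_left _))

lemma diagOp_apply (a : ι → ℂ) (C : ℝ) (h : ∀ i, ‖a i‖ ≤ C) (f : L2 ι) (i : ι) :
    diagOp a C h f i = a i * f i := rfl

/-- The orthogonal projection of `ℓ²(ι)` onto the closed span of the `δ_i`, `i ∈ s`. -/
def coordProj (s : Set ι) : L2 ι →L[ℂ] L2 ι :=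
  (Submodule.span ℂ (delta '' s)).topologicalClosure.starProjection

open Classical in
lemma coordProj_apply (s : Set ι) (f : L2 ι) (i : ι) :
    coordProj s f i = if i ∈ s then f i else 0 := by
  have hb : ∀ i, ‖(if i ∈ s then (1 : ℂ) else 0)‖ ≤ 1 := by intro i; split_ifs <;> simp
  set D := diagOp _ 1 hb with hD
  have hDf : ∀ f i, D f i = if i ∈ s then f i else 0 := by
    intro f i; rw [hD, diagOp_apply]; split_ifs <;> simp
  have : coordProj s f = D f := by
    refine Submodule.eq_starProjection_of_mem_of_inner_eq_zero ?_ ?_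
    · have hs := lp.hasSum_single (p := 2) (by norm_num) (D f)
      refine (Submodule.isClosed_topologicalClosure _).mem_of_tendsto hs
        (Eventually.of_forall fun t => Submodule.sum_mem _ fun j _ => ?_)
      refine Submodule.le_topologicalClosure _ ?_
      by_cases hj : j ∈ s
      · have : lp.single 2 j (D f j) = (D f j) • (delta j : L2 ι) := by
          rw [delta, ← lp.single_smul]; simp
        rw [this]
        exact Submodule.smul_mem _ _ (Submodule.subset_span ⟨j, hj, rfl⟩)
      · rw [hDf, if_neg hj]; simp
    · intro w hw
      have hcl : IsClosed {w : L2 ι | inner ℂ (f - D f) w = 0} :=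
        isClosed_eq (by fun_prop) continuous_const
      have hle : ((Submodule.span ℂ (delta '' s) : Submodule ℂ (L2 ι)) : Set (L2 ι)) ⊆
          {w : L2 ι | inner ℂ (f - D f) w = 0} := by
        intro w hw
        refine Submodule.span_induction ?_ ?_ ?_ ?_ hw
        · rintro _ ⟨j, hj, rfl⟩
          rw [Set.mem_ofPred_eq, delta, lp.inner_single_right]
          simp [hDf, hj]
        · simp
        · intro x y _ _ hx hy
          rw [Set.mem_ofPred_eq] at *
          rw [inner_add_right, hx, hy, add_zero]
        · intro c x _ hx
          rw [Set.mem_ofPred_eq] at *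
          rw [inner_smul_right, hx, mul_zero]
      exact closure_minimal hle hcl hw
  rw [this, hDf]

end L2

section CrossedProduct

variable {G X : Type*} [Group G] [TopologicalSpace X] [CompactSpace X] [MulAction G X]

/-- The copy of `f ∈ C(X)` in the regular representation on `ℓ²(X × G) = ℓ²(X) ⊗ ℓ²(G)` induced by
the faithful representation of `C(X)` on `ℓ²(X)` by multiplication operators:
`δ_(x,g) ↦ (g⁻¹.f)(x) δ_(x,g) = f(gx) δ_(x,g)`. -/
def crossedCoeff (G : Type*) [Group G] [MulAction G X] (f : C(X, ℂ)) :
    L2 (X × G) →L[ℂ] L2 (X × G) :=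
  diagOp (fun p => f (p.2 • p.1)) ‖f‖ fun _ => f.norm_coe_le_norm _

/-- The unitary `λ_g = 1 ⊗ λ_g` on `ℓ²(X) ⊗ ℓ²(G)`: `δ_(x,h) ↦ δ_(x,gh)`. -/
def crossedUnitary (X : Type*) (g : G) : L2 (X × G) →L[ℂ] L2 (X × G) :=
  permOp ((Equiv.refl X).prodCongr (Equiv.mulLeft g))

/-- Covariance: `λ_g f λ_g⁻¹ = g.f`, where `(g.f)(x) = f(g⁻¹x)`. -/
lemma crossed_covariance [ContinuousConstSMul G X] (g : G) (f : C(X, ℂ)) :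
    crossedUnitary X g * crossedCoeff G f * crossedUnitary X g⁻¹ =
      crossedCoeff G (f.comp ⟨fun x => g⁻¹ • x, continuous_const_smul g⁻¹⟩) := by
  refine ContinuousLinearMap.ext fun ξ => l2_ext fun ⟨x, h⟩ => ?_
  simp only [ContinuousLinearMap.mul_def, ContinuousLinearMap.comp_apply, crossedUnitary,
    crossedCoeff, permOp_apply, diagOp_apply]
  simp [mul_smul]

variable (G X) in
/-- The reduced crossed product `C(X) ⋊_r G` of an action by homeomorphisms on a compact space:
the C⋆-algebra generated by `C(X)` and the unitaries `λ_g`. -/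
def ReducedCrossedProduct [ContinuousConstSMul G X] :
    StarSubalgebra ℂ (L2 (X × G) →L[ℂ] L2 (X × G)) :=
  (StarAlgebra.adjoin ℂ
    (Set.range (crossedCoeff (X := X) G) ∪ Set.range (crossedUnitary (G := G) X))).topologicalClosure

variable [ContinuousConstSMul G X]

/-- A continuous function as an element of the reduced crossed product. -/
def ReducedCrossedProduct.coeff (f : C(X, ℂ)) : ReducedCrossedProduct G X :=
  ⟨crossedCoeff G f, StarSubalgebra.le_topologicalClosure _
    (StarAlgebra.subset_adjoin ℂ _ (Or.inl ⟨f, rfl⟩))⟩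

/-- The canonical unitary `λ_g` in the reduced crossed product. -/
def ReducedCrossedProduct.unitary (g : G) : ReducedCrossedProduct G X :=
  ⟨crossedUnitary X g, StarSubalgebra.le_topologicalClosure _
    (StarAlgebra.subset_adjoin ℂ _ (Or.inr ⟨g, rfl⟩))⟩

end CrossedProduct

section Hecke

variable {B W : Type*} [Group W] {M : CoxeterMatrix B} (cs : CoxeterSystem M W)

/-- The set of positive multi-parameters `(q_s)_s` that are constant on conjugacy classes. -/
def paramSet : Set (B → ℝ) :=
  {q | (∀ s, 0 < q s) ∧ ∀ s t, IsConj (cs.simple s) (cs.simple t) → q s = q t}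

/-- The sign multi-parameters `(ε_s)_s` that are constant on conjugacy classes. -/
def signSet : Set (B → ℤ) :=
  {ε | (∀ s, ε s = 1 ∨ ε s = -1) ∧ ∀ s t, IsConj (cs.simple s) (cs.simple t) → ε s = ε t}

/-- `q_w`, the product of the `q_s` over the letters of a reduced expression of `w`. -/
def paramProd (q : B → ℝ) (w : W) : ℝ := ((cs.exists_isReduced w).choose.map q).prod

/-- The positive multi-parameters at which the growth series `∑_w q_w` converges. -/
def growthRegion : Set (B → ℝ) := {q | q ∈ paramSet cs ∧ Summable (paramProd cs q)}

/-- The set of all `(q_s ^ ε_s)_s` with `q` positive in the region of convergence of the growth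
series and `ε` a sign multi-parameter. -/
def excludedSet : Set (B → ℝ) :=
  {q' | ∃ q ∈ growthRegion cs, ∃ ε ∈ signSet cs, q' = fun s => q s ^ ε s}

open Classical in
/-- Extension of a parameter to reflections. -/
def paramExt (q : B → ℝ) (t : W) : ℝ :=
  if h : ∃ s, IsConj (cs.simple s) t then q h.choose else 1

variable {cs}

lemma paramExt_simple {q : B → ℝ} (hq : q ∈ paramSet cs) (s : B) :
    paramExt cs q (cs.simple s) = q s := by
  have h : ∃ s', IsConj (cs.simple s') (cs.simple s) := ⟨s, IsConj.refl _⟩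
  rw [paramExt, dif_pos h]
  exact hq.2 _ _ h.choose_spec

lemma paramExt_conj (q : B → ℝ) (g t : W) : paramExt cs q (MulAut.conj g t) = paramExt cs q t := by
  have e : (fun s => IsConj (cs.simple s) (MulAut.conj g t)) = fun s => IsConj (cs.simple s) t := by
    funext s
    have h : IsConj t (MulAut.conj g t) := isConj_iff.2 ⟨g, rfl⟩
    exact propext ⟨fun h' => h'.trans h.symm, fun h' => h'.trans h⟩
  classical
  have key : ∀ P Q : B → Prop, P = Q →
      (if h : ∃ s, P s then q h.choose else 1) = if h : ∃ s, Q s then q h.choose else 1 := by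
    rintro P _ rfl; rfl
  exact key _ _ e

lemma prod_map_leftInvSeq {q : B → ℝ} (hq : q ∈ paramSet cs) (ω : List B) :
    ((cs.leftInvSeq ω).map (paramExt cs q)).prod = (ω.map q).prod := by
  induction ω with
  | nil => simp
  | cons s ω ih =>
    rw [CoxeterSystem.leftInvSeq, List.map_cons, List.prod_cons, List.map_map, paramExt_simple hq,
      List.map_cons, List.prod_cons, ← ih]
    congr 3
    exact funext fun t => paramExt_conj q _ t

/-- `q_w` does not depend on the choice of the reduced expression. -/
lemma paramProd_wordProd {q : B → ℝ} (hq : q ∈ paramSet cs) {ω : List B} (hω : cs.IsReduced ω) :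
    paramProd cs q (cs.wordProd ω) = (ω.map q).prod := by
  classical
  obtain ⟨hω', e⟩ := (cs.exists_isReduced (cs.wordProd ω)).choose_spec
  set ω' := (cs.exists_isReduced (cs.wordProd ω)).choose with hdef
  rw [paramProd, ← hdef, ← prod_map_leftInvSeq hq, ← prod_map_leftInvSeq hq]
  refine ((List.perm_iff_count.2 fun t => ?_).map _).prod_eq
  have h1 := sep_wordProd cs ω t
  have h2 := sep_wordProd cs ω' t
  rw [← e, h1] at h2
  have n1 := List.nodup_iff_count_le_one.1 hω.nodup_leftInvSeq t
  have n2 := List.nodup_iff_count_le_one.1 hω'.nodup_leftInvSeq t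
  rw [ZMod.natCast_eq_natCast_iff'] at h2
  omega

/-- Left translation by `w` on `ℓ²(W)`: `δ_v ↦ δ_{wv}`. This is the operator `T_w^{(1)}`. -/
def leftTranslation (w : W) : L2 W →L[ℂ] L2 W := permOp (Equiv.mulLeft w)

lemma leftTranslation_mul (v w : W) :
    leftTranslation (v * w) = leftTranslation v * leftTranslation w := by
  refine ContinuousLinearMap.ext fun ξ => l2_ext fun u => ?_
  change ξ ((v * w)⁻¹ * u) = ξ (w⁻¹ * (v⁻¹ * u))
  rw [mul_inv_rev, mul_assoc]

lemma leftTranslation_one : leftTranslation (1 : W) = 1 := by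
  refine ContinuousLinearMap.ext fun ξ => l2_ext fun u => ?_
  change ξ (1⁻¹ * u) = ξ u
  rw [inv_one, one_mul]

variable (cs)

/-- `P_w`, the orthogonal projection onto the closed span of the `δ_v` with `w ≤ v`. -/
def weakProj (w : W) : L2 W →L[ℂ] L2 W := coordProj {v | WeakLE cs w v}

/-- `p_s(q) = q_s^{-1/2} (q_s - 1)`. -/
def heckeCoeff (q : B → ℝ) (s : B) : ℝ := (q s - 1) / √(q s)

/-- The generator `T_s^{(q)} = T_s^{(1)} + p_s(q) P_s` of the Hecke algebra, acting on `ℓ²(W)`. -/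
def heckeGen (q : B → ℝ) (s : B) : L2 W →L[ℂ] L2 W :=
  leftTranslation (cs.simple s) + (heckeCoeff q s : ℂ) • weakProj cs (cs.simple s)

/-- The defining formula of `T_s^{(q)}` on basis vectors. -/
lemma heckeGen_delta (q : B → ℝ) (s : B) (w : W) :
    heckeGen cs q s (delta w) =
      if cs.length w < cs.length (cs.simple s * w) then delta (cs.simple s * w)
      else delta (cs.simple s * w) + (heckeCoeff q s : ℂ) • delta w := by
  classical
  have h1 : leftTranslation (cs.simple s) (delta w) = delta (cs.simple s * w) :=
    permOp_delta _ _
  have h2 : weakProj cs (cs.simple s) (delta w) =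
      if cs.length w < cs.length (cs.simple s * w) then 0 else delta w := by
    by_cases hs : WeakLE cs (cs.simple s) w
    · have hs' := simple_weakLE_iff.1 hs
      rw [if_neg (by omega)]
      refine l2_ext fun v => ?_
      rw [weakProj, coordProj_apply, Set.mem_ofPred_eq, delta_apply]
      by_cases hv : v = w
      · subst hv; simp [hs]
      · simp [hv]
    · have hs' := simple_not_weakLE_iff.1 hs
      rw [if_pos (by omega)]
      refine l2_ext fun v => ?_
      rw [weakProj, coordProj_apply, Set.mem_ofPred_eq, delta_apply]
      by_cases hv : v = w
      · subst hv; simp [hs]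
      · simp [hv]
  rw [heckeGen, add_apply, smul_apply, h1, h2]
  split_ifs <;> simp

lemma heckeGen_one (s : B) : heckeGen cs 1 s = leftTranslation (cs.simple s) := by
  simp [heckeGen, heckeCoeff]

/-- The reduced Hecke C⋆-algebra: the norm closure of the `*`-algebra generated by the
`T_s^{(q)}`. -/
def heckeCStar (q : B → ℝ) : StarSubalgebra ℂ (L2 W →L[ℂ] L2 W) :=
  (StarAlgebra.adjoin ℂ (Set.range (heckeGen cs q))).topologicalClosure

/-- The C⋆-algebra `𝔄(W)` generated by all Hecke C⋆-algebras of the system. -/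
def allHecke : StarSubalgebra ℂ (L2 W →L[ℂ] L2 W) :=
  (StarAlgebra.adjoin ℂ
    (⋃ q ∈ paramSet cs, (heckeCStar cs q : Set (L2 W →L[ℂ] L2 W)))).topologicalClosure

variable {cs}

lemma heckeCStar_le {q : B → ℝ} (hq : q ∈ paramSet cs) : heckeCStar cs q ≤ allHecke cs :=
  fun _ hx => StarSubalgebra.le_topologicalClosure _
    (StarAlgebra.subset_adjoin ℂ _ (Set.mem_biUnion hq hx))

lemma heckeGen_mem (q : B → ℝ) (s : B) : heckeGen cs q s ∈ heckeCStar cs q :=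
  StarSubalgebra.le_topologicalClosure _ (StarAlgebra.subset_adjoin ℂ _ ⟨s, rfl⟩)

lemma const_mem_paramSet {c : ℝ} (hc : 0 < c) : (fun _ => c) ∈ paramSet cs :=
  ⟨fun _ => hc, fun _ _ _ => rfl⟩

lemma leftTranslation_mem (w : W) : leftTranslation w ∈ allHecke cs := by
  induction w using cs.simple_induction_left with
  | one => rw [leftTranslation_one]; exact one_mem _
  | mul_simple_left w i h =>
    rw [leftTranslation_mul, ← heckeGen_one]
    exact mul_mem (heckeCStar_le (const_mem_paramSet one_pos) (heckeGen_mem 1 i)) h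

lemma weakProj_simple_mem (s : B) : weakProj cs (cs.simple s) ∈ allHecke cs := by
  have h4 : heckeGen cs (fun _ => 4) s ∈ allHecke cs :=
    heckeCStar_le (const_mem_paramSet (by norm_num)) (heckeGen_mem _ s)
  have h := sub_mem h4 (leftTranslation_mem (cs := cs) (cs.simple s))
  have hc : (heckeCoeff (fun _ => 4) s : ℂ) ≠ 0 := by
    have : √(4 : ℝ) ≠ 0 := by positivity
    simp only [heckeCoeff, ne_eq, Complex.ofReal_eq_zero, div_eq_zero_iff]
    norm_num
  rw [heckeGen, add_sub_cancel_left] at h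
  have h' := (allHecke cs).smul_mem h (heckeCoeff (fun _ => 4) s : ℂ)⁻¹
  rwa [smul_smul, inv_mul_cancel₀ hc, one_smul] at h'

lemma weakProj_simple_mul {s : B} {w : W} (h : ¬ WeakLE cs (cs.simple s) w) :
    weakProj cs (cs.simple s * w) = weakProj cs (cs.simple s) *
      (leftTranslation (cs.simple s) * weakProj cs w * leftTranslation (cs.simple s)) := by
  classical
  refine ContinuousLinearMap.ext fun ξ => l2_ext fun v => ?_
  simp only [ContinuousLinearMap.mul_def, ContinuousLinearMap.comp_apply, weakProj,
    coordProj_apply, leftTranslation, permOp_apply, Set.mem_ofPred_eq, Equiv.mulLeft_symm,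
    Equiv.coe_mulLeft, cs.inv_simple, cs.simple_mul_simple_cancel_left]
  have hsw := simple_weakLE_mul_iff.2 h
  by_cases hv : WeakLE cs (cs.simple s) v
  · have := weakLE_simple_mul (iff_of_true hsw hv)
    rw [cs.simple_mul_simple_cancel_left] at this
    simp [hv, this]
  · rw [if_neg fun h' => hv (hsw.trans h'), if_neg hv]

lemma weakProj_mem (w : W) : weakProj cs w ∈ allHecke cs := by
  induction hn : cs.length w generalizing w with
  | zero =>
    rw [cs.length_eq_zero_iff] at hn
    subst hn
    have : weakProj cs 1 = 1 := by
      classical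
      refine ContinuousLinearMap.ext fun ξ => l2_ext fun v => ?_
      simp [weakProj, coordProj_apply, one_weakLE]
    rw [this]
    exact one_mem _
  | succ n ih =>
    have hw : w ≠ 1 := by rintro rfl; simp at hn
    obtain ⟨s, hs⟩ := cs.exists_leftDescent_of_ne_one hw
    replace hs := cs.isLeftDescent_iff.1 hs
    have h : ¬ WeakLE cs (cs.simple s) (cs.simple s * w) := by
      rw [simple_weakLE_mul_iff, not_not, simple_weakLE_iff]; exact hs
    have e := weakProj_simple_mul h
    rw [cs.simple_mul_simple_cancel_left] at e
    rw [e]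
    exact mul_mem (weakProj_simple_mem s) (mul_mem (mul_mem (leftTranslation_mem _)
      (ih _ (by omega))) (leftTranslation_mem _))

variable (cs)

/-- The quotient map `π` by the compact operators, restricted to `𝔄(W) → π(𝔄(W))`. -/
def heckePi : allHecke cs →⋆ₐ[ℂ] (allHecke cs).map (calkinMap (L2 W)) :=
  StarAlgHom.codRestrict ((calkinMap (L2 W)).comp (allHecke cs).subtype) _
    fun x => ⟨x.1, x.2, rfl⟩

/-- The characteristic function of `{z | w ≤ z}` on the boundary. -/
def boundaryChar (w : W) : C(Boundary cs, ℂ) :=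
  (LocallyConstant.charFn ℂ
    ((Bordification.isClopen_above w).preimage
      (continuous_subtype_val (p := (· ∈ graphBoundary (cayley cs) 1))))).toContinuousMap

end Hecke

end Operators

end HeckeBoundary

open HeckeBoundary

/-!
The isomorphism `κ` is given by passing to limit operators at the boundary. Let `R_x` be the right
translation `δ_h ↦ δ_{hx}` of `ℓ²(W)`. If `x_n → z ∈ ∂(W,S)`, then `R_{x_n}⁻¹ T R_{x_n}` converges
`*`-strongly for every `T ∈ 𝔄(W)`: it is constant for a left translation, and for `P_w` it is
diagonal with entries `[w ≤ h x_n]`, which are eventually equal to `χ_w(hz)`. The sum of these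
limits over all `z` is an operator `Φ(T)` on `ℓ²(∂(W,S) × W)`, the space on which the reduced
crossed product acts, and `Φ` is a `*`-homomorphism from `𝔄(W)` to `C(∂(W,S)) ⋊_r W` which maps
`T_w^{(1)}` to `λ_w` and `P_w` to `χ_w` (`exists_limitMap`). Its image is closed
(`isClosed_range_starAlgHom`), so that `Φ` is surjective by the Stone–Weierstrass theorem
(`surjective_of_strongLimit`). Therefore it suffices to identify the kernel of `Φ` with the compact
operators in `𝔄(W)`.

Compact operators are mapped to `0` because a sequence that converges to the boundary leaves every
finite set (`StrongLimit.eq_zero_of_isCompactOperator`). Conversely, if `Φ(T) = 0`, then, by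
compactness, the matrix coefficients of `T` along each diagonal `{(x, gx) | x ∈ W}` tend to zero.
If `T` has finite propagation, then it is compact, and in general `T` is approximated by Schur
multiples of finite propagation with the same property (`isCompactOperator_of_tendsto_coeff`). Such
Schur multipliers exist because `W` has property A (`exists_propertyA_sets`): the reflections of `W`
can be coloured by finitely many colours such that walls of the same colour do not cross
(`exists_wall_colouring`), so that the walls of one colour that separate `x` from `1` form a chain,
and one attaches to `x` the tuples of walls that are among the last `n` in their chains. The
colouring is obtained from the geometric representation, reduced modulo `3`: if two walls cross,
then the product of the two reflections has finite order (`isOfFinOrder_of_crossing`), and an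
element of finite order which is congruent to `1` modulo `3` is trivial by Minkowski's lemma
(`eq_one_of_pow_eq_one_of_modEq_three`).

For the last assertion one has to show that `C*_{r,q}(W)` contains no nonzero compact operator if
`q ∉ R'`. A spectral projection `p` of such an operator has finite rank and commutes with the right
Hecke algebra; this gives `‖p δ_w‖² ≥ q'_w ‖p δ_1‖²` for `q'_s = min(q_s, 1/q_s)`, and then the
growth series converges at `q'` (`eq_zero_of_mem_heckeCStar_of_isCompactOperator`).
-/

namespace HeckeBoundary

/-! ### The geometric representation -/

noncomputable section GeometricRepresentation

open Polynomial Polynomial.Chebyshev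

variable {B W : Type*} [Group W]

/-- The subring of `ℝ` generated by the numbers `2 cos(π / m_{st})`. -/
def cosRing (M : CoxeterMatrix B) : Subalgebra ℤ ℝ :=
  Algebra.adjoin ℤ (Set.range fun p : B × B => 2 * Real.cos (Real.pi / M p.1 p.2))

/-- The number `2 cos(π / m_{st})`. With the conventions `m = 0` for `m = ∞` and `π / 0 = 0`
it is `2` for `m = ∞`, and it is `-2` on the diagonal. -/
def cosCoeff (M : CoxeterMatrix B) (s t : B) : cosRing M :=
  ⟨2 * Real.cos (Real.pi / M s t), Algebra.subset_adjoin ⟨(s, t), rfl⟩⟩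

variable (M : CoxeterMatrix B)

lemma coe_cosCoeff (s t : B) : (cosCoeff M s t : ℝ) = 2 * Real.cos (Real.pi / M s t) := rfl

lemma cosRing_coe_two : ((2 : cosRing M) : ℝ) = 2 := rfl

lemma cosCoeff_self (s : B) : cosCoeff M s s = -2 := by
  apply Subtype.ext
  simp [coe_cosCoeff, cosRing_coe_two]

lemma cosCoeff_comm (s t : B) : cosCoeff M s t = cosCoeff M t s := by
  rw [cosCoeff, cosCoeff]; simp only [M.symmetric s t]

lemma coe_eval_S (x : cosRing M) (n : ℤ) :
    (((S (cosRing M) n).eval x : cosRing M) : ℝ) = (S ℝ n).eval (x : ℝ) := by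
  have := Polynomial.Chebyshev.algebraMap_eval_S (R := cosRing M) (R' := ℝ) x n
  exact this

/-- The Chebyshev coefficients that occur in products of fewer than `m_{st}` alternating
reflections are nonnegative. -/
lemma eval_S_cosCoeff_nonneg {s t : B} (hst : s ≠ t) (k : ℕ) (hk : M s t ≠ 0 → k < M s t) :
    0 ≤ (S (cosRing M) k).eval (cosCoeff M s t) := by
  rw [← Subtype.coe_le_coe, coe_eval_S, coe_cosCoeff]
  by_cases h0 : M s t = 0
  · rw [h0]
    simp only [Nat.cast_zero, div_zero, Real.cos_zero, mul_one, S_eval_two]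
    rw [ZeroMemClass.coe_zero]; positivity
  · have h1 : M s t ≠ 1 := M.off_diagonal s t hst
    have h2 : 2 ≤ M s t := by omega
    have h2' : (2 : ℝ) ≤ M s t := by exact_mod_cast h2
    have hsin : 0 < Real.sin (Real.pi / M s t) := by
      apply Real.sin_pos_of_pos_of_lt_pi (by positivity)
      rw [div_lt_iff₀ (by positivity)]
      nlinarith [Real.pi_pos]
    have key := S_two_mul_real_cos (Real.pi / M s t) (k : ℤ)
    have hnn : 0 ≤ Real.sin (((k : ℤ) + 1 : ℝ) * (Real.pi / M s t)) := by
      apply Real.sin_nonneg_of_nonneg_of_le_pi (by positivity)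
      have : ((k : ℤ) + 1 : ℝ) ≤ M s t := by
        have := hk h0
        exact_mod_cast this
      calc _ ≤ (M s t : ℝ) * (Real.pi / M s t) := by gcongr
        _ = Real.pi := by field_simp
    rw [← key] at hnn
    exact nonneg_of_mul_nonneg_left hnn hsin

/-- The two Chebyshev identities at `2 cos(2π/m)` that make the product of two reflections in
roots of angle `π/m` have order dividing `m`. -/
lemma eval_S_braid {s t : B} (hst : s ≠ t) (h0 : M s t ≠ 0) (h2 : M s t ≠ 2) (x : cosRing M)
    (hx : x = cosCoeff M s t * cosCoeff M t s - 2) :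
    (S (cosRing M) ((M s t - 2 : ℤ) / 2)).eval x *
      ((S (cosRing M) ((M s t - 1 : ℤ) / 2)).eval x +
        (S (cosRing M) ((M s t - 3 : ℤ) / 2)).eval x) = 0 ∧
    (S (cosRing M) ((M s t - 1 : ℤ) / 2)).eval x *
      ((S (cosRing M) ((M s t : ℤ) / 2)).eval x +
        (S (cosRing M) ((M s t - 2 : ℤ) / 2)).eval x) = 0 := by
  have h1 : M s t ≠ 1 := M.off_diagonal s t hst
  obtain ⟨m, hm⟩ : ∃ m, M s t = m := ⟨_, rfl⟩
  have hx' : (x : ℝ) = 2 * Real.cos (2 * Real.pi / m) := by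
    rw [hx]
    push_cast
    rw [cosCoeff_comm M t s, coe_cosCoeff, hm, mul_div_assoc, Real.cos_two_mul]
    rw [cosRing_coe_two]; ring
  rw [hm] at h0 h1 h2 ⊢
  have h3 : 3 ≤ m := by omega
  have h3' : (3 : ℝ) ≤ m := by exact_mod_cast h3
  have hsin : Real.sin (2 * Real.pi / m) ≠ 0 := by
    apply ne_of_gt
    apply Real.sin_pos_of_pos_of_lt_pi (by positivity)
    rw [div_lt_iff₀ (by positivity)]
    nlinarith [Real.pi_pos]
  have key := fun n : ℤ => S_two_mul_real_cos (2 * Real.pi / m) n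
  simp only [← hx', ← coe_eval_S M] at key
  have hz : ∀ a : cosRing M, (a : ℝ) * Real.sin (2 * Real.pi / m) = 0 → a = 0 := by
    intro a ha
    apply Subtype.ext
    simpa [hsin] using ha
  rcases Nat.even_or_odd' m with ⟨k, rfl | rfl⟩
  · have e1 : (((2 * k : ℕ) : ℤ) - 2) / 2 = k - 1 := by omega
    have e2 : (((2 * k : ℕ) : ℤ) - 1) / 2 = k - 1 := by omega
    have : (S (cosRing M) ((k : ℤ) - 1)).eval x = 0 := by
      apply hz
      rw [key]
      have : (((k : ℤ) - 1 : ℤ) + 1 : ℝ) * (2 * Real.pi / ((2 * k : ℕ) : ℝ)) = Real.pi := by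
        have : (k : ℝ) ≠ 0 := by norm_cast; omega
        push_cast; field_simp; ring
      rw [this, Real.sin_pi]
    rw [e1, e2, this]
    simp
  · have e1 : (((2 * k + 1 : ℕ) : ℤ) - 2) / 2 = k - 1 := by omega
    have e2 : (((2 * k + 1 : ℕ) : ℤ) - 1) / 2 = k := by omega
    have e3 : (((2 * k + 1 : ℕ) : ℤ) - 3) / 2 = k - 1 := by omega
    have e4 : (((2 * k + 1 : ℕ) : ℤ)) / 2 = k := by omega
    have : (S (cosRing M) (k : ℤ)).eval x + (S (cosRing M) ((k : ℤ) - 1)).eval x = 0 := by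
      apply hz
      rw [AddMemClass.coe_add, add_mul, key, key]
      have : ((k : ℤ) + 1 : ℝ) * (2 * Real.pi / ((2 * k + 1 : ℕ) : ℝ)) =
          2 * Real.pi - (((k : ℤ) - 1 : ℤ) + 1 : ℝ) * (2 * Real.pi / ((2 * k + 1 : ℕ) : ℝ)) := by
        push_cast; field_simp; ring
      rw [this, Real.sin_two_pi_sub]
      ring
    rw [e1, e2, e3, e4, this]
    simp

variable [Fintype B] [DecidableEq B]

/-- The linear form `v ↦ 2 B(α_s, v)` of the geometric representation. -/
def rootForm (s : B) : Module.Dual (cosRing M) (B → cosRing M) :=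
  ∑ t, (-cosCoeff M s t) • LinearMap.proj t

/-- The simple root `α_s`. -/
def simpleRoot (s : B) : B → cosRing M := Pi.single s 1

lemma rootForm_simpleRoot (s t : B) : rootForm M s (simpleRoot M t) = -cosCoeff M s t := by
  simp [rootForm, simpleRoot, Pi.single_apply]

lemma rootForm_simpleRoot_self (s : B) : rootForm M s (simpleRoot M s) = 2 := by
  rw [rootForm_simpleRoot, cosCoeff_self, neg_neg]

/-- The reflection in the simple root `α_s`. -/
def simpleRefl (s : B) : (B → cosRing M) ≃ₗ[cosRing M] (B → cosRing M) :=
  Module.reflection (rootForm_simpleRoot_self M s)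

lemma simpleRefl_simpleRoot (s t : B) :
    simpleRefl M s (simpleRoot M t) = simpleRoot M t + cosCoeff M s t • simpleRoot M s := by
  rw [simpleRefl, Module.reflection_apply, rootForm_simpleRoot, neg_smul, sub_neg_eq_add]

lemma simpleRefl_liftable : M.IsLiftable (simpleRefl M) := by
  intro s t
  by_cases hst : s = t
  · subst hst
    rw [M.diagonal, pow_one]
    ext1 v
    exact Module.involutive_reflection _ v
  by_cases h0 : M s t = 0
  · rw [h0, pow_zero]
  by_cases h2 : M s t = 2
  · have hc : cosCoeff M s t = 0 := by
      apply Subtype.ext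
      simp [coe_cosCoeff, h2]
    have h1 : rootForm M s (simpleRoot M t) = 0 := by rw [rootForm_simpleRoot, hc, neg_zero]
    have h1' : rootForm M t (simpleRoot M s) = 0 := by
      rw [rootForm_simpleRoot, cosCoeff_comm, hc, neg_zero]
    rw [h2]
    ext1 v
    simp only [pow_two, LinearEquiv.mul_apply, simpleRefl, Module.reflection_apply, map_sub,
      map_smul, h1, h1', rootForm_simpleRoot_self, LinearEquiv.coe_one, id_eq]
    module
  · ext1 v
    have hx : rootForm M s (simpleRoot M t) * rootForm M t (simpleRoot M s) - 2 =
        cosCoeff M s t * cosCoeff M t s - 2 := by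
      rw [rootForm_simpleRoot, rootForm_simpleRoot]; ring
    obtain ⟨e1, e2⟩ := eval_S_braid M hst h0 h2 _ hx
    rw [simpleRefl, simpleRefl, Module.reflection_mul_reflection_pow_apply, e1, e2]
    simp

variable {M} (cs : CoxeterSystem M W)

/-- The geometric representation of a Coxeter group, over the ring generated by the
`2 cos(π / m_{st})`. -/
def geomRep : W →* ((B → cosRing M) ≃ₗ[cosRing M] (B → cosRing M)) :=
  cs.lift ⟨simpleRefl M, simpleRefl_liftable M⟩

lemma geomRep_simple (s : B) : geomRep cs (cs.simple s) = simpleRefl M s :=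
  cs.lift_apply_simple _ _

lemma geomRep_mul_apply (v w : W) (x : B → cosRing M) :
    geomRep cs (v * w) x = geomRep cs v (geomRep cs w x) := by
  rw [map_mul]; rfl

lemma geomRep_simple_simpleRoot_self (s : B) :
    geomRep cs (cs.simple s) (simpleRoot M s) = -simpleRoot M s := by
  rw [geomRep_simple, simpleRefl_simpleRoot, cosCoeff_self]
  module

/-- The product of `k` alternating reflections applied to a simple root. -/
lemma geomRep_alternatingWord (s t : B) (k : ℕ) :
    geomRep cs (cs.wordProd (CoxeterSystem.alternatingWord s t k)) (simpleRoot M s) =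
      if Even k then
        (S (cosRing M) k).eval (cosCoeff M s t) • simpleRoot M s +
          (S (cosRing M) (k - 1)).eval (cosCoeff M s t) • simpleRoot M t
      else
        (S (cosRing M) k).eval (cosCoeff M s t) • simpleRoot M t +
          (S (cosRing M) (k - 1)).eval (cosCoeff M s t) • simpleRoot M s := by
  induction k with
  | zero => simp [CoxeterSystem.alternatingWord]
  | succ k ih =>
    rw [CoxeterSystem.alternatingWord_succ', cs.wordProd_cons, geomRep_mul_apply, ih]
    have e : (S (cosRing M) ((k + 1 : ℕ) : ℤ)).eval (cosCoeff M s t) =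
        cosCoeff M s t * (S (cosRing M) k).eval (cosCoeff M s t) -
          (S (cosRing M) (k - 1)).eval (cosCoeff M s t) := by
      rw [Nat.cast_add, Nat.cast_one, S_add_one]
      simp
    have e' : (((k + 1 : ℕ) : ℤ) - 1) = k := by push_cast; ring
    rw [e, e']
    by_cases hk : Even k
    · have hk' : ¬ Even (k + 1) := by simpa [Nat.even_add_one] using hk
      simp only [hk, hk', if_true, if_false, map_add, map_smul, geomRep_simple,
        simpleRefl_simpleRoot, cosCoeff_self, cosCoeff_comm M t s]
      module
    · have hk' : Even (k + 1) := by simpa [Nat.even_add_one] using hk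
      simp only [hk, hk', if_true, if_false, map_add, map_smul, geomRep_simple,
        simpleRefl_simpleRoot, cosCoeff_self]
      module

end GeometricRepresentation

/-! ### Positive and negative roots -/

section RootPositivity

open Polynomial Polynomial.Chebyshev

variable {B W : Type*} [Group W] {M : CoxeterMatrix B} [Fintype B] [DecidableEq B]
  (cs : CoxeterSystem M W)

omit [Fintype B] in
lemma simpleRoot_nonneg (s : B) : 0 ≤ simpleRoot M s := by
  intro t
  by_cases h : t = s
  · subst h; simp [simpleRoot]
  · simp [simpleRoot, h]

/-- The root `wα_s` is positive if `|ws| > |w|`. For the induction write `w = v a` with `a` the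
longest alternating word in `s` and a right descent `t` of `w` that splits off from `w`; then
neither `s` nor `t` is a right descent of `v`, and `a α_s` is a nonnegative combination of `α_s`
and `α_t`. -/
theorem geomRep_simpleRoot_nonneg {w : W} {s : B}
    (h : cs.length w < cs.length (w * cs.simple s)) : 0 ≤ geomRep cs w (simpleRoot M s) := by
  induction hn : cs.length w using Nat.strong_induction_on generalizing w s with
  | _ n ih =>
  subst hn
  by_cases hw : w = 1
  · subst hw
    rw [map_one]
    exact simpleRoot_nonneg s
  obtain ⟨t, ht⟩ := cs.exists_rightDescent_of_ne_one hw
  have ht' := cs.isRightDescent_iff.1 ht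
  have hst : s ≠ t := by
    rintro rfl
    omega
  set a : ℕ → W := fun k => cs.wordProd (CoxeterSystem.alternatingWord s t k) with ha
  have ha1 : ∀ k, a (k + 1) = cs.simple (if Even k then t else s) * a k := by
    intro k
    rw [ha]
    simp only [CoxeterSystem.alternatingWord_succ', cs.wordProd_cons]
  have hal : ∀ k, cs.length (a k) ≤ k := fun k =>
    (cs.length_wordProd_le _).trans_eq (CoxeterSystem.length_alternatingWord _ _ _)
  obtain ⟨P, hP⟩ : ∃ P : ℕ → Prop, ∀ k, P k ↔ ∃ v, w = v * a k ∧ cs.length w = cs.length v + k :=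
    ⟨_, fun _ => Iff.rfl⟩
  have hP1 : P 1 := by
    refine (hP 1).2 ⟨w * cs.simple t, ?_, ht'.symm⟩
    rw [ha1, ha]
    simp [CoxeterSystem.alternatingWord]
  have hPd : ∀ k, P (k + 1) → P k := by
    intro k hk
    obtain ⟨v, e, l⟩ := (hP _).1 hk
    rw [ha1, ← mul_assoc] at e
    refine (hP k).2 ⟨_, e, ?_⟩
    have h1 := cs.length_mul_le (v * cs.simple (if Even k then t else s)) (a k)
    have h2 := cs.length_mul_le v (cs.simple (if Even k then t else s))
    rw [← e] at h1
    rw [cs.length_simple] at h2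
    have := hal k
    omega
  have hPle : ∀ j k, j ≤ k → P k → P j := by
    intro j k hjk
    induction hjk with
    | refl => exact id
    | step _ ih => exact fun h => ih (hPd _ h)
  obtain ⟨k, hk1, hk, hk2⟩ : ∃ k, 1 ≤ k ∧ P k ∧ ¬ P (k + 1) := by
    by_contra! hcon
    have hall : ∀ k, P (k + 1) := by
      intro k
      induction k with
      | zero => exact hP1
      | succ k ih => exact hcon _ (by omega) ih
    obtain ⟨v, -, l⟩ := (hP _).1 (hall (cs.length w))
    omega
  -- past `m_{st}` letters the braid relation would make `s` a right descent of `w`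
  have hkm : M s t ≠ 0 → k < M s t := by
    intro h0
    by_contra! hc
    obtain ⟨v, e, l⟩ := (hP _).1 (hPle _ _ hc hk)
    obtain ⟨m, hm⟩ : ∃ m, M s t = m + 1 := Nat.exists_eq_succ_of_ne_zero h0
    have hb : a (M s t) = a m * cs.simple s := by
      have := cs.wordProd_braidWord_eq s t
      rw [CoxeterSystem.braidWord, CoxeterSystem.braidWord, M.symmetric t s, hm,
        CoxeterSystem.alternatingWord_succ t s, cs.wordProd_concat] at this
      rw [hm, ha]
      exact this
    have e' : w * cs.simple s = v * a m := by
      rw [e, hb]; simp [mul_assoc]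
    have h1 := cs.length_mul_le v (a m)
    rw [← e'] at h1
    have := hal m
    omega
  obtain ⟨v, e, l⟩ := (hP _).1 hk
  obtain ⟨j, rfl⟩ : ∃ j, k = j + 1 := Nat.exists_eq_succ_of_ne_zero (by omega)
  have hx : cs.length v < cs.length (v * cs.simple (if Even j then t else s)) := by
    rcases cs.length_mul_simple v (if Even j then t else s) with h' | h'
    · omega
    · exfalso
      rw [ha1, ← mul_assoc] at e
      have h1 := cs.length_mul_le (v * cs.simple (if Even j then t else s)) (a j)
      rw [← e] at h1
      have := hal j
      omega
  have hy : cs.length v < cs.length (v * cs.simple (if Even (j + 1) then t else s)) := by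
    rcases cs.length_mul_simple v (if Even (j + 1) then t else s) with h' | h'
    · omega
    · exfalso
      refine hk2 ((hP _).2 ⟨v * cs.simple (if Even (j + 1) then t else s), ?_, by omega⟩)
      rw [ha1 (j + 1), e]
      simp [mul_assoc]
  have hvs : 0 ≤ geomRep cs v (simpleRoot M s) := by
    by_cases hj : Even j
    · exact ih _ (by omega) (by simpa [Nat.even_add_one, hj] using hy) rfl
    · exact ih _ (by omega) (by simpa [hj] using hx) rfl
  have hvt : 0 ≤ geomRep cs v (simpleRoot M t) := by
    by_cases hj : Even j
    · exact ih _ (by omega) (by simpa [hj] using hx) rfl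
    · exact ih _ (by omega) (by simpa [Nat.even_add_one, hj] using hy) rfl
  have hU := eval_S_cosCoeff_nonneg M hst (j + 1) hkm
  have hU' := eval_S_cosCoeff_nonneg M hst j fun h0 => lt_trans (Nat.lt_succ_self j) (hkm h0)
  have ej : (((j + 1 : ℕ) : ℤ) - 1) = j := by push_cast; ring
  rw [e, geomRep_mul_apply, ha, geomRep_alternatingWord, ej]
  have hc : ∀ (p q : cosRing M) (x y : B → cosRing M), 0 ≤ p → 0 ≤ q → 0 ≤ x → 0 ≤ y →
      0 ≤ p • x + q • y := fun p q x y hp hq hx hy i =>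
    add_nonneg (mul_nonneg hp (hx i)) (mul_nonneg hq (hy i))
  split_ifs
  · rw [map_add, map_smul, map_smul]; exact hc _ _ _ _ hU hU' hvs hvt
  · rw [map_add, map_smul, map_smul]; exact hc _ _ _ _ hU hU' hvt hvs

theorem geomRep_simpleRoot_nonpos {w : W} {s : B}
    (h : cs.length (w * cs.simple s) < cs.length w) : geomRep cs w (simpleRoot M s) ≤ 0 := by
  have := geomRep_simpleRoot_nonneg cs (w := w * cs.simple s) (s := s)
    (by rwa [cs.simple_mul_simple_cancel_right])
  rw [geomRep_mul_apply, geomRep_simple_simpleRoot_self, map_neg] at this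
  exact neg_nonneg.1 this

omit [Fintype B] in
lemma simpleRoot_ne_zero (s : B) : simpleRoot M s ≠ 0 := by
  intro h
  have := congrFun h s
  simp [simpleRoot] at this

lemma geomRep_simpleRoot_ne_zero (w : W) (s : B) : geomRep cs w (simpleRoot M s) ≠ 0 := by
  rw [Ne, LinearEquiv.map_eq_zero_iff]
  exact simpleRoot_ne_zero s

/-- The geometric representation is faithful. -/
theorem geomRep_injective : Function.Injective (geomRep cs) := by
  refine (injective_iff_map_eq_one _).2 fun w hw => ?_
  by_contra hw1
  obtain ⟨s, hs⟩ := cs.exists_rightDescent_of_ne_one hw1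
  have := geomRep_simpleRoot_nonpos cs hs
  rw [hw] at this
  exact simpleRoot_ne_zero s (le_antisymm this (simpleRoot_nonneg s))

/-- A root is positive or negative. -/
lemma root_nonneg_or_nonpos (w : W) (s : B) :
    0 ≤ geomRep cs w (simpleRoot M s) ∨ geomRep cs w (simpleRoot M s) ≤ 0 := by
  rcases cs.length_mul_simple w s with h | h
  · exact Or.inl (geomRep_simpleRoot_nonneg cs (by omega))
  · exact Or.inr (geomRep_simpleRoot_nonpos cs (by omega))

omit [Fintype B] [DecidableEq B] in
lemma sep_one [DecidableEq W] (t : W) : sep cs 1 t = 0 := by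
  have := sep_wordProd cs [] t
  simpa using this

lemma zmod_two_eq (a : ZMod 2) : a = 0 ∨ a = 1 := by
  revert a; decide

lemma sep_simple_eq_zero_iff [DecidableEq W] (y : W) (s : B) :
    sep cs y (cs.simple s) = 0 ↔ 0 ≤ geomRep cs y⁻¹ (simpleRoot M s) := by
  have e : cs.length (y⁻¹ * cs.simple s) = cs.length (cs.simple s * y) := by
    rw [← cs.length_inv, mul_inv_rev, inv_inv, cs.inv_simple]
  constructor
  · intro h
    apply geomRep_simpleRoot_nonneg
    rw [e, cs.length_inv]
    by_contra hc
    have hne := cs.length_simple_mul_ne y s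
    rw [sep_of_descent cs (by omega)] at h
    exact absurd h (by decide)
  · intro h
    rcases zmod_two_eq (sep cs y (cs.simple s)) with h0 | h0
    · exact h0
    · exfalso
      have hl := length_lt_of_sep cs (w := y) (t := cs.simple s) (by rw [h0]; decide)
      have := geomRep_simpleRoot_nonpos cs (w := y⁻¹) (s := s) (by rw [e, cs.length_inv]; exact hl)
      exact geomRep_simpleRoot_ne_zero cs _ _ (le_antisymm this h)

/-- The reflection `u s u⁻¹` separates `x` and `y` if and only if the root `u α_s`, seen from `x`
and from `y`, has different signs. -/
lemma sep_conj_eq_iff [DecidableEq W] (u x y : W) (s : B) :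
    sep cs x (u * cs.simple s * u⁻¹) = sep cs y (u * cs.simple s * u⁻¹) ↔
      (0 ≤ geomRep cs (x⁻¹ * u) (simpleRoot M s) ↔
        0 ≤ geomRep cs (y⁻¹ * u) (simpleRoot M s)) := by
  have key : ∀ z, sep cs z (u * cs.simple s * u⁻¹) =
      sep cs u (u * cs.simple s * u⁻¹) + sep cs (u⁻¹ * z) (cs.simple s) := by
    intro z
    have := sep_mul cs u (u⁻¹ * z) (u * cs.simple s * u⁻¹)
    rw [mul_inv_cancel_left] at this
    rw [this]
    congr 2
    simp [mul_assoc]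
  rw [key x, key y, add_right_inj]
  have hx := sep_simple_eq_zero_iff cs (u⁻¹ * x) s
  have hy := sep_simple_eq_zero_iff cs (u⁻¹ * y) s
  rw [mul_inv_rev, inv_inv] at hx hy
  rw [← hx, ← hy]
  rcases zmod_two_eq (sep cs (u⁻¹ * x) (cs.simple s)) with h | h <;>
  rcases zmod_two_eq (sep cs (u⁻¹ * y) (cs.simple s)) with h' | h' <;> simp [h, h']

end RootPositivity

/-! ### Crossing walls -/

section Walls

variable {B W : Type*} [Group W] {M : CoxeterMatrix B} (cs : CoxeterSystem M W)

/-- Only finitely many reflections separate two given elements. -/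
lemma finite_sep_ne [DecidableEq W] (x y : W) : {t | sep cs x t ≠ sep cs y t}.Finite := by
  have h : ∀ w, {t | sep cs w t ≠ 0}.Finite := by
    intro w
    obtain ⟨ω, -, rfl⟩ := cs.exists_isReduced w
    refine (List.finite_toSet (cs.leftInvSeq ω)).subset fun t ht => ?_
    by_contra hc
    refine ht ?_
    rw [sep_wordProd, List.count_eq_zero_of_not_mem hc, Nat.cast_zero]
  refine ((h x).union (h y)).subset fun t ht => ?_
  by_contra hc
  simp only [Set.mem_union, Set.mem_ofPred_eq, not_or, not_not] at hc
  exact ht (hc.1.trans hc.2.symm)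

variable [Fintype B] [DecidableEq B]

lemma exists_pos_root {t : W} (ht : cs.IsReflection t) :
    ∃ u s, t = u * cs.simple s * u⁻¹ ∧ 0 ≤ geomRep cs u (simpleRoot M s) := by
  obtain ⟨u, s, rfl⟩ := ht
  rcases root_nonneg_or_nonpos cs u s with h | h
  · exact ⟨u, s, rfl, h⟩
  · refine ⟨u * cs.simple s, s, by simp [mul_assoc], ?_⟩
    rw [geomRep_mul_apply, geomRep_simple_simpleRoot_self, map_neg]
    exact neg_nonneg.2 h

/-- A reflection moves vectors along its root. -/
lemma exists_geomRep_reflection (u : W) (s : B) (v : B → cosRing M) :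
    ∃ c : cosRing M, geomRep cs (u * cs.simple s * u⁻¹) v =
      v + c • geomRep cs u (simpleRoot M s) := by
  refine ⟨-rootForm M s (geomRep cs u⁻¹ v), ?_⟩
  rw [geomRep_mul_apply, geomRep_mul_apply, geomRep_simple, simpleRefl, Module.reflection_apply,
    map_sub, map_smul, ← geomRep_mul_apply, mul_inv_cancel, map_one, LinearEquiv.coe_one, id_eq]
  module

/-- If the walls of two reflections cross, then the product of the reflections has finite order:
otherwise the dihedral group they generate contains infinitely many reflections, and the walls of
these all separate one of two pairs of opposite quadrants. -/
theorem isOfFinOrder_of_crossing [DecidableEq W] {t t' : W} (ht : cs.IsReflection t)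
    (ht' : cs.IsReflection t') {x y z : W} (hx : sep cs x t = 1) (hx' : sep cs x t' = 1)
    (hy : sep cs y t = 1) (hy' : sep cs y t' = 0) (hz : sep cs z t = 0) (hz' : sep cs z t' = 1) :
    IsOfFinOrder (t * t') := by
  by_contra hfin
  obtain ⟨u, s, rfl, hpos⟩ := exists_pos_root cs ht
  obtain ⟨u', s', rfl, hpos'⟩ := exists_pos_root cs ht'
  set β := geomRep cs u (simpleRoot M s) with hβ
  set β' := geomRep cs u' (simpleRoot M s') with hβ'
  -- the sign of a root at `p` is determined by the side of its wall on which `p` lies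
  have hsign : ∀ (v : W) (i : B) (p : W), 0 ≤ geomRep cs v (simpleRoot M i) →
      (sep cs p (v * cs.simple i * v⁻¹) = 0 → 0 ≤ geomRep cs p⁻¹ (geomRep cs v (simpleRoot M i))) ∧
      (sep cs p (v * cs.simple i * v⁻¹) = 1 →
        geomRep cs p⁻¹ (geomRep cs v (simpleRoot M i)) ≤ 0) := by
    intro v i p hv
    have h := sep_conj_eq_iff cs v p 1 i
    rw [sep_one, inv_one, one_mul, geomRep_mul_apply] at h
    constructor
    · intro h0
      exact (h.1 h0).2 hv
    · intro h1
      rcases root_nonneg_or_nonpos cs (p⁻¹ * v) i with h2 | h2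
      · rw [geomRep_mul_apply] at h2
        have := h.2 (iff_of_true h2 hv)
        rw [h1] at this
        exact absurd this (by decide)
      · rwa [geomRep_mul_apply] at h2
  have x1 := (hsign u s x hpos).2 hx
  have x2 := (hsign u' s' x hpos').2 hx'
  have y1 := (hsign u s y hpos).2 hy
  have y2 := (hsign u' s' y hpos').1 hy'
  have z1 := (hsign u s z hpos).1 hz
  have z2 := (hsign u' s' z hpos').2 hz'
  rw [← hβ] at x1 y1 z1
  rw [← hβ'] at x2 y2 z2
  set t := u * cs.simple s * u⁻¹ with htd
  set t' := u' * cs.simple s' * u'⁻¹ with htd'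
  set d := t * t' with hd
  have hroot : ∀ n : ℕ, ∃ a b : cosRing M, geomRep cs (d ^ n) β = a • β + b • β' := by
    intro n
    induction n with
    | zero => exact ⟨1, 0, by rw [pow_zero, map_one]; simp⟩
    | succ n ih =>
      obtain ⟨a, b, e⟩ := ih
      obtain ⟨c, hc⟩ := exists_geomRep_reflection cs u' s' (a • β + b • β')
      obtain ⟨c', hc'⟩ := exists_geomRep_reflection cs u s (a • β + b • β' + c • β')
      rw [← htd', ← hβ'] at hc
      rw [← htd, ← hβ] at hc'
      refine ⟨a + c', b + c, ?_⟩
      rw [pow_succ', geomRep_mul_apply, e, hd, geomRep_mul_apply, hc, hc']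
      module
  have hcomb : ∀ (a b : cosRing M) (v v' : B → cosRing M), (0 ≤ a ∧ 0 ≤ v ∨ a ≤ 0 ∧ v ≤ 0) →
      (0 ≤ b ∧ 0 ≤ v' ∨ b ≤ 0 ∧ v' ≤ 0) → 0 ≤ a • v + b • v' := by
    have h1 : ∀ (a : cosRing M) (v : B → cosRing M), (0 ≤ a ∧ 0 ≤ v ∨ a ≤ 0 ∧ v ≤ 0) →
        0 ≤ a • v := by
      rintro a v (⟨ha, hv⟩ | ⟨ha, hv⟩) i
      · exact mul_nonneg ha (hv i)
      · exact mul_nonneg_of_nonpos_of_nonpos ha (hv i)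
    exact fun a b v v' h h' => add_nonneg (h1 a v h) (h1 b v' h')
  have hcomb' : ∀ (a b : cosRing M) (v v' : B → cosRing M), (0 ≤ a ∧ v ≤ 0 ∨ a ≤ 0 ∧ 0 ≤ v) →
      (0 ≤ b ∧ v' ≤ 0 ∨ b ≤ 0 ∧ 0 ≤ v') → a • v + b • v' ≤ 0 := by
    intro a b v v' h h'
    have := hcomb a b (-v) (-v') (by simpa using h) (by simpa using h')
    have e : a • -v + b • -v' = -(a • v + b • v') := by module
    rw [e] at this
    exact neg_nonneg.1 this
  -- every reflection `d ^ n t d ^ (-n)` separates `1` from `x` or `y` from `z`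
  have hsep : ∀ n : ℕ, d ^ n * t * (d ^ n)⁻¹ ∈
      {r | sep cs 1 r ≠ sep cs x r} ∪ {r | sep cs y r ≠ sep cs z r} := by
    intro n
    obtain ⟨a, b, e⟩ := hroot n
    have er : d ^ n * t * (d ^ n)⁻¹ = (d ^ n * u) * cs.simple s * (d ^ n * u)⁻¹ := by
      rw [htd]; group
    have hat : ∀ p : W, geomRep cs (p⁻¹ * (d ^ n * u)) (simpleRoot M s) =
        a • geomRep cs p⁻¹ β + b • geomRep cs p⁻¹ β' := by
      intro p
      rw [geomRep_mul_apply, geomRep_mul_apply, ← hβ, e, map_add, map_smul, map_smul]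
    have hdiff : ∀ p q : W, 0 ≤ a • geomRep cs p⁻¹ β + b • geomRep cs p⁻¹ β' →
        a • geomRep cs q⁻¹ β + b • geomRep cs q⁻¹ β' ≤ 0 →
        sep cs p (d ^ n * t * (d ^ n)⁻¹) ≠ sep cs q (d ^ n * t * (d ^ n)⁻¹) := by
      intro p q hp hq hc
      rw [er, sep_conj_eq_iff, hat, hat] at hc
      have := geomRep_simpleRoot_ne_zero cs (q⁻¹ * (d ^ n * u)) s
      rw [hat] at this
      exact this (le_antisymm hq (hc.1 hp))
    have o1 : geomRep cs (1 : W)⁻¹ β = β := by rw [inv_one, map_one]; rfl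
    have o2 : geomRep cs (1 : W)⁻¹ β' = β' := by rw [inv_one, map_one]; rfl
    rcases le_total 0 a with ha | ha <;> rcases le_total 0 b with hb | hb
    · refine Or.inl (hdiff 1 x ?_ ?_)
      · rw [o1, o2]
        exact hcomb _ _ _ _ (by tauto) (by tauto)
      · exact hcomb' _ _ _ _ (by tauto) (by tauto)
    · exact Or.inr (hdiff z y (hcomb _ _ _ _ (by tauto) (by tauto))
        (hcomb' _ _ _ _ (by tauto) (by tauto))).symm
    · exact Or.inr (hdiff y z (hcomb _ _ _ _ (by tauto) (by tauto))
        (hcomb' _ _ _ _ (by tauto) (by tauto)))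
    · refine Or.inl (hdiff x 1 ?_ ?_).symm
      · exact hcomb _ _ _ _ (by tauto) (by tauto)
      · rw [o1, o2]
        exact hcomb' _ _ _ _ (by tauto) (by tauto)
  have hinj : Function.Injective fun n : ℕ => d ^ n * t * (d ^ n)⁻¹ := by
    have htt : t * t = 1 := ht.mul_self
    have htt' : t' * t' = 1 := ht'.mul_self
    have hpow : ∀ n : ℕ, t * (d ^ n)⁻¹ = d ^ n * t := by
      intro n
      have h1 : t * d⁻¹ * t⁻¹ = d := by
        have e1 : t⁻¹ = t := inv_eq_of_mul_eq_one_left htt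
        have e2 : t'⁻¹ = t' := inv_eq_of_mul_eq_one_left htt'
        rw [hd, mul_inv_rev, e1, e2]
        simp only [mul_assoc, htt, mul_one]
      have h2 := conj_pow (i := n) (a := t) (b := d⁻¹)
      rw [h1, inv_pow] at h2
      nth_rw 2 [h2]
      rw [inv_mul_cancel_right]
    have hconj : ∀ n : ℕ, d ^ n * t * (d ^ n)⁻¹ = d ^ (n + n) * t := by
      intro n
      rw [mul_assoc, hpow, ← mul_assoc, pow_add]
    intro n m hnm
    have hnm' : d ^ n * t * (d ^ n)⁻¹ = d ^ m * t * (d ^ m)⁻¹ := hnm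
    rw [hconj, hconj] at hnm'
    have := injective_pow_iff_not_isOfFinOrder.2 hfin (mul_right_cancel hnm')
    omega
  exact Set.infinite_of_injective_forall_mem hinj hsep
    ((finite_sep_ne cs 1 x).union (finite_sep_ne cs y z))

end Walls

/-! ### A finite colouring of the walls -/

section FiniteColouring

variable {B W : Type*} [Group W] {M : CoxeterMatrix B}

/-- **Minkowski's lemma**: in a torsion free ring without nonzero elements that are divisible by
all powers of `3`, an element of finite order that is congruent to `1` modulo `3` is trivial. -/
lemma eq_one_of_pow_eq_one_of_modEq_three {R : Type*} [Ring R]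
    (htf : ∀ (n : ℕ) (x : R), n ≠ 0 → (n : R) * x = 0 → x = 0)
    (hsep : ∀ x : R, (∀ k : ℕ, ∃ y, x = 3 ^ k * y) → x = 0)
    {a : R} (ha : ∃ x, a = 1 + 3 * x) (hfin : IsOfFinOrder a) : a = 1 := by
  have prime_case : ∀ (p : ℕ) (a : R), p.Prime → (∃ x, a = 1 + 3 * x) → a ^ p = 1 → a = 1 := by
    rintro p a hp ⟨x, hx⟩ hap
    by_contra hne
    have hz : ∃ k : ℕ, ¬ ∃ y, a - 1 = 3 ^ k * y := by
      by_contra! hc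
      exact hne (sub_eq_zero.1 (hsep _ hc))
    classical
    set k := Nat.find hz with hk
    have hk0 : k ≠ 0 := by
      intro h0
      have := Nat.find_spec hz
      rw [← hk, h0] at this
      exact this ⟨a - 1, by simp⟩
    have hk1 : k ≠ 1 := by
      intro h0
      have := Nat.find_spec hz
      rw [← hk, h0] at this
      exact this ⟨x, by rw [hx]; simp⟩
    obtain ⟨j, hj⟩ : ∃ j, k = j + 1 := Nat.exists_eq_succ_of_ne_zero hk0
    have hj1 : 1 ≤ j := by omega
    obtain ⟨y, hy⟩ : ∃ y, a - 1 = 3 ^ j * y := by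
      have := Nat.find_min hz (m := j) (by omega)
      simpa using this
    have hy3 : ∀ z, y ≠ 3 * z := by
      rintro z rfl
      refine Nat.find_spec hz ⟨z, ?_⟩
      rw [← hk, hj, hy, pow_succ, mul_assoc]
    have c3 : ∀ (n : ℕ) (b : R), (3 : R) ^ n * b = b * 3 ^ n := fun n b =>
      ((Nat.cast_commute 3 b).pow_left n).eq
    have c5 : ∀ (n : ℕ) (b c : R), b * (3 ^ n * c) = 3 ^ n * (b * c) := fun n b c => by
      rw [← mul_assoc, ← c3, mul_assoc]
    have c4 : ∀ b c : R, b * (3 * c) = 3 * (b * c) := fun b c => by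
      simpa using c5 1 b c
    have h3tf : ∀ (n : ℕ) (b : R), (3 : R) ^ n * b = 0 → b = 0 := fun n b hb =>
      htf (3 ^ n) b (by positivity) (by push_cast; exact hb)
    have hpow : ∀ i : ℕ, ∃ q, a ^ i = 1 + (a - 1) * q := by
      intro i
      induction i with
      | zero => exact ⟨0, by simp⟩
      | succ i ih =>
        obtain ⟨q, hq⟩ := ih
        exact ⟨1 + a * q, by rw [pow_succ', hq]; noncomm_ring⟩
    by_cases hp3 : p = 3
    · subst hp3
      obtain ⟨i, rfl⟩ : ∃ i, j = i + 1 := Nat.exists_eq_succ_of_ne_zero (by omega)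
      set z := a - 1 with hzdef
      have haz : a = 1 + z := by rw [hzdef]; abel
      have h0 : 3 * z + 3 * z ^ 2 + z ^ 3 = 0 := by
        have : (1 + z) ^ 3 = 1 + (3 * z + 3 * z ^ 2 + z ^ 3) := by noncomm_ring
        rw [haz, this] at hap
        simpa using hap
      apply hy3 (-(3 ^ i * (y * y) + 3 ^ i * (3 ^ i * (y * (y * y)))))
      have h1 : 3 * z + 3 * z ^ 2 + z ^ 3 = 3 ^ (i + 2) *
          (y + 3 * (3 ^ i * (y * y) + 3 ^ i * (3 ^ i * (y * (y * y))))) := by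
        have e2 : z ^ 2 = 3 ^ (i + 1) * (3 ^ (i + 1) * (y * y)) := by
          rw [pow_two, hy, mul_assoc, c5 (i + 1) y]
        have e3 : z ^ 3 = 3 ^ (i + 1) * (3 ^ (i + 1) * (3 ^ (i + 1) * (y * (y * y)))) := by
          rw [pow_succ' z 2, e2, hy, mul_assoc, c5 (i + 1) y, c5 (i + 1) y]
        rw [e2, e3, hy]
        simp only [pow_succ, mul_add, ← mul_assoc]
        simp only [mul_assoc, c4, add_assoc]
      rw [h1] at h0
      have := h3tf _ _ h0
      rw [mul_neg]
      exact eq_neg_of_add_eq_zero_left this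
    · obtain ⟨q, hq⟩ : ∃ q, ∑ i ∈ Finset.range p, a ^ i = p + (a - 1) * q := by
        choose q hq using hpow
        refine ⟨∑ i ∈ Finset.range p, q i, ?_⟩
        rw [Finset.sum_congr rfl fun i _ => hq i, Finset.sum_add_distrib, ← Finset.mul_sum]
        simp
      have h0 : (a - 1) * ∑ i ∈ Finset.range p, a ^ i = 0 := by
        rw [mul_geom_sum, hap, sub_self]
      rw [hq, hy, mul_assoc] at h0
      have h1 := h3tf _ _ h0
      have hcop : IsCoprime (p : ℤ) 3 := by
        rw [show (3 : ℤ) = ((3 : ℕ) : ℤ) by norm_num, Nat.isCoprime_iff_coprime]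
        exact (Nat.coprime_primes hp Nat.prime_three).2 hp3
      obtain ⟨b, c, hbc⟩ := hcop
      have hbc' : (b : R) * (p : R) + (c : R) * 3 = 1 := by
        exact_mod_cast congrArg (Int.cast (R := R)) hbc
      obtain ⟨i, rfl⟩ : ∃ i, j = i + 1 := Nat.exists_eq_succ_of_ne_zero (by omega)
      have h2 : (p : R) * y = -(3 * (3 ^ i * (y * (y * q)))) := by
        rw [mul_add] at h1
        rw [(Nat.cast_commute p y).eq, eq_neg_iff_add_eq_zero, ← h1]
        congr 1
        rw [pow_succ', mul_assoc, mul_assoc, c4, c5 i y]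
      apply hy3 (c * y - b * (3 ^ i * (y * (y * q))))
      calc y = (b * p + c * 3) * y := by rw [hbc', one_mul]
        _ = b * (p * y) + 3 * (c * y) := by
          rw [add_mul, mul_assoc, (Int.cast_commute c (3 : R)).eq, mul_assoc]
        _ = _ := by
          rw [h2, mul_neg, ← mul_assoc (b : R) 3, (Int.cast_commute b (3 : R)).eq, mul_assoc]
          noncomm_ring
  have hmod : ∀ i : ℕ, ∃ x, a ^ i = 1 + 3 * x := by
    obtain ⟨x, rfl⟩ := ha
    intro i
    induction i with
    | zero => exact ⟨0, by simp⟩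
    | succ i ih =>
      obtain ⟨q, hq⟩ := ih
      exact ⟨x + q + x * (3 * q), by rw [pow_succ', hq]; noncomm_ring⟩
  by_contra hne
  have h1 : orderOf a ≠ 1 := fun h => hne (orderOf_eq_one_iff.1 h)
  obtain ⟨p, hp, n, hn⟩ := Nat.exists_prime_and_dvd h1
  have hpos := hfin.orderOf_pos
  have := prime_case p (a ^ n) hp (hmod n) (by rw [← pow_mul, mul_comm, ← hn, pow_orderOf_eq_one])
  have hle := orderOf_dvd_of_pow_eq_one this
  have hn0 : 0 < n := Nat.pos_of_ne_zero (by rintro rfl; omega)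
  have := Nat.le_of_dvd hn0 hle
  have := hp.two_le
  nlinarith

lemma matrix_natCast_mul_apply {ι R : Type*} [Fintype ι] [DecidableEq ι] [CommRing R] (n : ℕ)
    (x : Matrix ι ι R) (i j : ι) : ((n : Matrix ι ι R) * x) i j = n * x i j := by
  rw [← nsmul_eq_mul, Matrix.smul_apply, nsmul_eq_mul]

lemma finite_cosRing [Finite B] (M : CoxeterMatrix B) : Module.Finite ℤ (cosRing M) := by
  refine Algebra.finite_adjoin_of_finite_of_isIntegral (Set.finite_range _) ?_
  rintro _ ⟨⟨s, t⟩, rfl⟩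
  have e : 2 * Real.cos (Real.pi / M s t) =
      2 * Real.cos (((1 / (M s t : ℚ) : ℚ) : ℝ) * Real.pi) := by
    congr 2
    push_cast
    ring
  change IsIntegral ℤ (2 * Real.cos (Real.pi / M s t))
  rw [e]
  exact Real.isIntegral_two_mul_cos_rat_mul_pi _

lemma finite_cosRing_quotient [Finite B] (M : CoxeterMatrix B) :
    Finite (cosRing M ⧸ Ideal.span {(3 : cosRing M)}) := by
  have := finite_cosRing M
  have : Ring.HasFiniteQuotients (cosRing M) := inferInstance
  refine Ring.HasFiniteQuotients.finiteQuotient ?_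
  rw [Ne, Ideal.span_singleton_eq_bot]
  norm_num

lemma not_isUnit_three [Finite B] (M : CoxeterMatrix B) : ¬ IsUnit (3 : cosRing M) := by
  have := finite_cosRing M
  rintro ⟨u, hu⟩
  have h1 : ((3 : cosRing M) : ℝ) * ((u⁻¹ : (cosRing M)ˣ) : cosRing M) = 1 := by
    rw [← hu]
    exact congrArg Subtype.val u.mul_inv
  have h2 : IsIntegral ℤ ((u⁻¹ : (cosRing M)ˣ) : cosRing M) := Algebra.IsIntegral.isIntegral _
  have h3 : IsIntegral ℤ (((u⁻¹ : (cosRing M)ˣ) : cosRing M) : ℝ) := h2.algebraMap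
  have h4 : (((u⁻¹ : (cosRing M)ˣ) : cosRing M) : ℝ) = algebraMap ℚ ℝ (1 / 3) := by
    have e3 : ((3 : cosRing M) : ℝ) = 3 := rfl
    rw [e3] at h1
    simp only [one_div, map_inv₀, map_ofNat]
    linarith
  rw [h4] at h3
  have h5 := (isIntegral_algebraMap_iff (algebraMap ℚ ℝ).injective).1 h3
  obtain ⟨n, hn⟩ := IsIntegrallyClosed.isIntegral_iff.1 h5
  have h6 : (3 * n : ℚ) = 1 := by
    rw [eq_intCast] at hn
    rw [hn]; norm_num
  have h7 : 3 * n = 1 := by exact_mod_cast h6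
  omega

/-- The reflections of a Coxeter group of finite rank can be coloured by finitely many colours such
that the walls of distinct reflections of the same colour do not cross. The colour of `u s u⁻¹`
is `s` together with the reduction of `u` modulo `3` in the geometric representation; the product
of two reflections of the same colour is then congruent to `1` modulo `3`. -/
theorem exists_wall_colouring [Finite B] [DecidableEq W] (cs : CoxeterSystem M W) :
    ∃ (n : ℕ) (colour : W → Fin n), ∀ t t', cs.IsReflection t → cs.IsReflection t' →
      colour t = colour t' → (∃ x, sep cs x t = 1 ∧ sep cs x t' = 1) →
      (∃ x, sep cs x t = 1 ∧ sep cs x t' = 0) → (∃ x, sep cs x t = 0 ∧ sep cs x t' = 1) →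
      t = t' := by
  classical
  have := Fintype.ofFinite B
  have := finite_cosRing M
  have := finite_cosRing_quotient M
  by_cases hB : IsEmpty B
  · refine ⟨1, fun _ => 0, fun t t' ht => ?_⟩
    obtain ⟨_, s, -⟩ := ht
    exact hB.elim s
  rw [not_isEmpty_iff] at hB
  obtain ⟨s₀⟩ := hB
  -- the geometric representation by matrices
  let R := Matrix B B (cosRing M)
  let ρ : W →* R :=
    { toFun := fun w => LinearMap.toMatrix' (geomRep cs w).toLinearMap
      map_one' := by rw [map_one]; exact LinearMap.toMatrix'_one
      map_mul' := fun v w => by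
        rw [map_mul, ← LinearMap.toMatrix'_mul]; rfl }
  have hρ : Function.Injective ρ := fun v w h =>
    geomRep_injective cs (LinearEquiv.toLinearMap_injective (LinearMap.toMatrix'.injective h))
  have hdata : ∀ t, ∃ p : W × B, cs.IsReflection t → t = p.1 * cs.simple p.2 * p.1⁻¹ := by
    intro t
    by_cases ht : cs.IsReflection t
    · obtain ⟨u, s, e⟩ := ht
      exact ⟨(u, s), fun _ => e⟩
    · exact ⟨(1, s₀), fun h => absurd h ht⟩
  choose p hp using hdata
  let C := Matrix B B (cosRing M ⧸ Ideal.span {(3 : cosRing M)}) × B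
  have : Finite C := inferInstance
  obtain ⟨n, ⟨e⟩⟩ := Finite.exists_equiv_fin C
  refine ⟨n, fun t => e ((ρ (p t).1).map (Ideal.Quotient.mk _), (p t).2), ?_⟩
  rintro t t' ht ht' hcol ⟨x, hx, hx'⟩ ⟨y, hy, hy'⟩ ⟨z, hz, hz'⟩
  have hfin := isOfFinOrder_of_crossing cs ht ht' hx hx' hy hy' hz hz'
  obtain ⟨h1, h2⟩ := Prod.ext_iff.1 (e.injective hcol)
  simp only at h1 h2
  have ht1 := hp t ht
  have ht1' := hp t' ht'
  rw [← h2] at ht1'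
  set u := (p t).1
  set u' := (p t').1
  set s := (p t).2
  obtain ⟨d, hd⟩ : ∃ d : R, ρ u' = ρ u + 3 * d := by
    have : ∀ i j, ∃ c, ρ u' i j = ρ u i j + 3 * c := by
      intro i j
      have h3 := congrFun (congrFun h1 i) j
      simp only [Matrix.map_apply] at h3
      obtain ⟨c, hc⟩ :=
        Ideal.mem_span_singleton'.1 ((Ideal.Quotient.mk_eq_mk_iff_sub_mem _ _).1 h3.symm)
      exact ⟨c, by rw [mul_comm, hc]; ring⟩
    choose c hc using this
    refine ⟨Matrix.of c, ?_⟩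
    ext1 i j
    rw [Matrix.add_apply, hc]
    congr 1
    exact (matrix_natCast_mul_apply 3 (Matrix.of c) i j).symm
  have hmod : ∃ x, ρ (t * t') = 1 + 3 * x := by
    have hc3 : ∀ a : R, a * 3 = 3 * a := fun a => ((Nat.cast_commute 3 a).eq).symm
    have hinv : ρ u'⁻¹ = ρ u⁻¹ - 3 * (ρ u'⁻¹ * d * ρ u⁻¹) := by
      have e1 : ρ u'⁻¹ * ρ u' * ρ u⁻¹ = ρ u⁻¹ := by
        rw [← map_mul, inv_mul_cancel, map_one, one_mul]
      have e2 : ρ u'⁻¹ * ρ u * ρ u⁻¹ = ρ u'⁻¹ := by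
        rw [mul_assoc, ← map_mul, mul_inv_cancel, map_one, mul_one]
      rw [hd, mul_add, add_mul, e2, ← mul_assoc, hc3] at e1
      rw [eq_sub_iff_add_eq, ← mul_assoc, ← mul_assoc]
      exact e1
    have e0 : ρ t * (ρ u * ρ (cs.simple s) * ρ u⁻¹) = 1 := by
      rw [← map_mul, ← map_mul, ← ht1, ← map_mul, ht.mul_self, map_one]
    refine ⟨ρ t * (d * ρ (cs.simple s) * ρ u⁻¹ -
      (ρ u + 3 * d) * ρ (cs.simple s) * (ρ u'⁻¹ * d * ρ u⁻¹)), ?_⟩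
    rw [map_mul, ht1', map_mul, map_mul, hd]
    nth_rw 1 [hinv]
    rw [← e0]
    have hl : ∀ a b : R, a * (3 * b) = 3 * (a * b) := fun a b => by
      rw [← mul_assoc, hc3, mul_assoc]
    simp only [mul_sub, add_mul, mul_add, hl, mul_assoc]
    abel
  have hone := eq_one_of_pow_eq_one_of_modEq_three (R := R) ?_ ?_ hmod (ρ.isOfFinOrder hfin)
  · have := hρ (hone.trans (map_one ρ).symm)
    rw [mul_eq_one_iff_eq_inv, ht'.inv] at this
    exact this
  · intro n x hn hx
    ext1 i j
    have := congrFun (congrFun hx i) j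
    rw [matrix_natCast_mul_apply] at this
    exact (mul_eq_zero.1 this).resolve_left (by exact_mod_cast hn)
  · intro x hx
    ext1 i j
    by_contra hne
    have hne' : x i j ≠ 0 := hne
    have : IsNoetherianRing (cosRing M) := IsNoetherianRing.of_finite ℤ _
    have hfm := FiniteMultiplicity.of_not_isUnit (not_isUnit_three M) hne'
    obtain ⟨k, hk⟩ := hfm
    obtain ⟨y, hy⟩ := hx (k + 1)
    refine hk ⟨y i j, ?_⟩
    have e3 : (3 : R) ^ (k + 1) = ((3 ^ (k + 1) : ℕ) : R) := by rw [Nat.cast_pow, Nat.cast_ofNat]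
    rw [hy, e3]
    refine (matrix_natCast_mul_apply _ _ _ _).trans ?_
    rw [Nat.cast_pow, Nat.cast_ofNat]

end FiniteColouring

/-! ### End segments of chains of finite sets -/

section ChainFamily

variable {X T : Type*} [DecidableEq T]

/-- The number of elements that belong to every member of the family `N` which contains `t`. If
the members of `N` are chains of nested walls, this is the position of `t` in each of them. -/
noncomputable def chainHeight (N : X → Finset T) (t : T) : ℕ :=
  {t' | ∀ x, t ∈ N x → t' ∈ N x}.ncard

/-- The last `n` members of the chain `N x`, padded by natural numbers if there are fewer. -/
noncomputable def chainEnd (N : X → Finset T) (n : ℕ) (x : X) : Finset (T ⊕ ℕ) :=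
  ((N x).filter fun t => (N x).card < chainHeight N t + n).disjSum
    (Finset.range (n - (N x).card))

variable {N : X → Finset T}

omit [DecidableEq T] in
lemma setOf_chain_subset {x : X} {t : T} (ht : t ∈ N x) :
    {t' | ∀ x, t ∈ N x → t' ∈ N x} ⊆ (N x : Set T) := fun _ h => h x ht

omit [DecidableEq T] in
lemma one_le_chainHeight {x : X} {t : T} (ht : t ∈ N x) : 1 ≤ chainHeight N t := by
  rw [chainHeight, Nat.one_le_iff_ne_zero, Ne,
    Set.ncard_eq_zero ((N x).finite_toSet.subset (setOf_chain_subset ht))]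
  exact Set.Nonempty.ne_empty ⟨t, fun _ h => h⟩

omit [DecidableEq T] in
lemma chainHeight_le_card {x : X} {t : T} (ht : t ∈ N x) : chainHeight N t ≤ (N x).card := by
  rw [← Set.ncard_coe_finset]
  exact Set.ncard_le_ncard (setOf_chain_subset ht) (N x).finite_toSet

variable (hchain : ∀ x, ∀ t ∈ N x, ∀ t' ∈ N x,
  (∀ y, t ∈ N y → t' ∈ N y) ∨ ∀ y, t' ∈ N y → t ∈ N y)
  (hanti : ∀ x, ∀ t ∈ N x, ∀ t', (∀ y, t ∈ N y ↔ t' ∈ N y) → t = t')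

include hchain hanti

omit [DecidableEq T] in
lemma chainHeight_injOn (x : X) : Set.InjOn (chainHeight N) (N x) := by
  have key : ∀ t ∈ N x, ∀ t' ∈ N x, (∀ y, t ∈ N y → t' ∈ N y) →
      chainHeight N t = chainHeight N t' → t = t' := by
    intro t ht t' ht' h e
    refine hanti x t ht t' fun y => ⟨h y, ?_⟩
    have hsub : {u | ∀ y, t' ∈ N y → u ∈ N y} ⊆ {u | ∀ y, t ∈ N y → u ∈ N y} :=
      fun u hu y hy => hu y (h y hy)
    have := Set.eq_of_subset_of_ncard_le hsub e.le
      ((N x).finite_toSet.subset (setOf_chain_subset ht))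
    have ht1 : t ∈ {u | ∀ y, t ∈ N y → u ∈ N y} := fun _ h => h
    rw [← this] at ht1
    exact ht1 y
  intro t ht t' ht' e
  rcases hchain x t ht t' ht' with h | h
  · exact key t ht t' ht' h e
  · exact (key t' ht' t ht h e.symm).symm

omit [DecidableEq T] in
lemma image_chainHeight (x : X) : (N x).image (chainHeight N) = Finset.Icc 1 (N x).card := by
  refine Finset.eq_of_subset_of_card_le ?_ ?_
  · intro k hk
    obtain ⟨t, ht, rfl⟩ := Finset.mem_image.1 hk
    exact Finset.mem_Icc.2 ⟨one_le_chainHeight ht, chainHeight_le_card ht⟩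
  · rw [Finset.card_image_of_injOn (chainHeight_injOn hchain hanti x)]
    simp

omit [DecidableEq T] in
lemma card_chainEnd (n : ℕ) (x : X) : (chainEnd N n x).card = n := by
  rw [chainEnd, Finset.card_disjSum, Finset.card_range]
  have h1 : ((N x).filter fun t => (N x).card < chainHeight N t + n).image (chainHeight N) =
      Finset.Ioc ((N x).card - n) (N x).card := by
    ext k
    have := Finset.ext_iff.1 (image_chainHeight hchain hanti x) k
    simp only [Finset.mem_image, Finset.mem_Icc, Finset.mem_filter, Finset.mem_Ioc] at this ⊢
    constructor
    · rintro ⟨t, ⟨ht, h⟩, rfl⟩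
      have := one_le_chainHeight ht
      have := chainHeight_le_card ht
      omega
    · rintro ⟨h1, h2⟩
      obtain ⟨t, ht, rfl⟩ := this.2 ⟨by omega, h2⟩
      exact ⟨t, ⟨ht, by omega⟩, rfl⟩
  rw [← Finset.card_image_of_injOn ((chainHeight_injOn hchain hanti x).mono
    (Finset.coe_subset.2 (Finset.filter_subset _ _))), h1, Nat.card_Ioc]
  omega

lemma card_chainEnd_sdiff_le_one (n : ℕ) {x y : X} {t : T} (ht : t ∉ N x)
    (hy : N y = insert t (N x)) : (chainEnd N n x \ chainEnd N n y).card ≤ 1 := by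
  have hc : (N y).card = (N x).card + 1 := by rw [hy, Finset.card_insert_of_notMem ht]
  have hsub : N x ⊆ N y := hy ▸ Finset.subset_insert _ _
  have hl : ∀ u, Sum.inl u ∈ chainEnd N n x \ chainEnd N n y →
      u ∈ N x ∧ chainHeight N u + n = (N x).card + 1 := by
    intro u hu
    simp only [chainEnd, Finset.mem_sdiff, Finset.inl_mem_disjSum, Finset.mem_filter, hc] at hu
    refine ⟨hu.1.1, ?_⟩
    have := hu.2
    simp only [hsub hu.1.1, true_and] at this
    omega
  have hr : ∀ j, Sum.inr j ∈ chainEnd N n x \ chainEnd N n y → j + (N x).card + 1 = n := by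
    intro j hj
    simp only [chainEnd, Finset.mem_sdiff, Finset.inr_mem_disjSum, Finset.mem_range, hc] at hj
    omega
  rw [Finset.card_le_one]
  rintro (u | j) h1 (u' | j') h2
  · have e1 := hl _ h1
    have e2 := hl _ h2
    rw [chainHeight_injOn hchain hanti x e1.1 e2.1 (by omega)]
  · have e1 := hl _ h1
    have e2 := hr _ h2
    have := one_le_chainHeight e1.1
    omega
  · have e1 := hl _ h2
    have e2 := hr _ h1
    have := one_le_chainHeight e1.1
    omega
  · have e1 := hr _ h1
    have e2 := hr _ h2
    congr 1
    omega

omit hchain hanti in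
lemma card_sdiff_lt_of_chainEnd_inter {n : ℕ} {x y : X}
    (h : (chainEnd N n x ∩ chainEnd N n y).Nonempty) : (N x \ N y).card < n := by
  obtain ⟨u | j, h⟩ := h
  · simp only [chainEnd, Finset.mem_inter, Finset.inl_mem_disjSum, Finset.mem_filter] at h
    obtain ⟨⟨hx, hxn⟩, hy, -⟩ := h
    have hf := (N x).finite_toSet.subset (setOf_chain_subset hx)
    have hsubx : hf.toFinset ⊆ N x := by
      intro v hv
      rw [Set.Finite.mem_toFinset] at hv
      exact hv x hx
    have hsub : N x \ N y ⊆ N x \ hf.toFinset := by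
      intro v hv
      rw [Finset.mem_sdiff] at hv ⊢
      refine ⟨hv.1, fun hc => hv.2 ?_⟩
      rw [Set.Finite.mem_toFinset] at hc
      exact hc y hy
    have h1 := Finset.card_le_card hsub
    rw [Finset.card_sdiff_of_subset hsubx, ← Set.ncard_eq_toFinset_card _ hf] at h1
    have : {t' | ∀ x, u ∈ N x → t' ∈ N x}.ncard = chainHeight N u := rfl
    have := one_le_chainHeight hx
    have := chainHeight_le_card hx
    omega
  · simp only [chainEnd, Finset.mem_inter, Finset.inr_mem_disjSum, Finset.mem_range] at h
    have := Finset.card_le_card (Finset.sdiff_subset (s := N x) (t := N y))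
    omega

end ChainFamily

/-! ### Property A for Coxeter groups -/

section PropertyA

variable {B W : Type*} [Group W] {M : CoxeterMatrix B} (cs : CoxeterSystem M W) [DecidableEq W]

/-- The finite set of reflections that separate `x` from `1`. -/
noncomputable def inversions (x : W) : Finset W := (finite_sep_ne cs x 1).toFinset

lemma mem_inversions {x t : W} : t ∈ inversions cs x ↔ sep cs x t = 1 := by
  rw [inversions, Set.Finite.mem_toFinset, Set.mem_ofPred_eq, sep_one]
  rcases zmod_two_eq (sep cs x t) with h | h <;> simp [h]

lemma notMem_inversions {x t : W} : t ∉ inversions cs x ↔ sep cs x t = 0 := by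
  rw [mem_inversions]
  rcases zmod_two_eq (sep cs x t) with h | h <;> simp [h]

lemma isReflection_of_mem_inversions {x t : W} (h : t ∈ inversions cs x) : cs.IsReflection t := by
  obtain ⟨ω, -, rfl⟩ := cs.exists_isReduced x
  rw [mem_inversions, sep_wordProd] at h
  refine cs.isReflection_of_mem_leftInvSeq ω ?_
  by_contra hc
  rw [List.count_eq_zero_of_not_mem hc] at h
  exact absurd h (by decide)

lemma sep_simple (s : B) (t : W) : sep cs (cs.simple s) t = if t = cs.simple s then 1 else 0 := by
  have := sep_wordProd cs [s] t
  simp only [CoxeterSystem.wordProd_singleton, CoxeterSystem.leftInvSeq_singleton,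
    List.count_singleton, beq_iff_eq] at this
  rw [this]
  by_cases h : cs.simple s = t
  · rw [if_pos h, if_pos h.symm]; rfl
  · rw [if_neg h, if_neg fun h' => h h'.symm]; rfl

/-- Crossing one wall changes the set of inversions by the reflection in this wall. -/
lemma mem_inversions_mul_simple {x t : W} (s : B) :
    t ∈ inversions cs (x * cs.simple s) ↔
      (t ∈ inversions cs x ↔ t ≠ x * cs.simple s * x⁻¹) := by
  have e : x⁻¹ * t * x = cs.simple s ↔ t = x * cs.simple s * x⁻¹ := by
    rw [eq_mul_inv_iff_mul_eq, mul_assoc, inv_mul_eq_iff_eq_mul]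
  rw [mem_inversions, mem_inversions, sep_mul, sep_simple]
  simp only [e]
  by_cases h : t = x * cs.simple s * x⁻¹
  · rw [if_pos h]
    simp only [h, ne_eq, not_true_eq_false, iff_false]
    rcases zmod_two_eq (sep cs x (x * cs.simple s * x⁻¹)) with h' | h' <;> rw [h'] <;> decide
  · rw [if_neg h]
    simp [h]

lemma inversions_mul_simple (x : W) (s : B) :
    (x * cs.simple s * x⁻¹ ∉ inversions cs x ∧
      inversions cs (x * cs.simple s) = insert (x * cs.simple s * x⁻¹) (inversions cs x)) ∨
    (x * cs.simple s * x⁻¹ ∉ inversions cs (x * cs.simple s) ∧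
      inversions cs x = insert (x * cs.simple s * x⁻¹) (inversions cs (x * cs.simple s))) := by
  have key := fun t => mem_inversions_mul_simple cs (x := x) (t := t) s
  by_cases h : x * cs.simple s * x⁻¹ ∈ inversions cs x
  · right
    refine ⟨by rw [key]; simp [h], ?_⟩
    ext t
    rw [Finset.mem_insert, key]
    by_cases ht : t = x * cs.simple s * x⁻¹
    · simp [ht, h]
    · simp [ht]
  · left
    refine ⟨h, ?_⟩
    ext t
    rw [Finset.mem_insert, key]
    by_cases ht : t = x * cs.simple s * x⁻¹
    · simp [ht, h]
    · simp [ht]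

/-- A wall is determined by the half-space beyond it. -/
lemma eq_of_forall_mem_inversions_iff {x t t' : W} (ht : t ∈ inversions cs x)
    (h : ∀ y, t ∈ inversions cs y ↔ t' ∈ inversions cs y) : t = t' := by
  induction x using cs.simple_induction_right with
  | one => rw [mem_inversions, sep_one] at ht; exact absurd ht (by decide)
  | mul_simple_right w s ih =>
    by_cases hw : t ∈ inversions cs w
    · exact ih hw
    · have h1 := (mem_inversions_mul_simple cs s).1 ht
      have h2 := (mem_inversions_mul_simple cs s).1 ((h _).1 ht)
      rw [← h w] at h2
      simp only [hw, false_iff, not_not, ne_eq] at h1 h2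
      rw [h1, h2]

/-- The number of walls that separate `x` from `y` is at least their distance. -/
lemma length_le_card_inversions (x y : W) :
    cs.length (x⁻¹ * y) ≤ (inversions cs x \ inversions cs y).card +
      (inversions cs y \ inversions cs x).card := by
  obtain ⟨ω, hω, e⟩ := cs.exists_isReduced (x⁻¹ * y)
  have hl : ((cs.leftInvSeq ω).toFinset.image fun t => x * t * x⁻¹).card = cs.length (x⁻¹ * y) := by
    rw [Finset.card_image_of_injective, List.toFinset_card_of_nodup hω.nodup_leftInvSeq,
      cs.length_leftInvSeq, e, hω.eq]
    intro t t' h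
    simpa using h
  rw [← hl]
  refine (Finset.card_le_card ?_).trans (Finset.card_union_le _ _)
  intro r hr
  obtain ⟨t, ht, rfl⟩ := Finset.mem_image.1 hr
  have h1 : sep cs (x⁻¹ * y) t = 1 := by
    rw [e, sep_wordProd, List.count_eq_one_of_mem hω.nodup_leftInvSeq (List.mem_toFinset.1 ht)]
    rfl
  have h2 := sep_mul cs x (x⁻¹ * y) (x * t * x⁻¹)
  rw [mul_inv_cancel_left, show x⁻¹ * (x * t * x⁻¹) * x = t by group, h1] at h2
  rw [Finset.mem_union, Finset.mem_sdiff, Finset.mem_sdiff, notMem_inversions, notMem_inversions,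
    mem_inversions, mem_inversions, h2]
  rcases zmod_two_eq (sep cs x (x * t * x⁻¹)) with h | h <;> simp [h]
  decide

/-- **Coxeter groups of finite rank have property A.** For each colour, the walls of this colour
that separate `x` from `1` form a chain; the set attached to `x` consists of the tuples that pick,
for each colour, one of the `n` walls closest to `x`. -/
theorem exists_propertyA_sets [Finite B] : ∃ c : ℕ, ∀ n : ℕ, ∃ F : W → Finset (Fin c → W ⊕ ℕ),
    (∀ x, (F x).card = n ^ c) ∧
    (∀ x s, n * (F x \ F (x * cs.simple s)).card ≤ n ^ c) ∧
    ∃ R, ∀ x y, (F x ∩ F y).Nonempty → cs.length (x⁻¹ * y) ≤ R := by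
  obtain ⟨c, colour, hcol⟩ := exists_wall_colouring cs
  refine ⟨c, fun n => ?_⟩
  let N : Fin c → W → Finset W := fun i x => (inversions cs x).filter fun t => colour t = i
  have hmem : ∀ i x t, t ∈ N i x ↔ t ∈ inversions cs x ∧ colour t = i := fun i x t =>
    Finset.mem_filter
  have hchain : ∀ i x, ∀ t ∈ N i x, ∀ t' ∈ N i x,
      (∀ y, t ∈ N i y → t' ∈ N i y) ∨ ∀ y, t' ∈ N i y → t ∈ N i y := by
    intro i x t ht t' ht'
    by_contra! hc
    obtain ⟨⟨y, hy, hy'⟩, z, hz, hz'⟩ := hc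
    rw [hmem] at ht ht'
    simp only [hmem, ht.2, ht'.2, and_true] at hy hy' hz hz'
    have := hcol t t' (isReflection_of_mem_inversions cs ht.1)
      (isReflection_of_mem_inversions cs ht'.1) (ht.2.trans ht'.2.symm)
      ⟨x, (mem_inversions cs).1 ht.1, (mem_inversions cs).1 ht'.1⟩
      ⟨y, (mem_inversions cs).1 hy, (notMem_inversions cs).1 hy'⟩
      ⟨z, (notMem_inversions cs).1 hz', (mem_inversions cs).1 hz⟩
    subst this
    exact hy' hy
  have hanti : ∀ i x, ∀ t ∈ N i x, ∀ t', (∀ y, t ∈ N i y ↔ t' ∈ N i y) → t = t' := by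
    intro i x t ht t' h
    have ht' := (h x).1 ht
    rw [hmem] at ht ht'
    simp only [hmem, ht.2, ht'.2, and_true] at h
    exact eq_of_forall_mem_inversions_iff cs ht.1 h
  let F : W → Finset (Fin c → W ⊕ ℕ) := fun x => Fintype.piFinset fun i => chainEnd (N i) n x
  have hcard : ∀ x, (F x).card = n ^ c := by
    intro x
    simp only [F, Fintype.card_piFinset, card_chainEnd (hchain _) (hanti _)]
    simp
  refine ⟨F, hcard, ?_, ?_⟩
  · -- passing from `x` to `xs` changes the chain of one colour only, by one wall
    have key : ∀ x y t, t ∉ inversions cs x → inversions cs y = insert t (inversions cs x) →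
        n * n ^ c ≤ n * (F x ∩ F y).card + n ^ c := by
      intro x y t ht hy
      have e : F x ∩ F y = Fintype.piFinset fun i => chainEnd (N i) n x ∩ chainEnd (N i) n y := by
        ext f
        simp only [F, Finset.mem_inter, Fintype.mem_piFinset, forall_and]
      have h1 : ∀ i, i ≠ colour t → N i y = N i x := by
        intro i hi
        ext u
        rw [hmem, hmem, hy, Finset.mem_insert]
        constructor
        · rintro ⟨rfl | h, h'⟩
          · exact absurd h'.symm hi
          · exact ⟨h, h'⟩
        · exact fun h => ⟨Or.inr h.1, h.2⟩
      have h2 : N (colour t) y = insert t (N (colour t) x) := by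
        ext u
        rw [Finset.mem_insert, hmem, hmem, hy, Finset.mem_insert]
        constructor
        · rintro ⟨rfl | h, h'⟩
          · exact Or.inl rfl
          · exact Or.inr ⟨h, h'⟩
        · rintro (rfl | h)
          · exact ⟨Or.inl rfl, rfl⟩
          · exact ⟨Or.inr h.1, h.2⟩
      have h3 : n ≤ (chainEnd (N (colour t)) n x ∩ chainEnd (N (colour t)) n y).card + 1 := by
        have h4 := card_chainEnd_sdiff_le_one (hchain (colour t)) (hanti (colour t)) n
          (fun h => ht ((hmem _ _ _).1 h).1) h2
        have h5 := Finset.card_sdiff_add_card_inter (chainEnd (N (colour t)) n x)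
          (chainEnd (N (colour t)) n y)
        rw [card_chainEnd (hchain _) (hanti _)] at h5
        omega
      have h6 : ∀ i, i ≠ colour t → (chainEnd (N i) n x ∩ chainEnd (N i) n y).card = n := by
        intro i hi
        have : chainEnd (N i) n y = chainEnd (N i) n x := by
          rw [chainEnd, chainEnd, h1 i hi]
        rw [this, Finset.inter_self, card_chainEnd (hchain _) (hanti _)]
      obtain ⟨d, rfl⟩ : ∃ d, c = d + 1 :=
        Nat.exists_eq_succ_of_ne_zero (by have := (colour t).2; omega)
      rw [e, Fintype.card_piFinset, Fintype.prod_eq_mul_prod_compl (colour t),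
        Finset.prod_congr rfl fun i hi => h6 i (by simpa using hi), Finset.prod_const,
        Finset.card_compl, Fintype.card_fin, Finset.card_singleton, Nat.add_sub_cancel]
      calc n * n ^ (d + 1) = n ^ (d + 1) * n := mul_comm _ _
        _ ≤ n ^ (d + 1) *
            ((chainEnd (N (colour t)) n x ∩ chainEnd (N (colour t)) n y).card + 1) := by gcongr
        _ = _ := by ring
    intro x s
    have hkey : n * n ^ c ≤ n * (F x ∩ F (x * cs.simple s)).card + n ^ c := by
      rcases inversions_mul_simple cs x s with ⟨h1, h2⟩ | ⟨h1, h2⟩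
      · exact key _ _ _ h1 h2
      · rw [Finset.inter_comm]
        exact key _ _ _ h1 h2
    have := Finset.card_sdiff_add_card_inter (F x) (F (x * cs.simple s))
    rw [hcard] at this
    rw [← this] at hkey ⊢
    nlinarith
  · refine ⟨2 * (c * n), fun x y h => ?_⟩
    have hc : ∀ x y, (F x ∩ F y).Nonempty → (inversions cs x \ inversions cs y).card ≤ c * n := by
      intro x y h
      have e : inversions cs x \ inversions cs y = Finset.univ.biUnion fun i => N i x \ N i y := by
        ext t
        simp only [Finset.mem_sdiff, Finset.mem_biUnion, Finset.mem_univ, true_and, hmem]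
        constructor
        · rintro ⟨h1, h2⟩
          exact ⟨colour t, ⟨h1, rfl⟩, fun h => h2 h.1⟩
        · rintro ⟨i, ⟨h1, h2⟩, h3⟩
          exact ⟨h1, fun h => h3 ⟨h, h2⟩⟩
      rw [e]
      refine Finset.card_biUnion_le.trans ?_
      calc ∑ i : Fin c, (N i x \ N i y).card ≤ ∑ i : Fin c, n := by
            refine Finset.sum_le_sum fun i _ => (card_sdiff_lt_of_chainEnd_inter ?_).le
            obtain ⟨f, hf⟩ := h
            simp only [F, Finset.mem_inter, Fintype.mem_piFinset] at hf
            exact ⟨f i, Finset.mem_inter.2 ⟨hf.1 i, hf.2 i⟩⟩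
        _ = c * n := by simp
    have h1 := hc x y h
    rw [Finset.inter_comm] at h
    have h2 := hc y x h
    have := length_le_card_inversions cs x y
    omega

end PropertyA

/-! ### Operators on `ℓ²` and their matrix coefficients -/

section L2Operators

variable {ι : Type*}

lemma inner_delta_left (i : ι) (f : L2 ι) : inner ℂ (delta i) f = f i := by
  classical
  rw [delta, lp.inner_single_left]
  simp

lemma inner_delta_right (i : ι) (f : L2 ι) : inner ℂ f (delta i) = (starRingEnd ℂ) (f i) := by
  rw [← inner_conj_symm, inner_delta_left]

lemma norm_delta (i : ι) : ‖(delta i : L2 ι)‖ = 1 := by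
  classical
  rw [delta, lp.norm_single (by norm_num)]
  simp

/-- The canonical basis spans a dense subspace of `ℓ²`. -/
lemma span_delta_dense : (Submodule.span ℂ (Set.range (delta (ι := ι)))).topologicalClosure = ⊤ := by
  classical
  rw [eq_top_iff]
  intro f _
  refine (Submodule.isClosed_topologicalClosure _).mem_of_tendsto
    (lp.hasSum_single (p := 2) (by norm_num) f) (Eventually.of_forall fun t =>
      Submodule.sum_mem _ fun j _ => Submodule.le_topologicalClosure _ ?_)
  have : lp.single 2 j (f j) = (f j) • (delta j : L2 ι) := by
    rw [delta, ← lp.single_smul]; simp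
  rw [this]
  exact Submodule.smul_mem _ _ (Submodule.subset_span ⟨j, rfl⟩)

lemma clm_ext_delta {E : Type*} [NormedAddCommGroup E] [NormedSpace ℂ E] {S T : L2 ι →L[ℂ] E}
    (h : ∀ i, S (delta i) = T (delta i)) : S = T := by
  refine ContinuousLinearMap.ext_on (s := Set.range (delta (ι := ι))) ?_ ?_
  · have := span_delta_dense (ι := ι)
    rw [← SetLike.coe_set_eq, Submodule.topologicalClosure_coe] at this
    rw [dense_iff_closure_eq]
    exact this
  · rintro _ ⟨i, rfl⟩
    exact h i

/-- Operators with the same matrix coefficients are equal. -/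
lemma clm_ext_coeff {κ : Type*} {S T : L2 ι →L[ℂ] L2 κ}
    (h : ∀ i j, S (delta i) j = T (delta i) j) : S = T :=
  clm_ext_delta fun i => l2_ext (h i)

lemma star_apply_coeff (T : L2 ι →L[ℂ] L2 ι) (i j : ι) :
    (star T) (delta i) j = (starRingEnd ℂ) (T (delta j) i) := by
  rw [← inner_delta_left j, ContinuousLinearMap.star_eq_adjoint,
    ContinuousLinearMap.adjoint_inner_right, inner_delta_right]

lemma star_permOp (e : Equiv.Perm ι) : star (permOp e) = permOp e⁻¹ := by
  classical
  refine clm_ext_coeff fun i j => ?_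
  rw [star_apply_coeff, permOp_delta, permOp_delta, delta_apply, delta_apply]
  have : i = e j ↔ j = e⁻¹ i := by rw [Equiv.Perm.eq_inv_iff_eq, eq_comm]
  simp only [this, apply_ite (starRingEnd ℂ), map_one, map_zero]

lemma permOp_mul (e e' : Equiv.Perm ι) : permOp (e * e') = permOp e * permOp e' :=
  ContinuousLinearMap.ext fun _ => l2_ext fun _ => rfl

lemma permOp_one : permOp (1 : Equiv.Perm ι) = 1 :=
  ContinuousLinearMap.ext fun _ => l2_ext fun _ => rfl

lemma permOp_inv_mul_self (e : Equiv.Perm ι) : permOp e⁻¹ * permOp e = 1 := by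
  rw [← permOp_mul, inv_mul_cancel, permOp_one]

lemma norm_permOp_apply (e : Equiv.Perm ι) (f : L2 ι) : ‖permOp e f‖ = ‖f‖ := by
  have h := ContinuousLinearMap.adjoint_inner_left (permOp e) f (permOp e f)
  rw [← ContinuousLinearMap.star_eq_adjoint, star_permOp] at h
  have h' : permOp e⁻¹ (permOp e f) = f := by
    rw [← mul_apply_eq_comp, permOp_inv_mul_self]; rfl
  rw [h', inner_self_eq_norm_sq_to_K, inner_self_eq_norm_sq_to_K] at h
  have h2 : ‖f‖ ^ 2 = ‖permOp e f‖ ^ 2 := by exact_mod_cast h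
  exact ((sq_eq_sq₀ (norm_nonneg _) (norm_nonneg _)).1 h2).symm

open Classical in
lemma coordProj_delta (s : Set ι) (i : ι) :
    coordProj s (delta i) = if i ∈ s then delta i else 0 := by
  refine l2_ext fun j => ?_
  rw [coordProj_apply, delta_apply]
  by_cases hj : j = i
  · subst hj
    by_cases hs : j ∈ s <;> simp [hs, delta_apply]
  · by_cases hs : i ∈ s <;> simp [hs, delta_apply, hj]

lemma star_coordProj (s : Set ι) : star (coordProj s) = coordProj s := by
  classical
  refine clm_ext_coeff fun i j => ?_
  rw [star_apply_coeff, coordProj_delta, coordProj_delta]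
  by_cases hij : i = j
  · subst hij
    split_ifs <;> simp [delta_apply]
  · have : j ≠ i := fun h => hij h.symm
    split_ifs <;> simp [delta_apply, hij, this]

end L2Operators

/-! ### The right Hecke algebra -/

section HeckeCompact

variable {B W : Type*} [Group W] {M : CoxeterMatrix B} (cs : CoxeterSystem M W)

/-- The operator `δ_w ↦ δ_{ws} (+ p_s(q) δ_w if |ws| < |w|)`, a generator of the right Hecke
algebra. -/
noncomputable def rightHeckeGen (q : B → ℝ) (s : B) : L2 W →L[ℂ] L2 W :=
  permOp (Equiv.mulRight (cs.simple s)) +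
    (heckeCoeff q s : ℂ) • coordProj {v | cs.length (v * cs.simple s) < cs.length v}

open Classical in
lemma rightHeckeGen_delta (q : B → ℝ) (s : B) (w : W) :
    rightHeckeGen cs q s (delta w) = delta (w * cs.simple s) +
      (if cs.length (w * cs.simple s) < cs.length w then (heckeCoeff q s : ℂ) else 0) •
        delta w := by
  rw [rightHeckeGen, add_apply, smul_apply, permOp_delta, coordProj_delta]
  simp only [Equiv.coe_mulRight, Set.mem_ofPred_eq]
  split_ifs <;> simp

open Classical in
lemma heckeGen_delta_eq (q : B → ℝ) (s : B) (w : W) :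
    heckeGen cs q s (delta w) = delta (cs.simple s * w) +
      (if cs.length (cs.simple s * w) < cs.length w then (heckeCoeff q s : ℂ) else 0) •
        delta w := by
  rw [heckeGen_delta]
  have := cs.length_simple_mul_ne w s
  split_ifs <;> first | omega | simp

lemma star_rightHeckeGen (q : B → ℝ) (s : B) :
    star (rightHeckeGen cs q s) = rightHeckeGen cs q s := by
  have h : (Equiv.mulRight (cs.simple s))⁻¹ = Equiv.mulRight (cs.simple s) := by
    ext w
    rw [Equiv.Perm.inv_eq_iff_eq]
    simp
  rw [rightHeckeGen, star_add, star_smul, star_permOp, star_coordProj, h]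
  simp

/-- The exchange property: multiplication on the right by `s` does not change whether `t` is a
left descent, unless `tw = ws`. -/
lemma length_simple_mul_mul_simple {t s : B} {w : W}
    (h : cs.simple t * w ≠ w * cs.simple s) :
    cs.length (cs.simple t * (w * cs.simple s)) < cs.length (w * cs.simple s) ↔
      cs.length (cs.simple t * w) < cs.length w := by
  classical
  have key : ∀ v, cs.length (cs.simple t * v) < cs.length v ↔ sep cs v (cs.simple t) = 1 := by
    intro v
    refine ⟨sep_of_descent cs, fun h => length_lt_of_sep cs ?_⟩
    rw [h]; decide
  rw [key, key, sep_mul, sep_simple, if_neg, add_zero]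
  intro hc
  apply h
  rw [← hc]
  group

lemma rightHeckeGen_commute {q : B → ℝ} (hq : q ∈ paramSet cs) (s t : B) :
    Commute (heckeGen cs q t) (rightHeckeGen cs q s) := by
  classical
  refine clm_ext_delta fun w => ?_
  rw [mul_apply_eq_comp, mul_apply_eq_comp, rightHeckeGen_delta,
    heckeGen_delta_eq]
  simp only [map_add, map_smul, rightHeckeGen_delta, heckeGen_delta_eq, mul_assoc]
  by_cases h : cs.simple t * w = w * cs.simple s
  · have hc : heckeCoeff q s = heckeCoeff q t := by
      have : q s = q t := hq.2 s t (isConj_comm.1 (isConj_iff.2 ⟨w⁻¹, by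
        rw [mul_assoc, inv_inv, h]; simp⟩))
      rw [heckeCoeff, heckeCoeff, this]
    have e1 : cs.simple t * (w * cs.simple s) = w := by
      rw [← h, cs.simple_mul_simple_cancel_left]
    rw [e1, h, hc]
  · have e1 := length_simple_mul_mul_simple cs h
    have e2 : cs.length (cs.simple t * (w * cs.simple s)) < cs.length (cs.simple t * w) ↔
        cs.length (w * cs.simple s) < cs.length w := by
      have h' : cs.simple s * w⁻¹ ≠ w⁻¹ * cs.simple t := by
        intro h'
        apply h
        have := congrArg (·⁻¹) h'
        simpa using this.symm
      have := length_simple_mul_mul_simple cs h'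
      rw [← cs.length_inv (cs.simple s * (w⁻¹ * cs.simple t)), ← cs.length_inv (w⁻¹ * cs.simple t),
        ← cs.length_inv (cs.simple s * w⁻¹), ← cs.length_inv w⁻¹] at this
      simpa [mul_assoc] using this
    simp only [e1, e2]
    module

/-- The right Hecke operators commute with the Hecke C⋆-algebra. -/
lemma rightHeckeGen_commute_of_mem {q : B → ℝ} (hq : q ∈ paramSet cs) (s : B)
    {T : L2 W →L[ℂ] L2 W} (hT : T ∈ heckeCStar cs q) : Commute (rightHeckeGen cs q s) T := by
  have hle : heckeCStar cs q ≤ StarSubalgebra.centralizer ℂ {rightHeckeGen cs q s} := by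
    refine StarSubalgebra.topologicalClosure_minimal ?_ ?_
    · refine StarAlgebra.adjoin_le ?_
      rintro _ ⟨t, rfl⟩
      rw [SetLike.mem_coe, StarSubalgebra.mem_centralizer_iff]
      rintro _ rfl
      rw [star_rightHeckeGen]
      exact ⟨(rightHeckeGen_commute cs hq s t).eq.symm, (rightHeckeGen_commute cs hq s t).eq.symm⟩
    · have e : ((StarSubalgebra.centralizer ℂ {rightHeckeGen cs q s} :
          StarSubalgebra ℂ (L2 W →L[ℂ] L2 W)) : Set (L2 W →L[ℂ] L2 W)) =
          {T | rightHeckeGen cs q s * T = T * rightHeckeGen cs q s} := by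
        ext T
        rw [SetLike.mem_coe, StarSubalgebra.mem_centralizer_iff]
        simp [star_rightHeckeGen]
      rw [e]
      exact isClosed_eq (by fun_prop) (by fun_prop)
  have := (StarSubalgebra.mem_centralizer_iff ℂ).1 (hle hT) _ rfl
  exact this.1

lemma rightHeckeGen_sq (q : B → ℝ) (s : B) (η : L2 W) :
    rightHeckeGen cs q s (rightHeckeGen cs q s η) =
      η + (heckeCoeff q s : ℂ) • rightHeckeGen cs q s η := by
  classical
  have : rightHeckeGen cs q s * rightHeckeGen cs q s =
      1 + (heckeCoeff q s : ℂ) • rightHeckeGen cs q s := by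
    refine clm_ext_delta fun w => ?_
    have hne := cs.length_mul_simple_ne w s
    rw [mul_apply_eq_comp, add_apply, smul_apply]
    simp only [rightHeckeGen_delta, map_add, map_smul, cs.simple_mul_simple_cancel_right,
      one_apply_eq_self]
    rcases lt_or_gt_of_ne hne with h1 | h1
    · have h2 : ¬ cs.length w < cs.length (w * cs.simple s) := by omega
      simp only [h1, h2, if_true, if_false]
      module
    · have h2 : ¬ cs.length (w * cs.simple s) < cs.length w := by omega
      simp only [h1, h2, if_true, if_false]
      module
  exact DFunLike.congr_fun this η

end HeckeCompact

/-! ### Compact operators in Hecke C⋆-algebras -/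

section HeckeCompactIntersection

variable {B W : Type*} [Group W] {M : CoxeterMatrix B} (cs : CoxeterSystem M W)

/-- The eigenvalues of a generator of the right Hecke algebra are `√q` and `-1/√q`; this gives a
lower bound for its values. -/
lemma le_norm_sq_rightHeckeGen {q : B → ℝ} {s : B} (hq : 0 < q s) (η : L2 W) :
    min (q s) (q s)⁻¹ * ‖η‖ ^ 2 ≤ ‖rightHeckeGen cs q s η‖ ^ 2 := by
  set R := rightHeckeGen cs q s with hR
  set p := heckeCoeff q s with hp
  have hsymm : ∀ x y, inner ℂ (R x) y = inner ℂ x (R y) := by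
    intro x y
    have := ContinuousLinearMap.adjoint_inner_left R y x
    rwa [← ContinuousLinearMap.star_eq_adjoint, hR, star_rightHeckeGen, ← hR] at this
  have hsq : ∀ x, R (R x) = x + (p : ℂ) • R x := rightHeckeGen_sq cs q s
  obtain ⟨c, hc⟩ : ∃ c : ℝ, c = (inner ℂ η (R η) : ℂ).re := ⟨_, rfl⟩
  have h1 : ‖R η‖ ^ 2 = ‖η‖ ^ 2 + p * c := by
    rw [← inner_self_eq_norm_sq (𝕜 := ℂ), hsymm, hsq, inner_add_right, inner_smul_right, map_add,
      inner_self_eq_norm_sq, RCLike.re_to_complex, Complex.re_ofReal_mul, hc]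
  have hpos : ∀ x : ℝ, 0 ≤ ‖R η‖ ^ 2 + 2 * x * c + x ^ 2 * ‖η‖ ^ 2 := by
    intro x
    have : ‖R η + (x : ℂ) • η‖ ^ 2 = ‖R η‖ ^ 2 + 2 * x * c + x ^ 2 * ‖η‖ ^ 2 := by
      rw [norm_add_sq (𝕜 := ℂ), inner_smul_right, hsymm, RCLike.re_to_complex,
        Complex.re_ofReal_mul, ← hc, norm_smul, Complex.norm_real, mul_pow, Real.norm_eq_abs,
        sq_abs]
      ring
    rw [← this]
    positivity
  have ha := Real.sqrt_pos.2 hq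
  obtain ⟨a, haa⟩ : ∃ a, a = √(q s) := ⟨_, rfl⟩
  have hqa : q s = a ^ 2 := by rw [haa, Real.sq_sqrt hq.le]
  have hpa : p = a - a⁻¹ := by
    rw [hp, heckeCoeff, ← haa, hqa]
    rw [← haa] at ha
    field_simp
  rw [← haa] at ha
  obtain ⟨b, hb⟩ : ∃ b, b = a⁻¹ := ⟨_, rfl⟩
  have hbpos : 0 < b := by rw [hb]; positivity
  have hab : a * b = 1 := by rw [hb]; exact mul_inv_cancel₀ ha.ne'
  rw [← hb] at hpa
  have hqb : (q s)⁻¹ = b ^ 2 := by rw [hqa, hb, inv_pow]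
  rw [hqb, hqa, h1]
  -- `(R + b)² = (a + b) (R + b)` and `(a - R)² = (a + b) (a - R)` are nonnegative
  have k1 : 0 ≤ c + b * ‖η‖ ^ 2 := by
    have := hpos b
    rw [h1, hpa] at this
    have e : ‖η‖ ^ 2 + (a - b) * c + 2 * b * c + b ^ 2 * ‖η‖ ^ 2 =
        (a + b) * (c + b * ‖η‖ ^ 2) := by
      linear_combination (-‖η‖ ^ 2) * hab
    rw [e] at this
    exact nonneg_of_mul_nonneg_right this (by positivity)
  have k2 : 0 ≤ a * ‖η‖ ^ 2 - c := by
    have := hpos (-a)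
    rw [h1, hpa] at this
    have e : ‖η‖ ^ 2 + (a - b) * c + 2 * -a * c + (-a) ^ 2 * ‖η‖ ^ 2 =
        (a + b) * (a * ‖η‖ ^ 2 - c) := by
      linear_combination (-‖η‖ ^ 2) * hab
    rw [e] at this
    exact nonneg_of_mul_nonneg_right this (by positivity)
  rw [hpa]
  rcases le_total b a with h | h
  · have h2 : min (a ^ 2) (b ^ 2) ≤ b ^ 2 := min_le_right _ _
    have h3 : b ^ 2 * ‖η‖ ^ 2 ≤ ‖η‖ ^ 2 + (a - b) * c := by
      have e : ‖η‖ ^ 2 + (a - b) * c - b ^ 2 * ‖η‖ ^ 2 = (a - b) * (c + b * ‖η‖ ^ 2) := by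
        linear_combination (-‖η‖ ^ 2) * hab
      have := mul_nonneg (sub_nonneg.2 h) k1
      linarith
    exact (mul_le_mul_of_nonneg_right h2 (by positivity)).trans h3
  · have h2 : min (a ^ 2) (b ^ 2) ≤ a ^ 2 := min_le_left _ _
    have h3 : a ^ 2 * ‖η‖ ^ 2 ≤ ‖η‖ ^ 2 + (a - b) * c := by
      have e : ‖η‖ ^ 2 + (a - b) * c - a ^ 2 * ‖η‖ ^ 2 = (b - a) * (a * ‖η‖ ^ 2 - c) := by
        linear_combination (-‖η‖ ^ 2) * hab
      have := mul_nonneg (sub_nonneg.2 h) k2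
      linarith
    exact (mul_le_mul_of_nonneg_right h2 (by positivity)).trans h3

/-- A parameter becomes a member of the excluded set as soon as the growth series converges for
the parameter with entries `min(q_s, 1/q_s)`. -/
lemma mem_excludedSet_of_summable {q : B → ℝ} (hq : q ∈ paramSet cs)
    (h : Summable (paramProd cs fun s => min (q s) (q s)⁻¹)) : q ∈ excludedSet cs := by
  classical
  refine ⟨fun s => min (q s) (q s)⁻¹, ⟨⟨fun s => lt_min (hq.1 s) (inv_pos.2 (hq.1 s)),
    fun s t hst => by simp only [hq.2 s t hst]⟩, h⟩, fun s => if q s ≤ 1 then 1 else -1,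
    ⟨fun s => by by_cases hs : q s ≤ 1 <;> simp [hs],
      fun s t hst => by simp only [hq.2 s t hst]⟩, ?_⟩
  funext s
  have hpos := hq.1 s
  beta_reduce
  by_cases hs : q s ≤ 1
  · rw [if_pos hs, zpow_one, min_eq_left]
    exact hs.trans (one_le_inv_iff₀.2 ⟨hpos, hs⟩)
  · rw [if_neg hs, zpow_neg_one, min_eq_right, inv_inv]
    exact (inv_le_one_of_one_le₀ (not_le.1 hs).le).trans (not_le.1 hs).le

/-- A Hecke C⋆-algebra with parameter outside of the excluded set contains no nonzero compact
operators. An eigenprojection `p` of a compact operator would commute with the right Hecke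
algebra, so that `‖p δ_w‖² ≥ q'_w ‖p δ_1‖²` with `q'_s = min(q_s, 1/q_s)`; but the sum of the
`‖p δ_w‖²` is the rank of `p`. -/
theorem eq_zero_of_mem_heckeCStar_of_isCompactOperator {q : B → ℝ} (hq : q ∈ paramSet cs)
    (hq' : q ∉ excludedSet cs) {T : L2 W →L[ℂ] L2 W} (hT : T ∈ heckeCStar cs q)
    (hc : IsCompactOperator T) : T = 0 := by
  by_contra hne
  apply hq'
  set A := star T * T with hA
  have hAmem : A ∈ heckeCStar cs q := mul_mem (star_mem hT) hT
  have hAc : IsCompactOperator A := hc.clm_comp (star T)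
  have hA0 : A ≠ 0 := by
    exact fun h => hne ((CStarRing.star_mul_self_eq_zero_iff T).1 h)
  have hAsym : A.IsSymmetric :=
    (ContinuousLinearMap.isSelfAdjoint_iff_isSymmetric).1 (IsSelfAdjoint.star_mul_self T)
  obtain ⟨μ, hμ, hμ0⟩ : ∃ μ, Module.End.HasEigenvalue (A : Module.End ℂ (L2 W)) μ ∧ μ ≠ 0 := by
    by_contra! hcon
    exact hA0 ((ContinuousLinearMap.eq_zero_of_forall_hasEigenvalue_eq_zero hAc hAsym).1 hcon)
  set E := Module.End.eigenspace (A : Module.End ℂ (L2 W)) μ with hE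
  have hfin : FiniteDimensional ℂ E :=
    ContinuousLinearMap.finite_dimensional_eigenspace hAc μ hμ0
  have hRE : ∀ s, ∀ x ∈ E, rightHeckeGen cs q s x ∈ E := by
    intro s x hx
    rw [hE, Module.End.mem_eigenspace_iff] at hx ⊢
    have h1 := (rightHeckeGen_commute_of_mem cs hq s hAmem).eq
    have h2 : A (rightHeckeGen cs q s x) = rightHeckeGen cs q s (A x) :=
      (DFunLike.congr_fun h1 x).symm
    have hx' : A x = μ • x := hx
    change A (rightHeckeGen cs q s x) = _
    rw [h2, hx', map_smul]
  have hp : ∀ s x, E.starProjection (rightHeckeGen cs q s x) =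
      rightHeckeGen cs q s (E.starProjection x) := by
    intro s x
    refine Submodule.eq_starProjection_of_mem_of_inner_eq_zero
      (hRE s _ (Submodule.starProjection_apply_mem E x)) ?_
    intro y hy
    rw [← map_sub]
    have := ContinuousLinearMap.adjoint_inner_left (rightHeckeGen cs q s) y (x - E.starProjection x)
    rw [← ContinuousLinearMap.star_eq_adjoint, star_rightHeckeGen] at this
    rw [this]
    exact Submodule.starProjection_inner_eq_zero _ _ (hRE s y hy)
  have hstep : ∀ w s, cs.length w < cs.length (w * cs.simple s) →
      E.starProjection (delta (w * cs.simple s)) =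
        rightHeckeGen cs q s (E.starProjection (delta w)) := by
    classical
    intro w s h
    rw [← hp, rightHeckeGen_delta, if_neg (by omega), zero_smul, add_zero]
  set q' : B → ℝ := fun s => min (q s) (q s)⁻¹ with hqdef
  have hq'mem : q' ∈ paramSet cs := ⟨fun s => lt_min (hq.1 s) (inv_pos.2 (hq.1 s)),
    fun s t hst => by simp only [hqdef, hq.2 s t hst]⟩
  have hlow : ∀ ω : List B, cs.IsReduced ω → (ω.map q').prod * ‖E.starProjection (delta 1)‖ ^ 2 ≤
      ‖E.starProjection (delta (cs.wordProd ω))‖ ^ 2 := by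
    intro ω
    induction ω using List.reverseRecOn with
    | nil => intro _; simp
    | append_singleton ω s ih =>
      intro hω
      have hω' : cs.IsReduced ω := by
        have := hω.take ω.length
        simpa using this
      have e : cs.wordProd (ω ++ [s]) = cs.wordProd ω * cs.simple s := by
        rw [cs.wordProd_append, cs.wordProd_singleton]
      have hlt : cs.length (cs.wordProd ω) < cs.length (cs.wordProd ω * cs.simple s) := by
        rw [← e, hω.eq, hω'.eq]; simp
      rw [e, hstep _ _ hlt, List.map_append, List.prod_append]
      refine le_trans ?_ (le_norm_sq_rightHeckeGen cs (hq.1 s) _)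
      have hs : 0 < q' s := hq'mem.1 s
      calc _ = q' s * ((ω.map q').prod * ‖E.starProjection (delta 1)‖ ^ 2) := by
            simp; ring
        _ ≤ _ := mul_le_mul_of_nonneg_left (ih hω') hs.le
  have hξ : E.starProjection (delta 1) ≠ 0 := by
    intro h0
    have hall : ∀ ω : List B, cs.IsReduced ω → E.starProjection (delta (cs.wordProd ω)) = 0 := by
      intro ω
      induction ω using List.reverseRecOn with
      | nil => intro _; simpa using h0
      | append_singleton ω s ih =>
        intro hω
        have hω' : cs.IsReduced ω := by
          have := hω.take ω.length
          simpa using this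
        have e : cs.wordProd (ω ++ [s]) = cs.wordProd ω * cs.simple s := by
          rw [cs.wordProd_append, cs.wordProd_singleton]
        have hlt : cs.length (cs.wordProd ω) < cs.length (cs.wordProd ω * cs.simple s) := by
          rw [← e, hω.eq, hω'.eq]; simp
        rw [e, hstep _ _ hlt, ih hω', map_zero]
    have hz : E.starProjection = 0 := by
      refine clm_ext_delta fun w => ?_
      obtain ⟨ω, hω, rfl⟩ := cs.exists_isReduced w
      rw [hall ω hω, zero_apply]
    obtain ⟨x, hx⟩ := hμ.exists_hasEigenvector
    have h1 : E.starProjection x = x := Submodule.starProjection_eq_self_iff.2 hx.1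
    rw [hz, zero_apply] at h1
    exact hx.2 h1.symm
  have hsum : Summable fun w => ‖E.starProjection (delta w)‖ ^ 2 := by
    set b := stdOrthonormalBasis ℂ E with hb
    have e : ∀ w, ‖E.starProjection (delta w)‖ ^ 2 = ∑ i, ‖(b i : L2 W) w‖ ^ 2 := by
      intro w
      have h1 := b.sum_sq_norm_inner_right (E.orthogonalProjectionOnto (delta w))
      have h2 : ‖E.starProjection (delta w)‖ = ‖E.orthogonalProjectionOnto (delta w)‖ := rfl
      rw [h2, ← h1]
      refine Finset.sum_congr rfl fun i _ => ?_
      rw [Submodule.coe_inner, Submodule.coe_orthogonalProjectionOnto_apply,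
        ← Submodule.inner_starProjection_left_eq_right, Submodule.starProjection_eq_self_iff.2 (b i).2,
        inner_delta_right, RCLike.norm_conj]
    simp only [e]
    refine summable_sum fun i _ => ?_
    simpa using l2_summable (b i : L2 W)
  refine mem_excludedSet_of_summable cs hq ?_
  have hξ' : 0 < ‖E.starProjection (delta 1)‖ ^ 2 := by positivity
  refine Summable.of_nonneg_of_le (fun w => ?_) (fun w => ?_)
    (hsum.mul_right (‖E.starProjection (delta 1)‖ ^ 2)⁻¹)
  · obtain ⟨ω, hω, rfl⟩ := cs.exists_isReduced w
    rw [paramProd_wordProd hq'mem hω]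
    refine List.prod_nonneg fun a ha => ?_
    obtain ⟨s, -, rfl⟩ := List.mem_map.1 ha
    exact (hq'mem.1 s).le
  · obtain ⟨ω, hω, rfl⟩ := cs.exists_isReduced w
    rw [paramProd_wordProd hq'mem hω, ← div_eq_mul_inv, le_div_iff₀ hξ']
    exact hlow ω hω

end HeckeCompactIntersection

/-! ### Ampliations -/

section Ampliation

variable {I ι : Type*}

lemma norm_sq_eq_tsum (f : L2 ι) : ‖f‖ ^ (2 : ℝ) = ∑' i, ‖f i‖ ^ (2 : ℝ) := by
  simpa using lp.norm_rpow_eq_tsum (p := 2) (by norm_num) f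

/-- The restriction of a vector of `ℓ²(I × ι)` to the slice `{i} × ι`. -/
noncomputable def slice (i : I) : L2 (I × ι) →L[ℂ] L2 ι :=
  LinearMap.mkContinuous
    { toFun := fun ξ => ⟨fun x => ξ (i, x), (memℓp_gen_iff (by norm_num)).2 (by
        simpa [Function.comp_def] using
          (l2_summable ξ).comp_injective (Prod.mk_right_injective i))⟩
      map_add' := fun _ _ => rfl
      map_smul' := fun _ _ => rfl } 1 (by
    intro ξ
    rw [one_mul]
    refine lp.norm_le_of_tsum_le (by norm_num) (norm_nonneg _) ?_
    simp only [ENNReal.toReal_ofNat]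
    rw [norm_sq_eq_tsum]
    exact ((l2_summable ξ).comp_injective (Prod.mk_right_injective i)).tsum_le_tsum_of_inj
      (Prod.mk i) (Prod.mk_right_injective i) (fun _ _ => by positivity) (fun _ => le_rfl)
      (l2_summable ξ))

lemma slice_apply (i : I) (ξ : L2 (I × ι)) (x : ι) : slice i ξ x = ξ (i, x) := rfl

open Classical in
lemma slice_delta (i j : I) (x : ι) :
    slice i (delta (j, x)) = if i = j then (delta x : L2 ι) else 0 := by
  refine l2_ext fun y => ?_
  rw [slice_apply, delta_apply]
  by_cases h : i = j
  · simp [h, delta_apply]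
  · simp [h]

lemma summable_norm_slice (ξ : L2 (I × ι)) : Summable fun i => ‖slice i ξ‖ ^ (2 : ℝ) := by
  have := ((summable_prod_of_nonneg (fun _ => by positivity)).1 (l2_summable ξ)).2
  simpa only [norm_sq_eq_tsum, slice_apply] using this

lemma norm_sq_eq_tsum_slice (ξ : L2 (I × ι)) : ‖ξ‖ ^ (2 : ℝ) = ∑' i, ‖slice i ξ‖ ^ (2 : ℝ) := by
  rw [norm_sq_eq_tsum, (l2_summable ξ).tsum_prod]
  simp only [norm_sq_eq_tsum, slice_apply]

lemma norm_slice_map_le (T : L2 ι →L[ℂ] L2 ι) (ξ : L2 (I × ι)) (i : I) :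
    ‖T (slice i ξ)‖ ^ (2 : ℝ) ≤ ‖T‖ ^ (2 : ℝ) * ‖slice i ξ‖ ^ (2 : ℝ) := by
  rw [← Real.mul_rpow (norm_nonneg _) (norm_nonneg _)]
  exact Real.rpow_le_rpow (norm_nonneg _) (T.le_opNorm _) (by norm_num)

lemma summable_ampliation (T : L2 ι →L[ℂ] L2 ι) (ξ : L2 (I × ι)) :
    Summable fun p : I × ι => ‖T (slice p.1 ξ) p.2‖ ^ (2 : ℝ) := by
  refine (summable_prod_of_nonneg (fun _ => by positivity)).2 ⟨fun i => l2_summable (T (slice i ξ)), ?_⟩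
  simp only [← norm_sq_eq_tsum]
  exact Summable.of_nonneg_of_le (fun _ => by positivity) (norm_slice_map_le T ξ)
    ((summable_norm_slice ξ).mul_left _)

/-- The operator `1 ⊗ T` on `ℓ²(I × ι) = ℓ²(I) ⊗ ℓ²(ι)`. -/
noncomputable def ampliationOp (I : Type*) (T : L2 ι →L[ℂ] L2 ι) :
    L2 (I × ι) →L[ℂ] L2 (I × ι) :=
  LinearMap.mkContinuous
    { toFun := fun ξ => ⟨fun p => T (slice p.1 ξ) p.2, (memℓp_gen_iff (by norm_num)).2 (by
        simpa using summable_ampliation T ξ)⟩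
      map_add' := fun ξ η => l2_ext fun p => by
        change T (slice p.1 (ξ + η)) p.2 = T (slice p.1 ξ) p.2 + T (slice p.1 η) p.2
        rw [map_add, map_add]; rfl
      map_smul' := fun c ξ => l2_ext fun p => by
        change T (slice p.1 (c • ξ)) p.2 = c • T (slice p.1 ξ) p.2
        rw [map_smul, map_smul]; rfl } ‖T‖ (by
    intro ξ
    refine lp.norm_le_of_tsum_le (by norm_num) (by positivity) ?_
    simp only [ENNReal.toReal_ofNat]
    rw [Real.mul_rpow (norm_nonneg _) (norm_nonneg _), norm_sq_eq_tsum_slice ξ, ← tsum_mul_left]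
    change ∑' p : I × ι, ‖T (slice p.1 ξ) p.2‖ ^ (2 : ℝ) ≤ _
    rw [(summable_ampliation T ξ).tsum_prod]
    simp only [← norm_sq_eq_tsum]
    exact (Summable.of_nonneg_of_le (fun _ => by positivity) (norm_slice_map_le T ξ)
      ((summable_norm_slice ξ).mul_left _)).tsum_le_tsum (norm_slice_map_le T ξ)
      ((summable_norm_slice ξ).mul_left _))

lemma ampliationOp_apply (T : L2 ι →L[ℂ] L2 ι) (ξ : L2 (I × ι)) (p : I × ι) :
    ampliationOp I T ξ p = T (slice p.1 ξ) p.2 := rfl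

open Classical in
lemma ampliationOp_delta_apply (T : L2 ι →L[ℂ] L2 ι) (p r : I × ι) :
    ampliationOp I T (delta p) r = if r.1 = p.1 then T (delta p.2) r.2 else 0 := by
  rw [ampliationOp_apply, show p = (p.1, p.2) from rfl, slice_delta]
  split_ifs <;> simp

/-- The ampliation `T ↦ 1 ⊗ T` as a `*`-homomorphism. -/
noncomputable def ampliation (I : Type*) :
    (L2 ι →L[ℂ] L2 ι) →⋆ₐ[ℂ] (L2 (I × ι) →L[ℂ] L2 (I × ι)) where
  toFun := ampliationOp I
  map_one' := rfl
  map_mul' _ _ := rfl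
  map_zero' := rfl
  map_add' _ _ := rfl
  commutes' _ := rfl
  map_star' T := by
    classical
    refine clm_ext_coeff fun p r => ?_
    rw [star_apply_coeff, ampliationOp_delta_apply, ampliationOp_delta_apply, star_apply_coeff]
    by_cases h : r.1 = p.1
    · rw [if_pos h, if_pos h.symm]
    · rw [if_neg h, if_neg (Ne.symm h), map_zero]

open Classical in
lemma ampliation_delta_apply (T : L2 ι →L[ℂ] L2 ι) (p r : I × ι) :
    ampliation I T (delta p) r = if r.1 = p.1 then T (delta p.2) r.2 else 0 :=
  ampliationOp_delta_apply T p r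

lemma norm_ampliation_le (T : L2 ι →L[ℂ] L2 ι) : ‖ampliation I T‖ ≤ ‖T‖ :=
  NonUnitalStarAlgHom.norm_apply_le (ampliation I) T

end Ampliation

/-! ### Diagonal operators -/

section DiagonalOperators

variable {ι : Type*}

lemma diagOp_delta (a : ι → ℂ) (C : ℝ) (h : ∀ i, ‖a i‖ ≤ C) (i : ι) :
    diagOp a C h (delta i) = a i • delta i := by
  classical
  refine l2_ext fun j => ?_
  rw [diagOp_apply, lp.coeFn_smul, Pi.smul_apply, delta_apply, smul_eq_mul]
  split_ifs with hj
  · rw [hj]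
  · simp

lemma norm_diagOp_le (a : ι → ℂ) (C : ℝ) (h : ∀ i, ‖a i‖ ≤ C) (hC : 0 ≤ C) :
    ‖diagOp a C h‖ ≤ C := by
  refine le_of_le_of_eq ?_ (abs_of_nonneg hC)
  unfold diagOp
  exact LinearMap.mkContinuous_norm_le _ (abs_nonneg C) _

/-- A diagonal operator whose entries tend to `0` is compact: it is a norm limit of operators of
finite rank. -/
lemma isCompactOperator_diagOp {a : ι → ℂ} {C : ℝ} {h : ∀ i, ‖a i‖ ≤ C}
    (ha : Tendsto a cofinite (𝓝 0)) : IsCompactOperator (diagOp a C h) := by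
  classical
  have hcl : IsClosed {T : L2 ι →L[ℂ] L2 ι | IsCompactOperator T} :=
    isClosed_setOfPred_isCompactOperator
  refine hcl.closure_subset (Metric.mem_closure_iff.2 fun ε hε => ?_)
  have hfin : {i | ¬ ‖a i‖ < ε / 2}.Finite := by
    have := (tendsto_zero_iff_norm_tendsto_zero.1 ha).eventually (gt_mem_nhds (half_pos hε))
    exact this
  set s := hfin.toFinset with hs
  set R : ι → (L2 ι →L[ℂ] L2 ι) := fun i =>
    (innerSL ℂ (delta i : L2 ι)).smulRight (a i • (delta i : L2 ι)) with hR
  have hRc : ∀ i, R i ∈ compactIdeal (L2 ι) := by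
    intro i
    have h1 : IsCompactOperator (ContinuousLinearMap.toSpanSingleton ℂ (a i • (delta i : L2 ι))) :=
      isCompactOperator_of_locallyCompactSpace_rng
        (ContinuousLinearMap.toSpanSingleton ℂ (a i • (delta i : L2 ι)))
    have h2 := h1.comp_clm (innerSL ℂ (delta i : L2 ι))
    exact h2
  refine ⟨∑ i ∈ s, R i, (compactIdeal (L2 ι)).sum_mem fun i _ => hRc i, ?_⟩
  have hb : ∀ i, ‖if i ∈ s then 0 else a i‖ ≤ ε / 2 := by
    intro i
    split_ifs with hi
    · rw [norm_zero]; exact (half_pos hε).le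
    · have : ¬ ¬ ‖a i‖ < ε / 2 := fun hc => hi (hfin.mem_toFinset.2 hc)
      exact (not_not.1 this).le
  have e : diagOp a C h - ∑ i ∈ s, R i = diagOp (fun i => if i ∈ s then 0 else a i) _ hb := by
    refine clm_ext_delta fun j => ?_
    have hRj : ∀ i, R i (delta j) = if i = j then a j • delta j else 0 := by
      intro i
      rw [hR]
      simp only [ContinuousLinearMap.smulRight_apply, innerSL_apply_apply, inner_delta_left,
        delta_apply]
      split_ifs with hij
      · rw [hij, one_smul]
      · rw [zero_smul]
    rw [sub_apply, sum_apply]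
    simp only [hRj, diagOp_delta, Finset.sum_ite_eq']
    split_ifs <;> simp
  rw [dist_eq_norm, e]
  exact (norm_diagOp_le _ _ hb (half_pos hε).le).trans_lt (half_lt_self hε)

end DiagonalOperators

/-! ### Operators of finite propagation -/

section FinitePropagation

variable {W : Type*} [Group W]

/-- The operator `T` on `ℓ²(W)` has propagation in `G` if its matrix coefficient from `δ_x` to
`δ_y` vanishes unless `y = gx` for some `g ∈ G`. -/
def PropagationIn (G : Set W) (T : L2 W →L[ℂ] L2 W) : Prop :=
  ∀ x y, T (delta x) y ≠ 0 → y * x⁻¹ ∈ G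

lemma leftTranslation_delta (w x : W) : leftTranslation w (delta x) = delta (w * x) :=
  permOp_delta _ _

/-- An operator of finite propagation is a finite sum of products of left translations with
diagonal operators. -/
lemma PropagationIn.eq_sum {G : Finset W} {T : L2 W →L[ℂ] L2 W} (hT : PropagationIn (G : Set W) T)
    {C : ℝ} (hC : ∀ g x, ‖T (delta x) (g * x)‖ ≤ C) :
    T = ∑ g ∈ G, leftTranslation g * diagOp (fun x => T (delta x) (g * x)) C (hC g) := by
  classical
  refine clm_ext_coeff fun x y => ?_
  rw [sum_apply, lp.coeFn_sum, Finset.sum_apply]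
  have : ∀ g ∈ G, (leftTranslation g * diagOp (fun x => T (delta x) (g * x)) C (hC g)) (delta x) y =
      if g = y * x⁻¹ then T (delta x) y else 0 := by
    intro g _
    rw [mul_apply_eq_comp, diagOp_delta, map_smul, leftTranslation_delta, lp.coeFn_smul,
      Pi.smul_apply, delta_apply, smul_eq_mul]
    by_cases h : g = y * x⁻¹
    · subst h; simp
    · rw [if_neg h, if_neg, mul_zero]
      rintro rfl; exact h (by simp)
  rw [Finset.sum_congr rfl this, Finset.sum_ite_eq']
  split_ifs with h
  · rfl
  · by_contra hne
    exact h (hT x y hne)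

lemma norm_leftTranslation_le (w : W) : ‖(leftTranslation w : L2 W →L[ℂ] L2 W)‖ ≤ 1 :=
  ContinuousLinearMap.opNorm_le_bound _ zero_le_one fun f => by
    rw [leftTranslation, norm_permOp_apply, one_mul]

lemma PropagationIn.norm_le {G : Finset W} {T : L2 W →L[ℂ] L2 W}
    (hT : PropagationIn (G : Set W) T) {C : ℝ} (hC : ∀ g x, ‖T (delta x) (g * x)‖ ≤ C) :
    ‖T‖ ≤ G.card * C := by
  have hC0 : 0 ≤ C := (norm_nonneg _).trans (hC 1 1)
  rw [hT.eq_sum hC]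
  refine (norm_sum_le _ _).trans ?_
  rw [← nsmul_eq_mul]
  refine Finset.sum_le_card_nsmul _ _ _ fun g _ => (norm_mul_le _ _).trans ?_
  calc _ ≤ 1 * C := mul_le_mul (norm_leftTranslation_le g) (norm_diagOp_le _ _ _ hC0)
        (norm_nonneg _) zero_le_one
    _ = C := one_mul C

lemma norm_coeff_le {ι κ : Type*} (T : L2 ι →L[ℂ] L2 κ) (i : ι) (j : κ) :
    ‖T (delta i) j‖ ≤ ‖T‖ := by
  refine (lp.norm_apply_le_norm (by norm_num) _ j).trans ((T.le_opNorm _).trans ?_)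
  rw [norm_delta, mul_one]

lemma PropagationIn.isCompactOperator {G : Set W} (hG : G.Finite) {T : L2 W →L[ℂ] L2 W}
    (hT : PropagationIn G T)
    (h : ∀ g, Tendsto (fun x => T (delta x) (g * x)) cofinite (𝓝 0)) : IsCompactOperator T := by
  rw [← hG.coe_toFinset] at hT
  have e := hT.eq_sum (C := ‖T‖) fun g x => norm_coeff_le T x _
  have : T ∈ compactIdeal (L2 W) := by
    rw [e]
    exact (compactIdeal (L2 W)).sum_mem fun g _ =>
      (compactIdeal (L2 W)).mul_mem_left _ (isCompactOperator_diagOp (h g))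
  exact this

lemma PropagationIn.mul {G G' : Set W} {T T' : L2 W →L[ℂ] L2 W} (hT : PropagationIn G T)
    (hT' : PropagationIn G' T') : PropagationIn (Set.image2 (· * ·) G G') (T * T') := by
  intro x y h
  have e : (T * T') (delta x) y = inner ℂ (star T (delta y)) (T' (delta x)) := by
    rw [ContinuousLinearMap.star_eq_adjoint, ContinuousLinearMap.adjoint_inner_left,
      inner_delta_left]
    rfl
  rw [e, lp.inner_eq_tsum] at h
  obtain ⟨u, hu⟩ : ∃ u, inner ℂ ((star T (delta y) : L2 W) u) (T' (delta x) u) ≠ (0 : ℂ) := by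
    by_contra hc
    push Not at hc
    exact h ((tsum_congr hc).trans tsum_zero)
  rw [star_apply_coeff] at hu
  refine ⟨y * u⁻¹, hT u y fun h0 => hu (by simp [h0]), u * x⁻¹,
    hT' x u fun h0 => hu (by simp [h0]), by simp⟩

lemma PropagationIn.star {G : Set W} {T : L2 W →L[ℂ] L2 W} (hT : PropagationIn G T) :
    PropagationIn ((·⁻¹) '' G) (star T) := by
  intro x y h
  rw [star_apply_coeff] at h
  exact ⟨x * y⁻¹, hT y x fun h0 => h (by rw [h0, map_zero]), by simp⟩

lemma PropagationIn.add {G G' : Set W} {T T' : L2 W →L[ℂ] L2 W} (hT : PropagationIn G T)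
    (hT' : PropagationIn G' T') : PropagationIn (G ∪ G') (T + T') := by
  intro x y h
  by_contra hc
  rw [Set.mem_union, not_or] at hc
  apply h
  rw [add_apply, lp.coeFn_add, Pi.add_apply, not_not.1 (mt (hT x y) hc.1),
    not_not.1 (mt (hT' x y) hc.2), add_zero]

lemma propagationIn_algebraMap (c : ℂ) :
    PropagationIn {(1 : W)} (algebraMap ℂ (L2 W →L[ℂ] L2 W) c) := by
  classical
  intro x y h
  have e : algebraMap ℂ (L2 W →L[ℂ] L2 W) c (delta x) = c • delta x := rfl
  rw [e, lp.coeFn_smul, Pi.smul_apply, delta_apply] at h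
  have : y = x := by
    by_contra hne
    simp [hne] at h
  simp [this]

variable (W) in
/-- The `*`-algebra of operators of finite propagation on `ℓ²(W)`; its closure is the uniform Roe
algebra. -/
def finitePropagation : StarSubalgebra ℂ (L2 W →L[ℂ] L2 W) where
  carrier := {T | ∃ G : Set W, G.Finite ∧ PropagationIn G T}
  mul_mem' := by
    rintro T T' ⟨G, hG, h⟩ ⟨G', hG', h'⟩
    exact ⟨_, hG.image2 _ hG', h.mul h'⟩
  add_mem' := by
    rintro T T' ⟨G, hG, h⟩ ⟨G', hG', h'⟩
    exact ⟨_, hG.union hG', h.add h'⟩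
  algebraMap_mem' c := ⟨_, Set.finite_singleton _, propagationIn_algebraMap c⟩
  star_mem' := by
    rintro T ⟨G, hG, h⟩
    exact ⟨_, hG.image _, h.star⟩

lemma leftTranslation_mem_finitePropagation (w : W) :
    leftTranslation w ∈ finitePropagation W := by
  classical
  refine ⟨{w}, Set.finite_singleton _, fun x y h => ?_⟩
  rw [leftTranslation_delta, delta_apply] at h
  have : y = w * x := by
    by_contra hne
    simp [hne] at h
  simp [this]

lemma coordProj_mem_finitePropagation (s : Set W) : coordProj s ∈ finitePropagation W := by
  classical
  refine ⟨{1}, Set.finite_singleton _, fun x y h => ?_⟩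
  have : y = x := by
    by_contra hne
    apply h
    rw [coordProj_delta]
    split_ifs <;> simp [delta_apply, hne]
  simp [this]

lemma allHecke_le {B : Type*} {M : CoxeterMatrix B} (cs : CoxeterSystem M W)
    {A : StarSubalgebra ℂ (L2 W →L[ℂ] L2 W)} (hA : IsClosed (A : Set (L2 W →L[ℂ] L2 W)))
    (h : ∀ w, leftTranslation w ∈ A) (h' : ∀ w, weakProj cs w ∈ A) : allHecke cs ≤ A := by
  refine StarSubalgebra.topologicalClosure_minimal (StarAlgebra.adjoin_le ?_) hA
  refine Set.iUnion₂_subset fun q _ => ?_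
  refine StarSubalgebra.topologicalClosure_minimal (StarAlgebra.adjoin_le ?_) hA
  rintro _ ⟨s, rfl⟩
  exact add_mem (h _) (A.smul_mem (h' _) _)

lemma allHecke_le_closure_finitePropagation {B : Type*} {M : CoxeterMatrix B}
    (cs : CoxeterSystem M W) : allHecke cs ≤ (finitePropagation W).topologicalClosure :=
  allHecke_le cs (StarSubalgebra.isClosed_topologicalClosure _)
    (fun w => StarSubalgebra.le_topologicalClosure _ (leftTranslation_mem_finitePropagation w))
    (fun _ => StarSubalgebra.le_topologicalClosure _ (coordProj_mem_finitePropagation _))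

end FinitePropagation

/-! ### Schur multipliers -/

section SchurMultiplier

variable {J ι : Type*}

/-- The normalized indicator vector of `F x × {x}` in `ℓ²(J × ι)`. -/
noncomputable def fiberVec (F : ι → Finset J) (x : ι) : L2 (J × ι) :=
  ((√(F x).card : ℝ) : ℂ)⁻¹ • ∑ j ∈ F x, delta (j, x)

lemma inner_fiberVec (F : ι → Finset J) (x : ι) (ξ : L2 (J × ι)) :
    inner ℂ (fiberVec F x) ξ = ((√(F x).card : ℝ) : ℂ)⁻¹ * ∑ j ∈ F x, ξ (j, x) := by
  rw [fiberVec, inner_smul_left, sum_inner]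
  simp only [inner_delta_left, map_inv₀, Complex.conj_ofReal]

open Classical in
lemma fiberVec_apply (F : ι → Finset J) (x : ι) (p : J × ι) :
    fiberVec F x p = if p.2 = x ∧ p.1 ∈ F x then ((√(F x).card : ℝ) : ℂ)⁻¹ else 0 := by
  obtain ⟨j, y⟩ := p
  rw [fiberVec, lp.coeFn_smul, Pi.smul_apply, lp.coeFn_sum, Finset.sum_apply]
  simp only [delta_apply, Prod.mk.injEq, smul_eq_mul]
  by_cases hy : y = x
  · simp [hy]
  · simp [hy]

lemma orthonormal_fiberVec {F : ι → Finset J} (hF : ∀ x, (F x).Nonempty) :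
    Orthonormal ℂ (fiberVec F) := by
  classical
  rw [orthonormal_iff_ite]
  intro x y
  rw [inner_fiberVec]
  simp only [fiberVec_apply]
  split_ifs with h
  · subst h
    have hp : (0 : ℝ) < (F x).card := by exact_mod_cast (hF x).card_pos
    have hs : ((√(F x).card : ℝ) : ℂ) * ((√(F x).card : ℝ) : ℂ) = ((F x).card : ℂ) := by
      rw [← Complex.ofReal_mul, Real.mul_self_sqrt hp.le, Complex.ofReal_natCast]
    have hne : ((√(F x).card : ℝ) : ℂ) ≠ 0 := by
      rw [Complex.ofReal_ne_zero]; exact (Real.sqrt_pos.2 hp).ne'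
    rw [Finset.sum_congr rfl fun j hj => if_pos ⟨rfl, hj⟩, Finset.sum_const, nsmul_eq_mul, ← hs]
    field_simp
  · rw [Finset.sum_eq_zero, mul_zero]
    exact fun j _ => if_neg fun hc => h hc.1

/-- The isometry `δ_x ↦ fiberVec F x`. -/
noncomputable def fiberIsometry {F : ι → Finset J} (hF : ∀ x, (F x).Nonempty) :
    L2 ι →ₗᵢ[ℂ] L2 (J × ι) :=
  (orthonormal_fiberVec hF).orthogonalFamily.linearIsometry

lemma fiberIsometry_delta {F : ι → Finset J} (hF : ∀ x, (F x).Nonempty) (x : ι) :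
    fiberIsometry hF (delta x) = fiberVec F x := by
  classical
  rw [fiberIsometry, delta, OrthogonalFamily.linearIsometry_apply_single]
  simp

/-- The Schur multiplier with the positive definite kernel `|F x ∩ F y| / √(|F x| |F y|)`, as the
compression `T ↦ V* (1 ⊗ T) V` of the ampliation by the isometry `V = fiberIsometry hF`. -/
noncomputable def schurMul {F : ι → Finset J} (hF : ∀ x, (F x).Nonempty) (T : L2 ι →L[ℂ] L2 ι) :
    L2 ι →L[ℂ] L2 ι :=
  ((fiberIsometry hF).toContinuousLinearMap.adjoint ∘L ampliation J T) ∘L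
    (fiberIsometry hF).toContinuousLinearMap

lemma schurMul_sub {F : ι → Finset J} (hF : ∀ x, (F x).Nonempty) (S T : L2 ι →L[ℂ] L2 ι) :
    schurMul hF (S - T) = schurMul hF S - schurMul hF T := by
  rw [schurMul, map_sub, ContinuousLinearMap.comp_sub, ContinuousLinearMap.sub_comp]
  rfl

lemma norm_schurMul_le {F : ι → Finset J} (hF : ∀ x, (F x).Nonempty) (T : L2 ι →L[ℂ] L2 ι) :
    ‖schurMul hF T‖ ≤ ‖T‖ := by
  have h1 : ‖(fiberIsometry hF).toContinuousLinearMap‖ ≤ 1 :=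
    (fiberIsometry hF).norm_toContinuousLinearMap_le
  have h2 : ‖(fiberIsometry hF).toContinuousLinearMap.adjoint‖ ≤ 1 := by
    rwa [LinearIsometryEquiv.norm_map]
  calc ‖schurMul hF T‖ ≤ ‖(fiberIsometry hF).toContinuousLinearMap.adjoint ∘L ampliation J T‖ *
        ‖(fiberIsometry hF).toContinuousLinearMap‖ := ContinuousLinearMap.opNorm_comp_le _ _
    _ ≤ (‖(fiberIsometry hF).toContinuousLinearMap.adjoint‖ * ‖ampliation J T‖) * 1 := by
        gcongr
        exact ContinuousLinearMap.opNorm_comp_le _ _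
    _ ≤ (1 * ‖T‖) * 1 := by
        gcongr
        exact norm_ampliation_le T
    _ = ‖T‖ := by ring

lemma schurMul_delta_apply [DecidableEq J] {F : ι → Finset J} (hF : ∀ x, (F x).Nonempty) {N : ℕ}
    (hN : ∀ x, (F x).card = N) (T : L2 ι →L[ℂ] L2 ι) (x y : ι) :
    schurMul hF T (delta x) y = ((F x ∩ F y).card / N : ℂ) * T (delta x) y := by
  classical
  have hp : (0 : ℝ) < N := by rw [← hN x]; exact_mod_cast (hF x).card_pos
  have hs : ((√N : ℝ) : ℂ) * ((√N : ℝ) : ℂ) = (N : ℂ) := by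
    rw [← Complex.ofReal_mul, Real.mul_self_sqrt hp.le, Complex.ofReal_natCast]
  have hne : ((√N : ℝ) : ℂ) ≠ 0 := by
    rw [Complex.ofReal_ne_zero]; exact (Real.sqrt_pos.2 hp).ne'
  have e : schurMul hF T (delta x) y = inner ℂ (fiberVec F y) (ampliation J T (fiberVec F x)) := by
    rw [← inner_delta_left y, schurMul, ContinuousLinearMap.comp_apply,
      ContinuousLinearMap.comp_apply, ContinuousLinearMap.adjoint_inner_right]
    simp only [LinearIsometry.coe_toContinuousLinearMap, fiberIsometry_delta]
  have e2 : ∀ j, ampliation J T (fiberVec F x) (j, y) =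
      if j ∈ F x then ((√N : ℝ) : ℂ)⁻¹ * T (delta x) y else 0 := by
    intro j
    rw [fiberVec, map_smul, map_sum, lp.coeFn_smul, Pi.smul_apply, lp.coeFn_sum, Finset.sum_apply]
    simp only [ampliation_delta_apply, Finset.sum_ite_eq, hN, smul_eq_mul]
    split_ifs <;> simp
  rw [e, inner_fiberVec]
  simp only [e2]
  rw [← Finset.sum_filter, Finset.sum_const, Finset.filter_mem_eq_inter,
    Finset.inter_comm, hN, nsmul_eq_mul, ← hs]
  field_simp

end SchurMultiplier

/-! ### A compactness criterion from property A -/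

section CompactnessCriterion

variable {B W : Type*} [Finite B] [Group W] {M : CoxeterMatrix B}

lemma finite_ball (cs : CoxeterSystem M W) (R : ℕ) : {g : W | cs.length g ≤ R}.Finite := by
  have : {g : W | cs.length g ≤ R} = ⋃ n ∈ Set.Iic R, {g : W | cs.length g = n} := by
    ext g; simp
  rw [this]
  exact (Set.finite_Iic R).biUnion fun n _ => finite_sphere n

/-- Schur multipliers of finite propagation with kernels in `[0, 1]` which approximate the identity:
the analytic form of property A. -/
theorem exists_schur_approximation (cs : CoxeterSystem M W) (n : ℕ) (hn : 0 < n) :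
    ∃ (m : (L2 W →L[ℂ] L2 W) → (L2 W →L[ℂ] L2 W)) (k : W → W → ℝ),
      (∀ S T, m (S - T) = m S - m T) ∧ (∀ T, ‖m T‖ ≤ ‖T‖) ∧
      (∀ T x y, m T (delta x) y = k x y * T (delta x) y) ∧
      (∀ x y, 0 ≤ k x y ∧ k x y ≤ 1) ∧
      (∀ g x, n * (1 - k x (g * x)) ≤ cs.length g) ∧
      ∃ R, ∀ x y, k x y ≠ 0 → cs.length (y * x⁻¹) ≤ R := by
  classical
  obtain ⟨c, hc⟩ := exists_propertyA_sets cs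
  obtain ⟨F, hF, hstep, R, hR⟩ := hc n
  have hpos : 0 < n ^ c := by positivity
  have hne : ∀ x : W, (F x⁻¹).Nonempty := fun x => Finset.card_pos.1 (by rw [hF]; exact hpos)
  have hle : ∀ x y, (F x ∩ F y).card ≤ n ^ c := fun x y =>
    (Finset.card_le_card Finset.inter_subset_left).trans (hF x).le
  -- translating by `w` moves `F x` by at most `|w|` steps
  have hmove : ∀ (w x : W), n * (F x \ F (x * w)).card ≤ cs.length w * n ^ c := by
    intro w
    obtain ⟨ω, hω, rfl⟩ := cs.exists_isReduced w
    rw [hω.eq]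
    clear hω
    induction ω with
    | nil => intro x; simp
    | cons s ω ih =>
      intro x
      have h1 := hstep x s
      have h2 := ih (x * cs.simple s)
      have h3 : (F x \ F (x * cs.wordProd (s :: ω))).card ≤
          (F x \ F (x * cs.simple s)).card +
            (F (x * cs.simple s) \ F (x * cs.simple s * cs.wordProd ω)).card := by
        refine (Finset.card_le_card ?_).trans (Finset.card_union_le _ _)
        rw [cs.wordProd_cons, ← mul_assoc]
        intro j hj
        simp only [Finset.mem_union, Finset.mem_sdiff] at hj ⊢
        tauto
      calc _ ≤ n * _ := Nat.mul_le_mul_left n h3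
        _ ≤ (s :: ω).length * n ^ c := by
          rw [List.length_cons]
          linarith
  refine ⟨schurMul hne, fun x y => ((F x⁻¹ ∩ F y⁻¹).card : ℝ) / (n ^ c : ℕ), schurMul_sub hne,
    norm_schurMul_le hne, fun T x y => ?_, fun x y => ⟨by positivity, ?_⟩, fun g x => ?_, R,
    fun x y hk => ?_⟩
  · rw [schurMul_delta_apply hne fun x => hF x⁻¹]
    push_cast
    rfl
  · exact div_le_one_of_le₀ (by exact_mod_cast hle _ _) (by positivity)
  · have h1 := hmove g⁻¹ x⁻¹
    rw [cs.length_inv, ← mul_inv_rev] at h1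
    have h2 := Finset.card_inter_add_card_sdiff (F x⁻¹) (F (g * x)⁻¹)
    rw [hF] at h2
    have h1' : (n : ℝ) * (F x⁻¹ \ F (g * x)⁻¹).card ≤ cs.length g * (n ^ c : ℕ) := by
      exact_mod_cast h1
    have h2' : ((F x⁻¹ ∩ F (g * x)⁻¹).card : ℝ) + (F x⁻¹ \ F (g * x)⁻¹).card = (n ^ c : ℕ) := by
      exact_mod_cast h2
    have hp : (0 : ℝ) < (n ^ c : ℕ) := by exact_mod_cast hpos
    have e : (n : ℝ) * (1 - (F x⁻¹ ∩ F (g * x)⁻¹).card / (n ^ c : ℕ)) =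
        (n * (F x⁻¹ \ F (g * x)⁻¹).card) / (n ^ c : ℕ) := by
      rw [← h2'] at hp ⊢
      field_simp
      ring
    rw [e, div_le_iff₀ hp]
    exact h1'
  · have : (F x⁻¹ ∩ F y⁻¹).Nonempty := by
      rw [← Finset.card_pos, Nat.pos_iff_ne_zero]
      intro h0
      exact hk (by simp [h0])
    have := hR _ _ this
    rwa [inv_inv, ← cs.length_inv, mul_inv_rev, inv_inv] at this

/-- An operator in the closure of the operators of finite propagation is compact as soon as its
matrix coefficients along each diagonal `{(x, gx)}` tend to zero. -/
theorem isCompactOperator_of_tendsto_coeff (cs : CoxeterSystem M W) {T : L2 W →L[ℂ] L2 W}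
    (hT : T ∈ (finitePropagation W).topologicalClosure)
    (h : ∀ g, Tendsto (fun x => T (delta x) (g * x)) cofinite (𝓝 0)) : IsCompactOperator T := by
  have hcl : IsClosed {T : L2 W →L[ℂ] L2 W | IsCompactOperator T} :=
    isClosed_setOfPred_isCompactOperator
  refine hcl.closure_subset (Metric.mem_closure_iff.2 fun ε hε => ?_)
  rw [← SetLike.mem_coe, StarSubalgebra.topologicalClosure_coe, Metric.mem_closure_iff] at hT
  obtain ⟨T₀, ⟨G, hG, hGT⟩, hT₀⟩ := hT (ε / 3) (by positivity)
  rw [dist_eq_norm] at hT₀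
  -- `L` bounds the propagation of `T₀`
  obtain ⟨L, hL⟩ : ∃ L, ∀ g ∈ hG.toFinset, cs.length g ≤ L :=
    ⟨_, fun g hg => Finset.le_sup (f := cs.length) hg⟩
  obtain ⟨n, hn⟩ := exists_nat_gt (3 * (hG.toFinset.card * (L * ‖T₀‖)) / ε)
  obtain ⟨m, k, hsub, hnorm, hcoeff, hk, hkn, R, hR⟩ :=
    exists_schur_approximation cs (n + 1) n.succ_pos
  refine ⟨m T, ?_, ?_⟩
  · refine PropagationIn.isCompactOperator (finite_ball cs R) (fun x y hxy => ?_) fun g => ?_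
    · rw [hcoeff] at hxy
      exact hR x y fun h0 => hxy (by rw [h0]; simp)
    · refine squeeze_zero_norm (fun x => ?_) (tendsto_zero_iff_norm_tendsto_zero.1 (h g))
      rw [hcoeff, norm_mul, Complex.norm_real, Real.norm_of_nonneg (hk _ _).1]
      exact mul_le_of_le_one_left (norm_nonneg _) (hk _ _).2
  · have hn0 : (0 : ℝ) < ((n + 1 : ℕ) : ℝ) := by positivity
    have h1 : ‖T₀ - m T₀‖ ≤ hG.toFinset.card * (L * ‖T₀‖ / ((n + 1 : ℕ) : ℝ)) := by
      have hd : ∀ x y, (T₀ - m T₀) (delta x) y = ((1 - k x y : ℝ) : ℂ) * T₀ (delta x) y := by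
        intro x y
        rw [sub_apply, lp.coeFn_sub, Pi.sub_apply, hcoeff]
        push_cast
        ring
      refine PropagationIn.norm_le (fun x y hxy => ?_) fun g x => ?_
      · rw [hd] at hxy
        rw [hG.coe_toFinset]
        exact hGT x y (right_ne_zero_of_mul hxy)
      · rw [hd]
        by_cases hz : T₀ (delta x) (g * x) = 0
        · rw [hz, mul_zero, norm_zero]; positivity
        · have hg : g ∈ hG.toFinset := by
            rw [hG.mem_toFinset]
            simpa using hGT x _ hz
          have h2 : 1 - k x (g * x) ≤ L / ((n + 1 : ℕ) : ℝ) := by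
            rw [le_div_iff₀ hn0, mul_comm]
            exact (hkn g x).trans (by exact_mod_cast hL g hg)
          rw [norm_mul, Complex.norm_real, Real.norm_of_nonneg (by linarith [(hk x (g * x)).2]),
            mul_div_right_comm]
          exact mul_le_mul h2 (norm_coeff_le _ _ _) (norm_nonneg _) (by positivity)
    have h2 : hG.toFinset.card * (L * ‖T₀‖ / ((n + 1 : ℕ) : ℝ)) < ε / 3 := by
      rw [← mul_div_assoc, div_lt_iff₀ hn0]
      rw [div_lt_iff₀ hε] at hn
      push_cast
      linarith
    have h3 : ‖m T₀ - m T‖ < ε / 3 := by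
      rw [← hsub]
      refine (hnorm _).trans_lt ?_
      rwa [norm_sub_rev]
    rw [dist_eq_norm, show T - m T = (T - T₀) + (T₀ - m T₀) + (m T₀ - m T) by abel]
    calc _ ≤ ‖T - T₀‖ + ‖T₀ - m T₀‖ + ‖m T₀ - m T‖ := norm_add₃_le
      _ < ε := by linarith

end CompactnessCriterion

/-! ### Strong convergence and compactness on the canonical basis -/

section StrongConvergence

/-- A uniformly bounded sequence of operators on `ℓ²` which converges on the canonical basis
converges strongly. -/
lemma tendsto_apply_of_tendsto_delta {ι F : Type*} [NormedAddCommGroup F] [NormedSpace ℂ F]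
    {A : ℕ → L2 ι →L[ℂ] F} {S : L2 ι →L[ℂ] F} {C : ℝ} (hA : ∀ n, ‖A n‖ ≤ C)
    (h : ∀ i, Tendsto (fun n => A n (delta i)) atTop (𝓝 (S (delta i)))) (ξ : L2 ι) :
    Tendsto (fun n => A n ξ) atTop (𝓝 (S ξ)) := by
  have hC : 0 ≤ C := (norm_nonneg _).trans (hA 0)
  have hspan : ∀ η ∈ Submodule.span ℂ (Set.range (delta (ι := ι))),
      Tendsto (fun n => A n η) atTop (𝓝 (S η)) := by
    intro η hη
    induction hη using Submodule.span_induction with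
    | mem x hx => obtain ⟨i, rfl⟩ := hx; exact h i
    | zero => simp
    | add x y _ _ hx hy => simpa only [map_add] using hx.add hy
    | smul c x _ hx => simpa only [map_smul] using hx.const_smul c
  rw [Metric.tendsto_atTop]
  intro ε hε
  have hD : 0 < C + ‖S‖ + 1 := by positivity
  have hmem : ξ ∈ (Submodule.span ℂ (Set.range (delta (ι := ι)))).topologicalClosure := by
    rw [span_delta_dense]; trivial
  rw [← SetLike.mem_coe, Submodule.topologicalClosure_coe, Metric.mem_closure_iff] at hmem
  obtain ⟨η, hη, hd⟩ := hmem (ε / 2 / (C + ‖S‖ + 1)) (by positivity)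
  rw [dist_eq_norm, lt_div_iff₀ hD] at hd
  obtain ⟨N, hN⟩ := Metric.tendsto_atTop.1 (hspan η hη) (ε / 2) (half_pos hε)
  refine ⟨N, fun n hn => ?_⟩
  have h1 := hN n hn
  rw [dist_eq_norm] at h1 ⊢
  have h2 : ‖A n (ξ - η)‖ ≤ C * ‖ξ - η‖ := (A n).le_of_opNorm_le (hA n) _
  have h3 : ‖S (ξ - η)‖ ≤ ‖S‖ * ‖ξ - η‖ := S.le_opNorm _
  have e : A n ξ - S ξ = A n (ξ - η) + (A n η - S η) - S (ξ - η) := by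
    rw [map_sub, map_sub]; abel
  rw [e]
  have h4 := norm_sub_le (A n (ξ - η) + (A n η - S η)) (S (ξ - η))
  have h5 := norm_add_le (A n (ξ - η)) (A n η - S η)
  nlinarith [norm_nonneg (ξ - η)]

lemma continuous_coord {ι : Type*} (j : ι) : Continuous fun ξ : L2 ι => ξ j := by
  have : (fun ξ : L2 ι => ξ j) = fun ξ => inner ℂ (delta j) ξ := by
    funext ξ; rw [inner_delta_left]
  rw [this]
  fun_prop

/-- Compact operators turn the weak convergence of the canonical basis to `0` into norm
convergence. -/
lemma tendsto_delta_of_isCompactOperator {ι : Type*} {T : L2 ι →L[ℂ] L2 ι}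
    (hT : IsCompactOperator T) :
    Tendsto (fun i => T (delta i)) cofinite (𝓝 0) := by
  have hK := hT.isCompact_closure_image_closedBall (𝕜₁ := ℂ) 1
  refine hK.tendsto_nhds_of_unique_mapClusterPt (Eventually.of_forall fun i =>
    subset_closure ⟨delta i, by simp [norm_delta], rfl⟩) fun ξ _ hξ => l2_ext fun j => ?_
  have h1 : MapClusterPt (ξ j) cofinite (fun i => T (delta i) j) :=
    hξ.continuousAt_comp (continuous_coord j).continuousAt
  have h2 : Tendsto (fun i => T (delta i) j) cofinite (𝓝 0) := by
    have h3 := (l2_summable (star T (delta j))).tendsto_cofinite_zero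
    rw [tendsto_zero_iff_norm_tendsto_zero]
    have h4 := h3.rpow_const (p := 1 / 2) (Or.inr (by norm_num))
    rw [Real.zero_rpow (by norm_num)] at h4
    refine h4.congr fun i => ?_
    rw [star_apply_coeff, RCLike.norm_conj, ← Real.rpow_mul (norm_nonneg _)]
    norm_num
  have h5 : (𝓝 (ξ j) ⊓ 𝓝 0).NeBot := NeBot.mono h1 (inf_le_inf_left _ h2)
  exact eq_of_nhds_neBot h5

end StrongConvergence

/-! ### Sequences converging to the boundary -/

section BoundarySequences

variable {B W : Type*} [Finite B] [Group W] {M : CoxeterMatrix B} {cs : CoxeterSystem M W}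

omit [Finite B] in
lemma length_tendsto_of_boundary {x : ℕ → W} (hx : OConverges (cayley cs) 1 x)
    (hb : Bordification.mk x hx ∈ graphBoundary (cayley cs) 1) :
    Tendsto (fun n => cs.length (x n)) atTop atTop := by
  refine tendsto_atTop.2 fun N => ?_
  obtain ⟨v, hv, hN⟩ := hb N
  rw [Bordification.above_mk] at hv
  rw [cayley_dist, inv_one, one_mul] at hN
  filter_upwards [hv] with n hn
  exact hN.trans (graphLE_cayley.1 hn).length_le

omit [Finite B] in
/-- A sequence which converges to a boundary point leaves every finite set. -/
lemma tendsto_cofinite_of_boundary {x : ℕ → W} (hx : OConverges (cayley cs) 1 x)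
    (hb : Bordification.mk x hx ∈ graphBoundary (cayley cs) 1) :
    Tendsto x atTop cofinite := by
  refine le_cofinite_iff_eventually_ne.2 fun y => ?_
  have := (length_tendsto_of_boundary hx hb).eventually_gt_atTop (cs.length y)
  exact this.mono fun n hn h => by
    change x n = y at h
    rw [h] at hn; exact lt_irrefl _ hn

/-- Every infinite subset of `W` accumulates at the boundary. -/
lemma exists_seq_boundary {A : Set W} (hA : A.Infinite) :
    ∃ (x : ℕ → W) (hx : OConverges (cayley cs) 1 x), (∀ n, x n ∈ A) ∧
      Bordification.mk x hx ∈ graphBoundary (cayley cs) 1 := by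
  classical
  have := countable_of_finite cs
  obtain ⟨a⟩ : Nonempty (ℕ ↪ A) := ⟨hA.natEmbedding⟩
  obtain ⟨f, φ, hφ, hf⟩ := CompactSpace.tendsto_subseq
    fun (n : ℕ) (v : W) => decide (WeakLE cs v (a n))
  have hev : ∀ v, ∀ᶠ n in atTop, decide (WeakLE cs v (a (φ n))) = f v := by
    intro v
    have := (tendsto_pi_nhds.1 hf) v
    rw [nhds_discrete, tendsto_pure] at this
    exact this
  have hx : OConverges (cayley cs) 1 fun n => (a (φ n) : W) := by
    intro v
    simp only [graphLE_cayley]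
    cases hfv : f v
    · refine Or.inr ((hev v).mono fun n hn => ?_)
      rw [hfv] at hn; simpa using hn
    · refine Or.inl ((hev v).mono fun n hn => ?_)
      rw [hfv] at hn; simpa using hn
  refine ⟨_, hx, fun n => (a (φ n)).2, fun N => ?_⟩
  have hinj : Function.Injective fun n => (a (φ n) : W) :=
    Subtype.val_injective.comp (a.injective.comp hφ.injective)
  -- some element of the finite sphere of radius `N` lies below the limit
  by_contra! hcon
  have hnot : ∀ v ∈ {v : W | cs.length v = N}, ∀ᶠ n in atTop, ¬ WeakLE cs v (a (φ n)) := by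
    intro v hv
    have h1 : ¬ (Bordification.mk _ hx).Above v := by
      intro h
      have h2 := hcon v h
      rw [cayley_dist, inv_one, one_mul] at h2
      exact h2.ne hv
    filter_upwards [hx.eventually_iff v] with n hn h
    exact h1 (hn.1 (graphLE_cayley.2 h))
  have hall := ((finite_sphere (cs := cs) N).eventually_all).2 hnot
  have hlong : ∀ᶠ n in atTop, ¬ cs.length (a (φ n) : W) ≤ N := by
    have h1 := hinj.tendsto_cofinite
    rw [Nat.cofinite_eq_atTop] at h1
    exact h1.eventually (finite_ball cs N).compl_mem_cofinite
  obtain ⟨n, h1, h2⟩ := (hall.and hlong).exists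
  obtain ⟨u, hu, hun⟩ := exists_weakLE_length_eq (cs := cs) (not_le.1 h2).le
  exact h1 u hun hu

end BoundarySequences

/-! ### Limit operators at the boundary -/

section LimitOperators

variable {B W : Type*} [Group W] {M : CoxeterMatrix B} {cs : CoxeterSystem M W}

/-- A choice of sequences in `W` converging to all the points of the boundary. -/
def IsApproach (σ : Boundary cs → ℕ → W) : Prop :=
  ∀ z, ∃ hx : OConverges (cayley cs) 1 (σ z), Bordification.mk (σ z) hx = z.1

variable (cs) in
lemma exists_isApproach : ∃ σ : Boundary cs → ℕ → W, IsApproach σ := by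
  have : ∀ z : Boundary cs, ∃ x : ℕ → W, ∃ hx : OConverges (cayley cs) 1 x,
      Bordification.mk x hx = z.1 := fun z => z.1.exists_rep
  choose σ hσ using this
  exact ⟨σ, hσ⟩

lemma IsApproach.tendsto_cofinite {σ : Boundary cs → ℕ → W} (hσ : IsApproach σ) (z : Boundary cs) :
    Tendsto (σ z) atTop cofinite := by
  obtain ⟨hx, e⟩ := hσ z
  exact tendsto_cofinite_of_boundary hx (by rw [e]; exact z.2)

lemma IsApproach.eventually_iff {σ : Boundary cs → ℕ → W} (hσ : IsApproach σ) (z : Boundary cs)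
    (h w : W) : ∀ᶠ n in atTop, (WeakLE cs w (h * σ z n) ↔ (h • z).1.Above w) := by
  obtain ⟨hx, e⟩ := hσ z
  have e' : (h • z).1 = h • z.1 := rfl
  rw [e', ← e, smul_mk]
  filter_upwards [(hx.mul_left h).eventually_iff w] with n hn
  rw [← hn, graphLE_cayley]

/-- The permutation `(z, h) ↦ (z, h x_n)`, where `x = σ z` is the chosen sequence converging
to `z`. -/
def translatePerm (σ : Boundary cs → ℕ → W) (n : ℕ) : Equiv.Perm (Boundary cs × W) :=
  Equiv.prodShear (Equiv.refl _) fun z => Equiv.mulRight (σ z n)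

lemma translatePerm_apply (σ : Boundary cs → ℕ → W) (n : ℕ) (p : Boundary cs × W) :
    translatePerm σ n p = (p.1, p.2 * σ p.1 n) := rfl

/-- The direct sum over `z ∈ ∂W` of the operators `R_x⁻¹ T R_x` on `ℓ²(W)`, where `x = σ z n` and
`R_x` is the right translation `δ_h ↦ δ_{hx}`. -/
noncomputable def translate (σ : Boundary cs → ℕ → W) (n : ℕ) (T : L2 W →L[ℂ] L2 W) :
    L2 (Boundary cs × W) →L[ℂ] L2 (Boundary cs × W) :=
  permOp (translatePerm σ n)⁻¹ * ampliation (Boundary cs) T * permOp (translatePerm σ n)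

open Classical in
lemma translate_delta_apply (σ : Boundary cs → ℕ → W) (n : ℕ) (T : L2 W →L[ℂ] L2 W)
    (p r : Boundary cs × W) : translate σ n T (delta p) r =
      if r.1 = p.1 then T (delta (p.2 * σ p.1 n)) (r.2 * σ r.1 n) else 0 := by
  rw [translate, mul_apply_eq_comp, mul_apply_eq_comp, permOp_delta, permOp_apply]
  change ampliation _ T (delta _) (translatePerm σ n r) = _
  rw [ampliation_delta_apply]
  simp only [translatePerm_apply]
  by_cases h : r.1 = p.1 <;> simp [h]

lemma translate_mul (σ : Boundary cs → ℕ → W) (n : ℕ) (S T : L2 W →L[ℂ] L2 W) :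
    translate σ n (S * T) = translate σ n S * translate σ n T := by
  have h : permOp (translatePerm σ n) * permOp (translatePerm σ n)⁻¹ = 1 := by
    rw [← permOp_mul, mul_inv_cancel, permOp_one]
  rw [translate, translate, translate, map_mul]
  simp only [mul_assoc]
  rw [← mul_assoc (permOp (translatePerm σ n)) (permOp (translatePerm σ n)⁻¹), h, one_mul]

lemma translate_add (σ : Boundary cs → ℕ → W) (n : ℕ) (S T : L2 W →L[ℂ] L2 W) :
    translate σ n (S + T) = translate σ n S + translate σ n T := by
  simp only [translate, map_add, mul_add, add_mul]

lemma translate_sub (σ : Boundary cs → ℕ → W) (n : ℕ) (S T : L2 W →L[ℂ] L2 W) :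
    translate σ n (S - T) = translate σ n S - translate σ n T := by
  simp only [translate, map_sub, mul_sub, sub_mul]

lemma translate_algebraMap (σ : Boundary cs → ℕ → W) (n : ℕ) (c : ℂ) :
    translate σ n (algebraMap ℂ _ c) = algebraMap ℂ _ c := by
  rw [translate, AlgHomClass.commutes, ← Algebra.commutes, mul_assoc, permOp_inv_mul_self, mul_one]

lemma norm_translate_apply_le (σ : Boundary cs → ℕ → W) (n : ℕ) (T : L2 W →L[ℂ] L2 W)
    (ξ : L2 (Boundary cs × W)) : ‖translate σ n T ξ‖ ≤ ‖T‖ * ‖ξ‖ := by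
  rw [translate, mul_apply_eq_comp, mul_apply_eq_comp, norm_permOp_apply]
  refine ((ampliation (Boundary cs) T).le_of_opNorm_le (norm_ampliation_le T) _).trans ?_
  rw [norm_permOp_apply]

/-- `S` is the strong limit of the translates of `T` towards the boundary, for every choice of
sequences that converge to the boundary points. -/
def StrongLimit (T : L2 W →L[ℂ] L2 W) (S : L2 (Boundary cs × W) →L[ℂ] L2 (Boundary cs × W)) :
    Prop :=
  ∀ σ : Boundary cs → ℕ → W, IsApproach σ → ∀ ξ,
    Tendsto (fun n => translate σ n T ξ) atTop (𝓝 (S ξ))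

lemma StrongLimit.norm_le {T : L2 W →L[ℂ] L2 W}
    {S : L2 (Boundary cs × W) →L[ℂ] L2 (Boundary cs × W)} (h : StrongLimit T S) : ‖S‖ ≤ ‖T‖ := by
  obtain ⟨σ, hσ⟩ := exists_isApproach cs
  exact S.opNorm_le_bound (norm_nonneg _) fun ξ =>
    le_of_tendsto (h σ hσ ξ).norm (Eventually.of_forall fun n => norm_translate_apply_le σ n T ξ)

lemma StrongLimit.add {T T' : L2 W →L[ℂ] L2 W}
    {S S' : L2 (Boundary cs × W) →L[ℂ] L2 (Boundary cs × W)} (h : StrongLimit T S)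
    (h' : StrongLimit T' S') : StrongLimit (T + T') (S + S') := fun σ hσ ξ => by
  simpa only [translate_add, add_apply] using (h σ hσ ξ).add (h' σ hσ ξ)

lemma StrongLimit.sub {T T' : L2 W →L[ℂ] L2 W}
    {S S' : L2 (Boundary cs × W) →L[ℂ] L2 (Boundary cs × W)} (h : StrongLimit T S)
    (h' : StrongLimit T' S') : StrongLimit (T - T') (S - S') := fun σ hσ ξ => by
  simpa only [translate_sub, sub_apply] using (h σ hσ ξ).sub (h' σ hσ ξ)

lemma StrongLimit.mul {T T' : L2 W →L[ℂ] L2 W}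
    {S S' : L2 (Boundary cs × W) →L[ℂ] L2 (Boundary cs × W)} (h : StrongLimit T S)
    (h' : StrongLimit T' S') : StrongLimit (T * T') (S * S') := fun σ hσ ξ => by
  have h1 : Tendsto (fun n => translate σ n T (translate σ n T' ξ - S' ξ)) atTop (𝓝 0) := by
    refine squeeze_zero_norm (fun n => norm_translate_apply_le σ n T _) ?_
    have := (tendsto_iff_norm_sub_tendsto_zero.1 (h' σ hσ ξ)).const_mul ‖T‖
    rwa [mul_zero] at this
  have h2 := h1.add (h σ hσ (S' ξ))
  rw [zero_add] at h2
  refine h2.congr fun n => ?_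
  rw [map_sub, sub_add_cancel, translate_mul]
  rfl

lemma strongLimit_algebraMap (c : ℂ) :
    StrongLimit (cs := cs) (algebraMap ℂ _ c) (algebraMap ℂ _ c) := fun σ _ ξ => by
  simp only [translate_algebraMap]
  exact tendsto_const_nhds

/-- Strong limits depend continuously on the operator. -/
lemma StrongLimit.of_approx {T : L2 W →L[ℂ] L2 W}
    {S : L2 (Boundary cs × W) →L[ℂ] L2 (Boundary cs × W)}
    (h : ∀ ε > 0, ∃ T' S', StrongLimit (cs := cs) T' S' ∧ ‖T - T'‖ < ε ∧ ‖S - S'‖ < ε) :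
    StrongLimit T S := fun σ hσ ξ => by
  rw [Metric.tendsto_atTop]
  intro ε hε
  have hD : 0 < ‖ξ‖ + 1 := by positivity
  obtain ⟨T', S', hTS, h1, h2⟩ := h (ε / 3 / (‖ξ‖ + 1)) (by positivity)
  rw [lt_div_iff₀ hD] at h1 h2
  obtain ⟨N, hN⟩ := Metric.tendsto_atTop.1 (hTS σ hσ ξ) (ε / 3) (by positivity)
  refine ⟨N, fun n hn => ?_⟩
  have h3 := hN n hn
  rw [dist_eq_norm] at h3 ⊢
  have e : translate σ n T ξ - S ξ = translate σ n (T - T') ξ + (translate σ n T' ξ - S' ξ) -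
      (S - S') ξ := by
    rw [translate_sub, sub_apply, sub_apply]; abel
  rw [e]
  have h4 := norm_sub_le (translate σ n (T - T') ξ + (translate σ n T' ξ - S' ξ)) ((S - S') ξ)
  have h5 := norm_add_le (translate σ n (T - T') ξ) (translate σ n T' ξ - S' ξ)
  have h6 := norm_translate_apply_le σ n (T - T') ξ
  have h7 := (S - S').le_opNorm ξ
  nlinarith [norm_nonneg (T - T'), norm_nonneg (S - S')]

lemma StrongLimit.coeff_tendsto {T : L2 W →L[ℂ] L2 W}
    {S : L2 (Boundary cs × W) →L[ℂ] L2 (Boundary cs × W)} (h : StrongLimit T S)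
    {σ : Boundary cs → ℕ → W} (hσ : IsApproach σ) (p r : Boundary cs × W) :
    Tendsto (fun n => translate σ n T (delta p) r) atTop (𝓝 (S (delta p) r)) :=
  ((continuous_coord r).tendsto _).comp (h σ hσ (delta p))

lemma StrongLimit.unique {T : L2 W →L[ℂ] L2 W}
    {S S' : L2 (Boundary cs × W) →L[ℂ] L2 (Boundary cs × W)} (h : StrongLimit T S)
    (h' : StrongLimit T S') : S = S' := by
  have h1 := (h.sub h').norm_le
  rw [sub_self, norm_zero] at h1
  exact sub_eq_zero.1 (norm_le_zero_iff.1 h1)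

/-- Compact operators vanish at the boundary. -/
lemma StrongLimit.eq_zero_of_isCompactOperator {T : L2 W →L[ℂ] L2 W}
    {S : L2 (Boundary cs × W) →L[ℂ] L2 (Boundary cs × W)} (h : StrongLimit T S)
    (hT : IsCompactOperator T) : S = 0 := by
  classical
  obtain ⟨σ, hσ⟩ := exists_isApproach cs
  refine clm_ext_coeff fun p r => ?_
  refine tendsto_nhds_unique (h.coeff_tendsto hσ p r) ?_
  have h1 : Tendsto (fun n => T (delta (p.2 * σ p.1 n))) atTop (𝓝 0) :=
    ((tendsto_delta_of_isCompactOperator hT).comp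
      (mul_right_injective p.2).tendsto_cofinite).comp (hσ.tendsto_cofinite p.1)
  refine squeeze_zero_norm (fun n => ?_) (tendsto_zero_iff_norm_tendsto_zero.1 h1)
  rw [translate_delta_apply]
  split_ifs
  · exact lp.norm_apply_le_norm (by norm_num) _ _
  · rw [norm_zero]; exact norm_nonneg _

/-- An operator in the closure of the operators of finite propagation is compact if its translates
tend to zero at the boundary. -/
lemma StrongLimit.isCompactOperator [Finite B] {T : L2 W →L[ℂ] L2 W} (h : StrongLimit (cs := cs) T 0)
    (hT : T ∈ (finitePropagation W).topologicalClosure) : IsCompactOperator T := by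
  classical
  -- otherwise some diagonal `{(x, gx)}` has large coefficients along a sequence tending to `z ∈ ∂W`
  refine isCompactOperator_of_tendsto_coeff cs hT fun g => ?_
  rw [tendsto_zero_iff_norm_tendsto_zero]
  by_contra hcon
  obtain ⟨ε, hε, hinf⟩ : ∃ ε > 0, {x | ε ≤ ‖T (delta x) (g * x)‖}.Infinite := by
    by_contra! hfin
    refine hcon (tendsto_order.2 ⟨fun a ha => Eventually.of_forall fun x =>
      ha.trans_le (norm_nonneg _), fun a ha => ?_⟩)
    filter_upwards [(hfin a ha).compl_mem_cofinite] with x hx using not_le.1 hx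
  obtain ⟨x, hx, hxA, hb⟩ := exists_seq_boundary (cs := cs) hinf
  set z : Boundary cs := ⟨_, hb⟩ with hz
  obtain ⟨σ₀, hσ₀⟩ := exists_isApproach cs
  have hσ : IsApproach (Function.update σ₀ z x) := by
    intro z'
    by_cases h' : z' = z
    · subst h'; rw [Function.update_self]; exact ⟨hx, rfl⟩
    · rw [Function.update_of_ne h']; exact hσ₀ z'
  have h1 := h.coeff_tendsto hσ (z, 1) (z, g)
  simp only [translate_delta_apply, if_true, Function.update_self, one_mul] at h1
  have h2 := h1.norm
  have h3 := ge_of_tendsto h2 (Eventually.of_forall hxA)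
  exact hε.not_ge (h3.trans (by simp))

end LimitOperators

/-! ### Images and kernels of `*`-homomorphisms of C⋆-algebras -/

section CStarHom

/-- Every element of the image of a `*`-homomorphism of C⋆-algebras has a preimage of no larger
norm, obtained by cutting off the modulus of any preimage with the functional calculus. -/
lemma exists_eq_norm_le {A B : Type*} [CStarAlgebra A] [CStarAlgebra B] (φ : A →⋆ₐ[ℂ] B) (a : A) :
    ∃ a', φ a' = φ a ∧ ‖a'‖ ≤ ‖φ a‖ := by
  have hφc : Continuous φ := AddMonoidHomClass.continuous_of_bound φ 1 fun a => by
    simpa using NonUnitalStarAlgHom.norm_apply_le φ a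
  rcases (norm_nonneg (φ a)).eq_or_lt with h0 | hr
  · exact ⟨0, by rw [map_zero, norm_eq_zero.1 h0.symm], by simp⟩
  have : Nontrivial B := ⟨φ a, 0, norm_pos_iff.1 hr⟩
  set r := ‖φ a‖ with hrdef
  -- `g(x) = 1` on the spectrum of `φ(a)* φ(a)`, and `x g(x)² ≤ r²`
  set g : ℝ → ℝ := fun x => r / √(max x (r ^ 2)) with hg
  have hpos : ∀ x, 0 < √(max x (r ^ 2)) := fun x =>
    Real.sqrt_pos.2 (lt_max_of_lt_right (by positivity))
  have hgc : Continuous g := by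
    refine continuous_const.div (by fun_prop) fun x => (hpos x).ne'
  have hsa : IsSelfAdjoint (star a * a) := IsSelfAdjoint.star_mul_self a
  have hgs : IsSelfAdjoint (cfc g (star a * a)) := cfc_predicate g _
  refine ⟨a * cfc g (star a * a), ?_, ?_⟩
  · have h1 : φ (cfc g (star a * a)) = cfc g (star (φ a) * φ a) := by
      have := StarAlgHom.map_cfc (R := ℝ) (S := ℂ) φ g (star a * a) hgc.continuousOn
        hφc hsa (hsa.map φ)
      rw [this, map_mul, map_star]
    rw [map_mul, h1]
    have h2 : cfc g (star (φ a) * φ a) = 1 := by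
      rw [← cfc_one ℝ (star (φ a) * φ a)]
      refine cfc_congr fun x hx => ?_
      have h3 : ‖x‖ ≤ ‖star (φ a) * φ a‖ := spectrum.norm_le_norm_of_mem hx
      rw [CStarRing.norm_star_mul_self, ← hrdef, ← sq] at h3
      have h4 : x ≤ r ^ 2 := (le_abs_self x).trans h3
      simp only [hg, max_eq_right h4, Real.sqrt_sq hr.le, Pi.one_apply]
      exact div_self hr.ne'
    rw [h2, mul_one]
  · refine abs_le_of_sq_le_sq' ?_ hr.le |>.2
    rw [sq, ← CStarRing.norm_star_mul_self, star_mul, hgs.star_eq]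
    have e : cfc g (star a * a) * star a * (a * cfc g (star a * a)) =
        cfc (fun x => g x * (x * g x)) (star a * a) := by
      rw [cfc_mul g (fun x => x * g x) _ hgc.continuousOn (by fun_prop),
        cfc_mul (fun x => x) g _ (by fun_prop) hgc.continuousOn, cfc_id' ℝ (star a * a)]
      simp only [mul_assoc]
    rw [e]
    refine norm_cfc_le (by positivity) fun x hx => ?_
    have hx0 : 0 ≤ x := spectrum_star_mul_self_nonneg x hx
    have h5 : √(max x (r ^ 2)) ^ 2 = max x (r ^ 2) := Real.sq_sqrt (hx0.trans (le_max_left _ _))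
    have h6 : g x * (x * g x) = r ^ 2 * (x / max x (r ^ 2)) := by
      rw [← h5]; simp only [hg]; field_simp
    have h7 : x / max x (r ^ 2) ≤ 1 :=
      div_le_one_of_le₀ (le_max_left _ _) (hx0.trans (le_max_left _ _))
    have h8 : 0 ≤ x / max x (r ^ 2) := div_nonneg hx0 (hx0.trans (le_max_left _ _))
    rw [h6, Real.norm_of_nonneg (by positivity)]
    nlinarith [sq_nonneg r]

/-- The image of a `*`-homomorphism of C⋆-algebras is closed. -/
lemma isClosed_range_starAlgHom {A B : Type*} [CStarAlgebra A] [CStarAlgebra B]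
    (φ : A →⋆ₐ[ℂ] B) : IsClosed (φ.range : Set B) := by
  let f : NormedAddGroupHom A B := AddMonoidHom.mkNormedAddGroupHom
    (φ : A →+ B) 1 fun a => by simpa using NonUnitalStarAlgHom.norm_apply_le φ a
  have hf : f.SurjectiveOnWith φ.range.toSubalgebra.toSubmodule.toAddSubgroup 1 := by
    rintro _ ⟨a, rfl⟩
    obtain ⟨a', h1, h2⟩ := exists_eq_norm_le φ a
    exact ⟨a', h1, by simpa using h2⟩
  have hf' := controlled_closure_of_complete one_pos one_pos hf
  refine isClosed_of_closure_subset fun b hb => ?_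
  obtain ⟨a, ha, -⟩ := hf' b hb
  exact ⟨a, ha⟩

/-- Two surjective `*`-homomorphisms with the same kernel have isomorphic targets. -/
lemma exists_starAlgEquiv_of_ker_eq {A C D : Type*} [Ring A] [StarRing A] [Algebra ℂ A]
    [Ring C] [StarRing C] [Algebra ℂ C] [Ring D] [StarRing D] [Algebra ℂ D] (p : A →⋆ₐ[ℂ] C)
    (φ : A →⋆ₐ[ℂ] D) (hp : Function.Surjective p) (hφ : Function.Surjective φ)
    (h : ∀ a, p a = 0 ↔ φ a = 0) : ∃ κ : C ≃⋆ₐ[ℂ] D, ∀ a, κ (p a) = φ a := by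
  have key : ∀ a b, p a = p b ↔ φ a = φ b := fun a b => by
    rw [← sub_eq_zero, ← map_sub, h, map_sub, sub_eq_zero]
  obtain ⟨s, hs⟩ := hp.hasRightInverse
  have hsp : ∀ a, φ (s (p a)) = φ a := fun a => (key _ _).1 (hs (p a))
  let ψ : C →⋆ₐ[ℂ] D :=
    { toFun := fun c => φ (s c)
      map_one' := by rw [← map_one p, hsp, map_one]
      map_mul' := fun c d => by
        rw [← map_mul, ← key, map_mul, hs, hs, hs]
      map_zero' := by rw [← map_zero p, hsp, map_zero]
      map_add' := fun c d => by
        rw [← map_add, ← key, map_add, hs, hs, hs]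
      commutes' := fun c => by
        rw [← AlgHomClass.commutes p, hsp, AlgHomClass.commutes]
      map_star' := fun c => by
        rw [← map_star, ← key, map_star, hs, hs] }
  refine ⟨StarAlgEquiv.ofBijective ψ ⟨fun c d hcd => ?_, fun d => ?_⟩, hsp⟩
  · have := (key _ _).2 hcd
    rwa [hs, hs] at this
  · obtain ⟨a, rfl⟩ := hφ d
    exact ⟨p a, hsp a⟩

end CStarHom

/-! ### The representation of `C(X)` in the crossed product -/

section CrossedCoefficients

variable {G X : Type*} [Group G] [TopologicalSpace X] [CompactSpace X] [MulAction G X]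

lemma crossedCoeff_delta (f : C(X, ℂ)) (p : X × G) :
    crossedCoeff G f (delta p) = f (p.2 • p.1) • delta p :=
  diagOp_delta _ _ _ _

lemma star_crossedCoeff (f : C(X, ℂ)) : star (crossedCoeff G f) = crossedCoeff G (star f) := by
  classical
  refine clm_ext_coeff fun p r => ?_
  rw [star_apply_coeff, crossedCoeff_delta, crossedCoeff_delta, lp.coeFn_smul, lp.coeFn_smul,
    Pi.smul_apply, Pi.smul_apply, delta_apply, delta_apply]
  by_cases h : p = r
  · subst h; simp
  · simp [h, Ne.symm h]

variable (G X) in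
/-- The representation of `C(X)` in the crossed product as a `*`-homomorphism. -/
noncomputable def crossedCoeffHom : C(X, ℂ) →⋆ₐ[ℂ] (L2 (X × G) →L[ℂ] L2 (X × G)) where
  toFun := crossedCoeff G
  map_one' := clm_ext_delta fun p => by
    rw [crossedCoeff_delta, ContinuousMap.one_apply, one_smul]; rfl
  map_mul' f g := clm_ext_delta fun p => by
    rw [mul_apply_eq_comp, crossedCoeff_delta, crossedCoeff_delta, ContinuousLinearMap.map_smul,
      crossedCoeff_delta, smul_smul, ContinuousMap.mul_apply, mul_comm]
  map_zero' := clm_ext_delta fun p => by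
    rw [crossedCoeff_delta, ContinuousMap.zero_apply, zero_smul]; rfl
  map_add' f g := clm_ext_delta fun p => by
    rw [add_apply, crossedCoeff_delta, crossedCoeff_delta, crossedCoeff_delta,
      ContinuousMap.add_apply, add_smul]
  commutes' c := clm_ext_delta fun p => by
    rw [crossedCoeff_delta]; rfl
  map_star' f := (star_crossedCoeff f).symm

lemma continuous_crossedCoeffHom : Continuous (crossedCoeffHom G X) :=
  AddMonoidHomClass.continuous_of_bound _ 1 fun f => by
    rw [one_mul]
    exact norm_diagOp_le (fun p : X × G => f (p.2 • p.1)) ‖f‖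
      (fun _ => f.norm_coe_le_norm _) (norm_nonneg f)

omit [TopologicalSpace X] [CompactSpace X] [MulAction G X] in
lemma star_crossedUnitary (g : G) : star (crossedUnitary X g) = crossedUnitary X g⁻¹ := by
  rw [crossedUnitary, star_permOp, crossedUnitary]
  congr 1
  ext1 p
  rw [Equiv.Perm.inv_eq_iff_eq]
  exact Prod.ext rfl (by simp)

end CrossedCoefficients

/-! ### The limit map from `𝔄(W)` to the crossed product -/

section BoundaryLimit

variable {B W : Type*} [Finite B] [Group W] {M : CoxeterMatrix B} {cs : CoxeterSystem M W}

open Classical in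
omit [Finite B] in
lemma boundaryChar_apply (w : W) (z : Boundary cs) :
    boundaryChar cs w z = if z.1.Above w then 1 else 0 := by
  rw [boundaryChar]
  by_cases h : z.1.Above w
  · rw [if_pos h]; exact Set.indicator_of_mem (s := {z : Boundary cs | z.1.Above w}) h 1
  · rw [if_neg h]; exact Set.indicator_of_notMem (s := {z : Boundary cs | z.1.Above w}) h 1

omit [Finite B] in
lemma strongLimit_leftTranslation (g : W) :
    StrongLimit (cs := cs) (leftTranslation g) (crossedUnitary (Boundary cs) g) := fun σ _ ξ => by
  classical
  have : ∀ n, translate σ n (leftTranslation g) = crossedUnitary (Boundary cs) g := by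
    intro n
    refine clm_ext_coeff fun p r => ?_
    rw [translate_delta_apply, leftTranslation_delta, crossedUnitary, permOp_delta, delta_apply,
      delta_apply]
    by_cases h : r.1 = p.1
    · simp [h, Prod.ext_iff, ← mul_assoc]
    · simp [h, Prod.ext_iff]
  simp only [this]
  exact tendsto_const_nhds

lemma strongLimit_weakProj (w : W) :
    StrongLimit (weakProj cs w) (crossedCoeff W (boundaryChar cs w)) := fun σ hσ ξ => by
  classical
  refine tendsto_apply_of_tendsto_delta (C := ‖weakProj cs w‖) (fun n =>
    ContinuousLinearMap.opNorm_le_bound _ (norm_nonneg _) fun ξ => norm_translate_apply_le σ n _ ξ)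
    (fun p => ?_) ξ
  refine tendsto_const_nhds.congr' ?_
  filter_upwards [hσ.eventually_iff p.1 p.2 w] with n hn
  refine l2_ext fun r => ?_
  rw [crossedCoeff_delta, boundaryChar_apply, translate_delta_apply, weakProj, coordProj_delta,
    lp.coeFn_smul, Pi.smul_apply, delta_apply, Set.mem_ofPred_eq, hn]
  by_cases h : r.1 = p.1
  · split_ifs <;> simp_all [delta_apply, Prod.ext_iff]
  · simp [h, Prod.ext_iff]

/-- `S` is the strong-`*` limit of the translates of `T` towards the boundary. -/
def HasBoundaryLimit (T : L2 W →L[ℂ] L2 W)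
    (S : L2 (Boundary cs × W) →L[ℂ] L2 (Boundary cs × W)) : Prop :=
  StrongLimit T S ∧ StrongLimit (star T) (star S)

omit [Finite B] in
lemma hasBoundaryLimit_leftTranslation (g : W) :
    HasBoundaryLimit (cs := cs) (leftTranslation g) (crossedUnitary (Boundary cs) g) := by
  refine ⟨strongLimit_leftTranslation g, ?_⟩
  have e : (Equiv.mulLeft g)⁻¹ = Equiv.mulLeft g⁻¹ := by
    ext1 x
    rw [Equiv.Perm.inv_eq_iff_eq]
    simp
  rw [star_crossedUnitary, leftTranslation, star_permOp, e]
  exact strongLimit_leftTranslation g⁻¹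

lemma hasBoundaryLimit_weakProj (w : W) :
    HasBoundaryLimit (weakProj cs w) (crossedCoeff W (boundaryChar cs w)) := by
  classical
  have h : star (boundaryChar cs w) = boundaryChar cs w := by
    ext z
    rw [ContinuousMap.star_apply, boundaryChar_apply]
    split_ifs <;> simp
  refine ⟨strongLimit_weakProj w, ?_⟩
  rw [star_crossedCoeff, h, weakProj, star_coordProj]
  exact strongLimit_weakProj w

lemma isClosed_reducedCrossedProduct : IsClosed
    (ReducedCrossedProduct W (Boundary cs) :
      Set (L2 (Boundary cs × W) →L[ℂ] L2 (Boundary cs × W))) :=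
  StarSubalgebra.isClosed_topologicalClosure _

variable (cs) in
/-- The algebra of all operators whose translates converge `*`-strongly towards the boundary to an
element of the crossed product. -/
noncomputable def limitDomain : StarSubalgebra ℂ (L2 W →L[ℂ] L2 W) where
  carrier := {T | ∃ S ∈ ReducedCrossedProduct W (Boundary cs), HasBoundaryLimit T S}
  mul_mem' := by
    rintro T T' ⟨S, hS, h⟩ ⟨S', hS', h'⟩
    refine ⟨S * S', mul_mem hS hS', h.1.mul h'.1, ?_⟩
    rw [star_mul, star_mul]
    exact h'.2.mul h.2
  add_mem' := by
    rintro T T' ⟨S, hS, h⟩ ⟨S', hS', h'⟩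
    refine ⟨S + S', add_mem hS hS', h.1.add h'.1, ?_⟩
    rw [star_add, star_add]
    exact h.2.add h'.2
  algebraMap_mem' c := by
    refine ⟨algebraMap ℂ _ c, algebraMap_mem _ c, strongLimit_algebraMap c, ?_⟩
    rw [← algebraMap_star_comm, ← algebraMap_star_comm]
    exact strongLimit_algebraMap _
  star_mem' := by
    rintro T ⟨S, hS, h⟩
    refine ⟨star S, star_mem hS, h.2, ?_⟩
    rw [star_star, star_star]
    exact h.1

lemma isClosed_limitDomain : IsClosed (limitDomain cs : Set (L2 W →L[ℂ] L2 W)) := by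
  refine isClosed_of_closure_subset fun T hT => ?_
  obtain ⟨T', hT', hlim⟩ := mem_closure_iff_seq_limit.1 hT
  choose S' hS' h using hT'
  have hC : CauchySeq S' := by
    rw [Metric.cauchySeq_iff]
    intro ε hε
    obtain ⟨N, hN⟩ := Metric.cauchySeq_iff.1 hlim.cauchySeq ε hε
    refine ⟨N, fun m hm n hn => lt_of_le_of_lt ?_ (hN m hm n hn)⟩
    rw [dist_eq_norm, dist_eq_norm]
    exact ((h m).1.sub (h n).1).norm_le
  obtain ⟨S, hS⟩ := cauchySeq_tendsto_of_complete hC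
  have key : ∀ ε > 0, ∃ n, ‖T - T' n‖ < ε ∧ ‖S - S' n‖ < ε := by
    intro ε hε
    obtain ⟨n, h1, h2⟩ := ((Metric.tendsto_nhds.1 hlim ε hε).and
      (Metric.tendsto_nhds.1 hS ε hε)).exists
    refine ⟨n, ?_, ?_⟩
    · rwa [norm_sub_rev, ← dist_eq_norm]
    · rwa [norm_sub_rev, ← dist_eq_norm]
  refine ⟨S, isClosed_reducedCrossedProduct.mem_of_tendsto hS (Eventually.of_forall hS'),
    StrongLimit.of_approx fun ε hε => ?_, StrongLimit.of_approx fun ε hε => ?_⟩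
  · obtain ⟨n, h1, h2⟩ := key ε hε
    exact ⟨_, _, (h n).1, h1, h2⟩
  · obtain ⟨n, h1, h2⟩ := key ε hε
    refine ⟨_, _, (h n).2, ?_, ?_⟩
    · rwa [← star_sub, norm_star]
    · rwa [← star_sub, norm_star]

lemma allHecke_le_limitDomain : allHecke cs ≤ limitDomain cs :=
  allHecke_le cs isClosed_limitDomain
    (fun w => ⟨_, (ReducedCrossedProduct.unitary w).2, hasBoundaryLimit_leftTranslation w⟩)
    (fun w => ⟨_, (ReducedCrossedProduct.coeff (boundaryChar cs w)).2, hasBoundaryLimit_weakProj w⟩)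

variable (cs) in
/-- Taking strong limits at the boundary is a `*`-homomorphism from `𝔄(W)` to the crossed product,
since these limits are unique. -/
lemma exists_limitMap : ∃ Φ : allHecke cs →⋆ₐ[ℂ] ReducedCrossedProduct W (Boundary cs),
    ∀ T : allHecke cs, StrongLimit (T : L2 W →L[ℂ] L2 W) (Φ T : L2 (Boundary cs × W) →L[ℂ] _) := by
  have hex : ∀ T : allHecke cs, ∃ S : ReducedCrossedProduct W (Boundary cs),
      HasBoundaryLimit (T : L2 W →L[ℂ] L2 W) (S : L2 (Boundary cs × W) →L[ℂ] _) := fun T => by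
    obtain ⟨S, hS, h⟩ := allHecke_le_limitDomain T.2
    exact ⟨⟨S, hS⟩, h⟩
  choose Φ hΦ using hex
  have huniq : ∀ (T : allHecke cs) (S : ReducedCrossedProduct W (Boundary cs)),
      StrongLimit (T : L2 W →L[ℂ] L2 W) (S : L2 (Boundary cs × W) →L[ℂ] _) → Φ T = S :=
    fun T S h => Subtype.ext ((hΦ T).1.unique h)
  refine ⟨{ toFun := Φ
            map_one' := ?_
            map_mul' := ?_
            map_zero' := ?_
            map_add' := ?_
            commutes' := ?_
            map_star' := ?_ }, fun T => (hΦ T).1⟩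
  · refine huniq _ _ ?_
    have := strongLimit_algebraMap (cs := cs) 1
    rw [map_one, map_one] at this
    exact this
  · exact fun T T' => huniq _ _ ((hΦ T).1.mul (hΦ T').1)
  · refine huniq _ _ ?_
    have := strongLimit_algebraMap (cs := cs) 0
    rw [map_zero, map_zero] at this
    exact this
  · exact fun T T' => huniq _ _ ((hΦ T).1.add (hΦ T').1)
  · exact fun c => huniq _ _ (strongLimit_algebraMap c)
  · exact fun T => huniq _ _ (hΦ T).2

end BoundaryLimit

/-! ### Surjectivity of the limit map -/

section Surjectivity

variable {B W : Type*} [Finite B] [Group W] {M : CoxeterMatrix B} {cs : CoxeterSystem M W}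

variable (cs) in
/-- By the Stone–Weierstrass theorem, the characteristic functions `χ_w` generate `C(∂W)`. -/
lemma closure_adjoin_boundaryChar :
    (StarAlgebra.adjoin ℂ (Set.range (boundaryChar cs))).topologicalClosure = ⊤ := by
  classical
  refine ContinuousMap.starSubalgebra_topologicalClosure_eq_top_of_separatesPoints _ ?_
  intro z z' hne
  obtain ⟨w, hw⟩ : ∃ w, ¬ (z.1.Above w ↔ z'.1.Above w) := by
    by_contra! h
    exact hne (Subtype.ext (Bordification.ext_above h))
  refine ⟨_, ⟨boundaryChar cs w, StarAlgebra.subset_adjoin ℂ _ ⟨w, rfl⟩, rfl⟩, ?_⟩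
  change boundaryChar cs w z ≠ boundaryChar cs w z'
  rw [boundaryChar_apply, boundaryChar_apply]
  by_cases h1 : z.1.Above w <;> by_cases h2 : z'.1.Above w <;> simp_all

lemma reducedCrossedProduct_le {R : StarSubalgebra ℂ (L2 (Boundary cs × W) →L[ℂ] _)}
    (hR : IsClosed (R : Set (L2 (Boundary cs × W) →L[ℂ] L2 (Boundary cs × W))))
    (hu : ∀ g, crossedUnitary (Boundary cs) g ∈ R)
    (hc : ∀ w, crossedCoeff W (boundaryChar cs w) ∈ R) :
    ReducedCrossedProduct W (Boundary cs) ≤ R := by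
  refine StarSubalgebra.topologicalClosure_minimal (StarAlgebra.adjoin_le ?_) hR
  refine Set.union_subset ?_ ?_
  · rintro _ ⟨f, rfl⟩
    have hle : (StarAlgebra.adjoin ℂ (Set.range (boundaryChar cs))).topologicalClosure ≤
        R.comap (crossedCoeffHom W (Boundary cs)) := by
      refine StarSubalgebra.topologicalClosure_minimal (StarAlgebra.adjoin_le ?_)
        (hR.preimage continuous_crossedCoeffHom)
      rintro _ ⟨w, rfl⟩
      exact hc w
    rw [closure_adjoin_boundaryChar] at hle
    exact hle (StarSubalgebra.mem_top (x := f))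
  · rintro _ ⟨g, rfl⟩
    exact hu g

/-- The image of the limit map is closed and contains the generators of the crossed product. -/
lemma surjective_of_strongLimit {Φ : allHecke cs →⋆ₐ[ℂ] ReducedCrossedProduct W (Boundary cs)}
    (hΦ : ∀ T : allHecke cs, StrongLimit (T : L2 W →L[ℂ] L2 W) (Φ T : L2 (Boundary cs × W) →L[ℂ] _)) :
    Function.Surjective Φ := by
  have hA : IsClosed (allHecke cs : Set (L2 W →L[ℂ] L2 W)) :=
    StarSubalgebra.isClosed_topologicalClosure _
  let Ψ := (ReducedCrossedProduct W (Boundary cs)).subtype.comp Φ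
  have hR : IsClosed (Ψ.range : Set (L2 (Boundary cs × W) →L[ℂ] L2 (Boundary cs × W))) :=
    isClosed_range_starAlgHom Ψ
  have hle : ReducedCrossedProduct W (Boundary cs) ≤ Ψ.range := by
    refine reducedCrossedProduct_le hR (fun g => ?_) fun w => ?_
    · exact ⟨⟨_, leftTranslation_mem g⟩, (hΦ _).unique (strongLimit_leftTranslation g)⟩
    · exact ⟨⟨_, weakProj_mem w⟩, (hΦ _).unique (strongLimit_weakProj w)⟩
  intro S
  obtain ⟨T, hT⟩ := hle S.2
  exact ⟨T, Subtype.ext hT⟩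

end Surjectivity

/-! ### The image in the Calkin algebra -/

section CalkinQuotient

variable {B W : Type*} [Group W] {M : CoxeterMatrix B} {cs : CoxeterSystem M W}

lemma coe_heckePi (T : allHecke cs) : (heckePi cs T : Calkin (L2 W)) = calkinMap (L2 W) T := rfl

lemma heckePi_eq_zero_iff (T : allHecke cs) :
    heckePi cs T = 0 ↔ IsCompactOperator (T : L2 W →L[ℂ] L2 W) := by
  rw [← calkinMap_eq_zero_iff, ← coe_heckePi, ZeroMemClass.coe_eq_zero]

lemma surjective_heckePi : Function.Surjective (heckePi cs) := by
  rintro ⟨_, T, hT, rfl⟩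
  exact ⟨⟨T, hT⟩, Subtype.ext (coe_heckePi _)⟩

lemma coe_starSubalgebra_inclusion {A : Type*} [Ring A] [StarRing A] [Algebra ℂ A] [StarModule ℂ A]
    {S S' : StarSubalgebra ℂ A} (h : S ≤ S') (x : S) : (StarSubalgebra.inclusion h x : A) = x := rfl

/-- Away from the excluded parameters the Hecke C⋆-algebra embeds into the Calkin algebra. -/
lemma eq_zero_of_isCompactOperator_inclusion [Finite B] {q : B → ℝ} (hq : q ∈ paramSet cs)
    (hq' : q ∉ excludedSet cs) (T : heckeCStar cs q)
    (h : IsCompactOperator (StarSubalgebra.inclusion (heckeCStar_le hq) T : L2 W →L[ℂ] L2 W)) :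
    T = 0 := by
  rw [coe_starSubalgebra_inclusion] at h
  exact ZeroMemClass.coe_eq_zero.1
    (eq_zero_of_mem_heckeCStar_of_isCompactOperator cs hq hq' T.2 h)

end CalkinQuotient

end HeckeBoundary

theorem corollary6 {B W : Type*} [Finite B] [Group W] {M : CoxeterMatrix B}
    (cs : CoxeterSystem M W) :
    ∃ κ : (allHecke cs).map (calkinMap (L2 W)) ≃⋆ₐ[ℂ] ReducedCrossedProduct W (Boundary cs),
      (∀ w : W, κ (heckePi cs ⟨weakProj cs w, weakProj_mem w⟩) =
        ReducedCrossedProduct.coeff (boundaryChar cs w)) ∧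
      (∀ w : W, κ (heckePi cs ⟨leftTranslation w, leftTranslation_mem w⟩) =
        ReducedCrossedProduct.unitary w) ∧
      ∀ (q : B → ℝ) (hq : q ∈ paramSet cs), q ∉ excludedSet cs →
        Function.Injective
          ((κ : (allHecke cs).map (calkinMap (L2 W)) →⋆ₐ[ℂ]
            ReducedCrossedProduct W (Boundary cs)).comp
              ((heckePi cs).comp (StarSubalgebra.inclusion (heckeCStar_le hq)))) := by
  obtain ⟨Φ, hΦ⟩ := exists_limitMap cs
  have hker : ∀ T, heckePi cs T = 0 ↔ Φ T = 0 := fun T => by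
    rw [heckePi_eq_zero_iff]
    constructor
    · exact fun h => Subtype.ext ((hΦ T).eq_zero_of_isCompactOperator h)
    · intro h
      have h1 := hΦ T
      rw [h] at h1
      exact h1.isCompactOperator (allHecke_le_closure_finitePropagation cs T.2)
  obtain ⟨κ, hκ⟩ := exists_starAlgEquiv_of_ker_eq (heckePi cs) Φ surjective_heckePi
    (surjective_of_strongLimit hΦ) hker
  refine ⟨κ, fun w => ?_, fun w => ?_, fun q hq hq' => ?_⟩
  · rw [hκ]
    exact Subtype.ext ((hΦ _).unique (strongLimit_weakProj w))
  · rw [hκ]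
    exact Subtype.ext ((hΦ _).unique (strongLimit_leftTranslation w))
  · rw [injective_iff_map_eq_zero]
    intro T hT
    have h1 : κ (heckePi cs (StarSubalgebra.inclusion (heckeCStar_le hq) T)) = 0 := hT
    rw [map_eq_zero_iff κ κ.injective, heckePi_eq_zero_iff] at h1
    exact eq_zero_of_isCompactOperator_inclusion hq hq' T h1
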